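/- All graphs and groups are finite. **Weisfeiler–Leman.** For $k\ge 2$, count-free $k$-WL colours the $k$-tuples over a structure by $\chi_{r+1}(\bar v)=\bigl(\chi_r(\bar v),\{(\chi_r(\bar v(v_1/x)),\dots,\chi_r(\bar v(v_k/x))) : x\}\bigr)$, where $\bar v(v_i/x)$ is $\bar v$ with its $i$-th entry replaced by $x$. For graphs, $\chi_0(\bar v)$ records which $v_i=v_j$ and which $v_iv_j$ are edges; for groups (Version I), $\chi_0(\bar g)$ records which $g_i=g_j$ and which $g_ig_j=g_\ell$. A graph $\Gamma$ is *identified* by count-free $(k,r)$-WL if every graph $\Delta\not\cong\Gamma$ has a different number of vertices or a different set of colours $\chi_r$ of $k$-tuples. **CFI graphs.** For a graph $\Gamma$, $\mathrm{CFI}(\Gamma)$ has, for every vertex $v$, a gadget with external vertices $a^v_w,b^v_w$ for each neighbour $w$ of $v$ and internal vertices $m^v_S$ for each set $S$ of neighbours of $v$ of even size; $m^v_S$ is adjacent to $b^v_w$ for $w\in S$ and to $a^v_w$ for neighbours $w\notin S$; for every edge $vw$ of $\Gamma$ there are the edges $a^v_wa^w_v$ and $b^v_wb^w_v$. The twisted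 graph $\widetilde{\mathrm{CFI}(\Gamma)}$ is obtained by choosing one edge $vw$ of $\Gamma$ and replacing these two edges by $a^v_wb^w_v$ and $b^v_wa^w_v$. **Mekler groups.** For a prime $p>2$ and a graph $\Gamma$ with vertices $v_1,\dots,v_N$, $$G_\Gamma=\langle x_1,\dots,x_N \mid x_i^p,\ [[x_i,x_j],x_k]\ (\text{all } i,j,k),\ [x_i,x_j]\ (v_iv_j\in E(\Gamma))\rangle .$$ **Complexity.** Circuits have AND, OR, NOT (and, where stated, Majority) gates of unbounded fan-in, and families are first-order uniform (gate types, wires and outputs are definable over $\{0,\dots,n+1\}$ with $<,+,\times,\mathrm{BIT}$). $\mathsf{FOLL}$: polynomial size and depth $O(\log\log n)$, no Majority gates. $\mathsf{MAC}^0$: polynomial size, constant depth, at most one Majority gate, at the output. $L\in\beta_1\mathsf{MAC}^0$ iff there is $L'\in\mathsf{MAC}^0$ such that $x\in L$ iff $(x,y)\in L'$ for some $y$ with $|y|=O(\log|x|)$. $\beta_1\mathsf{MAC}^0(\mathsf{FOLL})$ is the class of compositions $g\circ f$ with $f$ computable in $\mathsf{FOLL}$ and $g$ in $\beta_1\mathsf{MAC}^0$.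 Groups are given by Cayley tables. An isomorphism problem with a promise is *decidable* in the class if each of isomorphism and non-isomorphism agrees, on all inputs that satisfy the promise, with some language in the class. **Theorem.** Let $p>2$ be a prime and $\Gamma_0$ a connected $3$-regular graph. Put $\Gamma_1=\mathrm{CFI}(\Gamma_0)$, $\Gamma_2=\widetilde{\mathrm{CFI}(\Gamma_0)}$ (for any choice of the twisted edge), $G_i=G_{\Gamma_i}$ and $n=|G_i|$. The constants in $O(\cdot)$ below are absolute. (a) The multisets of colours of all $k$-tuples computed by $O(\log\log n)$ rounds of count-free $k$-WL Version I, for some $k=O(1)$, are different for $G_1$ and $G_2$. Isomorphism of two groups $G,H$, under the promise that each is isomorphic to $G_1$ or $G_2$ for a common (not given) $p$ and $\Gamma_0$, is decidable in $\beta_1\mathsf{MAC}^0(\mathsf{FOLL})$. (b) If moreover $\Gamma_0$ is identified by count-free $(3,r)$-WL, then for each $i\in\{1,2\}$ and every group $H\not\cong G_i$ the multisets of colours of all $k$-tuples computed by $\max\{r,O(\log\log n)\}$ rounds of count-free $k$-WL Version I, for some $k=O(1)$, are different for $G_i$ and $H$. Isomorphism of two groups $G,H$, under the promise that $G$ is isomorphic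 to $G_1$ or $G_2$ for some $p$ and some such $\Gamma_0$ (identified by count-free $(3,r)$-WL for some $r$), with $H$ arbitrary, is decidable in $\beta_1\mathsf{MAC}^0(\mathsf{FOLL})$. -/

import Mathlib

namespace CFIGroups

/-! ### Count-free Weisfeiler--Leman -/

/-- Colours of the count-free `k`-dimensional refinement after `r` rounds, over initial colours
`I`: a colour of round `r + 1` is a colour of round `r` together with a set of `k`-tuples of
colours of round `r`. The type does not depend on the structure that is coloured, so colours of
tuples over different structures can be compared. -/
def WLColor (k : ℕ) (I : Type) : ℕ → Type
  | 0 => I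
  | r + 1 => WLColor k I r × Set (Fin k → WLColor k I r)

/-- The count-free colouring
`χ_{r+1}(v) = (χ_r(v), { (χ_r(v(v₁/x)), …, χ_r(v(v_k/x))) | x })` with `χ₀ = init`. -/
def wlColor {k : ℕ} {I α : Type} (init : (Fin k → α) → I) :
    (r : ℕ) → (Fin k → α) → WLColor k I r
  | 0, v => init v
  | r + 1, v =>
    (wlColor init r v, Set.range fun (x : α) (i : Fin k) => wlColor init r (Function.update v i x))

/-- Initial colour of a tuple of vertices: its equalities and its adjacencies. -/
def graphInit {V : Type} (Γ : SimpleGraph V) {k : ℕ} (v : Fin k → V) :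
    (Fin k → Fin k → Prop) × (Fin k → Fin k → Prop) :=
  (fun i j => v i = v j, fun i j => Γ.Adj (v i) (v j))

/-- Initial colour of a tuple of group elements in Version I: its equalities and the products
`g i * g j = g l` that hold in it. -/
def groupInit {G : Type} [Group G] {k : ℕ} (g : Fin k → G) :
    (Fin k → Fin k → Prop) × (Fin k → Fin k → Fin k → Prop) :=
  (fun i j => g i = g j, fun i j l => g i * g j = g l)

/-- Two finite graphs are distinguished by count-free `(k, r)`-WL: they have different numbers of
vertices, or the sets of colours of `k`-tuples after `r` rounds differ. -/
def GraphDistinguished (k r : ℕ) {V W : Type} (Γ : SimpleGraph V) (Δ : SimpleGraph W) : Prop :=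
  Nat.card V ≠ Nat.card W ∨
    Set.range (wlColor (graphInit Γ (k := k)) r) ≠ Set.range (wlColor (graphInit Δ (k := k)) r)

/-- `Γ` is identified by count-free `(k, r)`-WL: it is distinguished from every finite graph that
is not isomorphic to it. -/
def GraphIdentified (k r : ℕ) {V : Type} (Γ : SimpleGraph V) : Prop :=
  ∀ (W : Type) [Finite W] (Δ : SimpleGraph W),
    IsEmpty (Γ ≃g Δ) → GraphDistinguished k r Γ Δ

/-- The multiplicity of the colour `c` in the multiset of colours of all `k`-tuples over `G` after
`r` rounds of count-free WL Version I. -/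
noncomputable def colorMultiplicity (G : Type) [Group G] (k r : ℕ)
    (c : WLColor k ((Fin k → Fin k → Prop) × (Fin k → Fin k → Fin k → Prop)) r) : ℕ :=
  Nat.card {g : Fin k → G // wlColor groupInit r g = c}

/-- The multisets of colours computed by `r` rounds of the count-free `k`-dimensional WL Version I
on the finite groups `G` and `H` are different. -/
def ColorMultisetsDiffer (k r : ℕ) (G H : Type) [Group G] [Group H] : Prop :=
  ∃ c, colorMultiplicity G k r c ≠ colorMultiplicity H k r c

/-- `⌊log₂ ⌊log₂ n⌋⌋`. -/
def loglog (n : ℕ) : ℕ := Nat.log 2 (Nat.log 2 n)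

/-! ### CFI graphs and Mekler's groups -/

/-- Finite connected `3`-regular graphs. -/
def IsBaseGraph {V : Type} (Γ : SimpleGraph V) : Prop :=
  Finite V ∧ Γ.Connected ∧ ∃ _ : Γ.LocallyFinite, Γ.IsRegularOfDegree 3

/-- Vertices of the CFI graphs over `Γ`. The gadget of `v` has the external vertices `ext d b` for
the darts `d` (oriented edges) that start at `v`, where `b = false` is the vertex `a` and
`b = true` is the vertex `b` of the pair belonging to the edge `d`, and the internal vertices
`int v S`, one for each even set `S` of neighbours of `v` (the set of positions of the bits `1`
in the string that labels the internal vertex). -/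
inductive CFIVertex {V : Type} (Γ : SimpleGraph V) : Type
  | ext (d : Γ.Dart) (b : Bool) : CFIVertex Γ
  | int (v : V) (S : Finset V) (sub : ∀ w ∈ S, Γ.Adj v w) (even : Even S.card) : CFIVertex Γ

/-- Adjacency in the CFI graph over `Γ` in which exactly the edges in `T` are twisted. -/
def CFIAdj {V : Type} (Γ : SimpleGraph V) (T : Set (Sym2 V)) : CFIVertex Γ → CFIVertex Γ → Prop
  | .ext d b, .ext d' b' => d' = d.symm ∧ (b' = b ↔ d.edge ∉ T)
  | .ext d b, .int v S _ _ => d.fst = v ∧ (b = true ↔ d.snd ∈ S)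
  | .int v S _ _, .ext d b => d.fst = v ∧ (b = true ↔ d.snd ∈ S)
  | .int _ _ _ _, .int _ _ _ _ => False

/-- The graph obtained from `CFI(Γ)` by twisting exactly the edges in `T`. -/
def twistedCFI {V : Type} (Γ : SimpleGraph V) (T : Set (Sym2 V)) : SimpleGraph (CFIVertex Γ) where
  Adj := CFIAdj Γ T
  symm := by
    refine ⟨?_⟩
    rintro (⟨d, b⟩ | ⟨v, S, h₁, h₂⟩) (⟨d', b'⟩ | ⟨v', S', h₁', h₂'⟩) h
    · obtain ⟨rfl, h⟩ := h
      refine ⟨d.symm_symm.symm, ?_⟩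
      rw [SimpleGraph.Dart.edge_symm, eq_comm]
      exact h
    · exact h
    · exact h
    · exact h
  loopless := by
    refine ⟨?_⟩
    rintro (⟨d, b⟩ | ⟨v, S, h₁, h₂⟩) h
    · exact d.symm_ne h.1.symm
    · exact h

/-- `CFI(Γ)`. -/
def CFI {V : Type} (Γ : SimpleGraph V) : SimpleGraph (CFIVertex Γ) := twistedCFI Γ ∅

open scoped commutatorElement in
/-- The relators of Mekler's construction on the generating set of vertices: `p`-th powers of the
generators, triple commutators of the generators, and commutators of adjacent generators. -/
def meklerRels (p : ℕ) {W : Type} (Γ : SimpleGraph W) : Set (FreeGroup W) :=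
  {a | ∃ x : W, a = FreeGroup.of x ^ p} ∪
  {a | ∃ x y z : W, a = ⁅⁅FreeGroup.of x, FreeGroup.of y⁆, FreeGroup.of z⁆} ∪
  {a | ∃ x y : W, Γ.Adj x y ∧ a = ⁅FreeGroup.of x, FreeGroup.of y⁆}

/-- The class `2`, exponent `p` group of the graph `Γ`. -/
abbrev MeklerGroup (p : ℕ) {W : Type} (Γ : SimpleGraph W) : Type :=
  PresentedGroup (meklerRels p Γ)

/-! ### Uniform circuits

A family of circuits has, for inputs of length `n`, the `k`-tuples of numbers in `{0, …, n + 1}`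
as its gates, for a constant `k`; hence its size is the polynomial `(n + 2) ^ k`. Uniformity is
first-order uniformity: gate types, wires and outputs are defined, for all `n`, by fixed first-order
formulas over the numbers `{0, …, n + 1}` with order, addition, multiplication and `BIT`. -/

/-- Relation symbols of the language of arithmetic with `BIT`. -/
inductive ArithRel : ℕ → Type
  | lt : ArithRel 2
  | add : ArithRel 3
  | mul : ArithRel 3
  | bit : ArithRel 2

/-- The relational language of `<`, `+`, `×`, `BIT`. -/
def arith : FirstOrder.Language := ⟨fun _ => Empty, ArithRel⟩

/-- The arithmetic structure on `{0, …, m - 1}`; `+` and `×` are the graphs of the operations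
of `ℕ`, and `bit i a` says that the bit of weight `2 ^ i` in `a` is `1`. -/
instance arithStructure (m : ℕ) : arith.Structure (Fin m) where
  funMap := fun f _ => f.elim
  RelMap := fun {_} R => match R with
    | .lt => fun v => (v 0 : ℕ) < v 1
    | .add => fun v => (v 0 : ℕ) + v 1 = v 2
    | .mul => fun v => (v 0 : ℕ) * v 1 = v 2
    | .bit => fun v => Nat.testBit (v 1 : ℕ) (v 0 : ℕ) = true

/-- A family of relations on `{0, …, n + 1}`, one for each `n`, is defined by one formula. -/
def FODefinable {α : Type} (R : ∀ n : ℕ, (α → Fin (n + 2)) → Prop) : Prop :=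
  ∃ φ : arith.Formula α, ∀ (n : ℕ) (v : α → Fin (n + 2)), R n v ↔ φ.Realize v

/-- Gate types of circuits with `n` input bits. -/
inductive GateKind (n : ℕ) : Type
  | input (i : Fin n)
  | and
  | or
  | not
  | maj

/-- Gates: `k`-tuples over `{0, …, n + 1}`. -/
abbrev Gate (n k : ℕ) : Type := Fin k → Fin (n + 2)

/-- Boolean circuits with `n` input bits and unbounded fan-in; `wire h g` says that the gate `h`
is an input of the gate `g`. -/
structure Circuit (n k : ℕ) where
  kind : Gate n k → GateKind n
  wire : Gate n k → Gate n k → Prop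
  acyclic : WellFounded wire
  not_fanin : ∀ g, kind g = GateKind.not → ∃! h, wire h g

/-- The value of a gate on the input `x`. A majority gate is `1` iff more than half of its inputs
are `1`. -/
def Circuit.eval {n k : ℕ} (C : Circuit n k) (x : Fin n → Bool) : Gate n k → Prop :=
  C.acyclic.fix fun g val =>
    match C.kind g with
    | .input i => x i = true
    | .and => ∀ h (w : C.wire h g), val h w
    | .or => ∃ h, ∃ w : C.wire h g, val h w
    | .not => ∀ h (w : C.wire h g), ¬ val h w
    | .maj => Nat.card {h // C.wire h g} < 2 * Nat.card {h // ∃ w : C.wire h g, val h w}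

/-- Every directed path in the circuit has at most `d` wires. -/
def Circuit.DepthLE {n k : ℕ} (C : Circuit n k) (d : ℕ) : Prop :=
  ∃ level : Gate n k → ℕ, (∀ h g, C.wire h g → level h < level g) ∧ ∀ g, level g ≤ d

/-- First-order uniform families of circuits. -/
structure Uniform {k : ℕ} (C : ∀ n, Circuit n k) : Prop where
  input : FODefinable (α := Fin k ⊕ Unit) fun n v =>
    ∃ i : Fin n, (C n).kind (v ∘ Sum.inl) = GateKind.input i ∧ (i : ℕ) = v (Sum.inr ())
  and : FODefinable fun n g => (C n).kind g = GateKind.and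
  or : FODefinable fun n g => (C n).kind g = GateKind.or
  not : FODefinable fun n g => (C n).kind g = GateKind.not
  maj : FODefinable fun n g => (C n).kind g = GateKind.maj
  wire : FODefinable (α := Fin k ⊕ Fin k) fun n v =>
    (C n).wire (v ∘ Sum.inl) (v ∘ Sum.inr)

/-! ### Complexity classes -/

/-- The number with the base `n + 2` digits `v`. -/
def tupleIndex {n l : ℕ} (v : Fin l → Fin (n + 2)) : ℕ := ∑ i, (v i : ℕ) * (n + 2) ^ (i : ℕ)

/-- Functions computed by uniform families of AND/OR/NOT circuits of polynomial size and depth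
`O(log log n)`. On inputs of length `n` the output has `len n` bits, and `out n j` is the gate
that computes bit `j`. -/
def FOLLComputable (f : List Bool → List Bool) : Prop :=
  ∃ (k l c : ℕ) (C : ∀ n, Circuit n k) (len : ℕ → ℕ) (out : ∀ n, ℕ → Gate n k),
    Uniform C ∧
    (∀ n, (C n).DepthLE (c * loglog n + c)) ∧
    (∀ n g, (C n).kind g ≠ GateKind.maj) ∧
    (∀ n, len n ≤ (n + 2) ^ l) ∧
    FODefinable (α := Fin l ⊕ Fin k) (fun n v =>
      tupleIndex (v ∘ Sum.inl) < len n ∧ out n (tupleIndex (v ∘ Sum.inl)) = v ∘ Sum.inr) ∧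
    ∀ x : List Bool, (f x).length = len x.length ∧
      ∀ (j : ℕ) (hj : j < (f x).length),
        ((f x)[j] = true ↔ (C x.length).eval x.get (out x.length j))

/-- `MAC⁰`: languages decided by uniform families of circuits of constant depth and polynomial size
with AND, OR, NOT gates and at most one majority gate, which is at the output. -/
def MAC0 : Set (Set (List Bool)) :=
  {L | ∃ (k d : ℕ) (C : ∀ n, Circuit n k) (out : ∀ n, Gate n k),
    Uniform C ∧
    FODefinable (fun n g => out n = g) ∧
    (∀ n, (C n).DepthLE d) ∧
    (∀ n g, (C n).kind g = GateKind.maj → g = out n) ∧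
    ∀ x : List Bool, x ∈ L ↔ (C x.length).eval x.get (out x.length)}

/-- Encoding of a pair of strings as one string: the bits of `x` doubled, then `01`, then `y`. -/
def pairCode (x y : List Bool) : List Bool :=
  (x.flatMap fun b => [b, b]) ++ [false, true] ++ y

/-- `β_i 𝒞`: languages `L` with `x ∈ L` iff there is `y` of length `O(log^i |x|)` such that
`(x, y)` lies in a fixed language of `𝒞`. -/
def beta (i : ℕ) (𝒞 : Set (Set (List Bool))) : Set (Set (List Bool)) :=
  {L | ∃ L' ∈ 𝒞, ∃ c : ℕ, ∀ x : List Bool,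
    x ∈ L ↔ ∃ y : List Bool, y.length ≤ c * Nat.log 2 x.length ^ i + c ∧ pairCode x y ∈ L'}

/-- `β₁MAC⁰(FOLL)`: languages whose characteristic function is `g ∘ f` with `f` computable in `FOLL`
and `g` the characteristic function of a language in `β₁MAC⁰`. -/
def beta1MAC0FOLL : Set (Set (List Bool)) :=
  {L | ∃ f, FOLLComputable f ∧ ∃ M ∈ beta 1 MAC0, ∀ x, x ∈ L ↔ f x ∈ M}

/-! ### Isomorphism problems for groups given by Cayley tables -/

/-- The Cayley table of a group with elements labelled `0, …, n - 1`: the order `n` in unary,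
terminated by `0`, and then the `n ^ 2` entries row by row, each with `⌈log₂ n⌉` bits. -/
def cayleyCode {G : Type} [Group G] {n : ℕ} (e : Fin n ≃ G) : List Bool :=
  List.replicate n true ++ [false] ++
    (List.finRange n).flatMap fun i => (List.finRange n).flatMap fun j =>
      List.ofFn fun t : Fin (Nat.clog 2 n) => Nat.testBit (e.symm (e i * e j) : ℕ) t

/-- Isomorphism of two groups `G`, `H` given by Cayley tables, under the promise `P G H`, is decided
in the class `𝒞`. As `𝒞` need not be closed under complement, both isomorphism
and non-isomorphism are required to be accepted by languages in `𝒞`. -/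
def IsoDecidableIn (𝒞 : Set (Set (List Bool)))
    (P : (G H : Type) → [Group G] → [Group H] → Prop) : Prop :=
  (∃ L ∈ 𝒞, ∀ (G H : Type) [Group G] [Group H] (n m : ℕ) (e : Fin n ≃ G) (e' : Fin m ≃ H),
    P G H → (cayleyCode e ++ cayleyCode e' ∈ L ↔ Nonempty (G ≃* H))) ∧
  (∃ L ∈ 𝒞, ∀ (G H : Type) [Group G] [Group H] (n m : ℕ) (e : Fin n ≃ G) (e' : Fin m ≃ H),
    P G H → (cayleyCode e ++ cayleyCode e' ∈ L ↔ ¬ Nonempty (G ≃* H)))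

/-- `G` is isomorphic to the Mekler group of `CFI(Γ)` or of the twisted CFI graph of `Γ`. -/
def IsCFIGroup (p : ℕ) {V : Type} (Γ : SimpleGraph V) (G : Type) [Group G] : Prop :=
  Nonempty (G ≃* MeklerGroup p (CFI Γ)) ∨
    ∃ e ∈ Γ.edgeSet, Nonempty (G ≃* MeklerGroup p (twistedCFI Γ {e}))

end CFIGroups

open CFIGroups

/-! Count-free refinement is used through a pebble game: a predicate with few variables and
quantifier depth `r` cannot separate tuples that have the same colour after `r` rounds (`WLInv`;
each quantifier costs one round). Composing `2 ^ s` relations costs `s` extra rounds by halving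
(`WLInv.relComp`), and powers with exponents up to `2 ^ 2 ^ t` cost `O(t)` rounds (`WLInv.pow`). A
Mekler group of order `n` over a graph with vertex set `W` has `|W| ≤ log n` and, for nonempty `W`,
`p ≤ n`. Hence paths in the graph, products over all pairs of vertices and `p`-th powers are all
within reach of `O(log log n)` rounds.

CFI graphs of connected cubic graphs, twisted or not, are connected, have neither triangles nor
4-cycles, and have degrees 2 or more and at most 3. Over such a graph, commutation in the Mekler
group is read off from exponent vectors: for each nonadjacent pair of vertices a Heisenberg quotient
detects the commutator (`mekler_commute_iff`). The centre is the kernel of the exponent vector, and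
the noncentral elements with nonabelian centralizer are exactly those supported at a single vertex
(`isVertexLike_iff`). Colour the vertices with ten colours that differ on the neighbours of every
vertex, and pebble one generator together with, for each colour, the product of the generators of
that colour. A vertex is then named by the colours along a path from the root, and its generator
becomes definable up to central factors (`exists_atPath`).

If the pebbled tuple is equivalent to a tuple over a group `H`, the same definitions pick elements
of `H` that satisfy the relators, which gives a homomorphism into `H`. If a product of commutators
dies in `H`, the assertion that it is trivial is itself definable and transfers back, so the
homomorphism is injective (`exists_embedding`). Equal orders turn it into an isomorphism
(`mekler_iso_of_wlEquiv`).

That the groups of the two CFI graphs differ is seen in two steps. The graph is recovered from its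
group (`graph_iso_of_mekler_iso`). An isomorphism of the graphs would carry the internal vertices
labelled by empty sets to a family of even sets, one per base vertex, that disagree along exactly
one edge, which parity forbids (`cfi_not_iso`, `no_odd_section`).

For the complexity bound, one round of refinement is a first-order formula over the input and the
previous round. It is evaluated by a uniform block of constant depth, and `O(log log n)` blocks stay
in `FOLL`. The outer `β₁MAC⁰` computation only reads the resulting bit or its negation. As any
equivalent pair of tuples over groups of equal order already forces isomorphism, comparing constant
tuples is enough. -/

namespace CFIGroups

/-! ### Count-free equivalence of tuples and invariant predicates -/

/-- The tuples `g` and `h` over two groups have the same colour after `r` rounds. -/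
def WLEquiv {k : ℕ} {G H : Type} [Group G] [Group H] (r : ℕ) (g : Fin k → G) (h : Fin k → H) :
    Prop :=
  wlColor groupInit r g = wlColor groupInit r h

section WLEquiv

variable {k : ℕ} {G H : Type} [Group G] [Group H]

/-- Equality of the two sets of colour tuples is mutual inclusion, which is the back-and-forth
condition of the pebble game. One answer `y` has to serve all positions `i` at once. -/
theorem wlEquiv_succ {r : ℕ} {g : Fin k → G} {h : Fin k → H} :
    WLEquiv (r + 1) g h ↔ WLEquiv r g h ∧
      (∀ x, ∃ y, ∀ i, WLEquiv r (Function.update g i x) (Function.update h i y)) ∧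
      (∀ y, ∃ x, ∀ i, WLEquiv r (Function.update g i x) (Function.update h i y)) := by
  refine Prod.mk_inj.trans (and_congr Iff.rfl ?_)
  refine ⟨fun hs => ⟨fun x => ?_, fun y => ?_⟩, fun ⟨h₁, h₂⟩ => ?_⟩
  · have hx := Set.mem_range_self (f := fun (x : G) (i : Fin k) =>
      wlColor groupInit r (Function.update g i x)) x
    rw [hs] at hx
    obtain ⟨y, hy⟩ := hx
    exact ⟨y, fun i => (congrFun hy i).symm⟩
  · have hy := Set.mem_range_self (f := fun (x : H) (i : Fin k) =>
      wlColor groupInit r (Function.update h i x)) y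
    rw [← hs] at hy
    obtain ⟨x, hx⟩ := hy
    exact ⟨x, fun i => congrFun hx i⟩
  · apply Set.Subset.antisymm
    · rintro _ ⟨x, rfl⟩
      obtain ⟨y, hy⟩ := h₁ x
      exact ⟨y, funext fun i => (hy i).symm⟩
    · rintro _ ⟨y, rfl⟩
      obtain ⟨x, hx⟩ := h₂ y
      exact ⟨x, funext fun i => hx i⟩

theorem wlEquiv_zero {g : Fin k → G} {h : Fin k → H} :
    WLEquiv 0 g h ↔ (∀ i j, g i = g j ↔ h i = h j) ∧
      ∀ i j l, g i * g j = g l ↔ h i * h j = h l := by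
  refine Prod.mk_inj.trans ?_
  simp [funext_iff]

theorem WLEquiv.symm {r : ℕ} {g : Fin k → G} {h : Fin k → H} (e : WLEquiv r g h) :
    WLEquiv r h g := Eq.symm e

theorem WLEquiv.mono {r s : ℕ} (hrs : r ≤ s) {g : Fin k → G} {h : Fin k → H}
    (e : WLEquiv s g h) : WLEquiv r g h := by
  induction s, hrs using Nat.le_induction with
  | base => exact e
  | succ s _ ih => exact ih (wlEquiv_succ.1 e).1

theorem WLEquiv.of_mulEquiv (φ : G ≃* H) (r : ℕ) (g : Fin k → G) : WLEquiv r g (φ ∘ g) := by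
  induction r generalizing g with
  | zero =>
    rw [wlEquiv_zero]
    refine ⟨fun i j => by simp, fun i j l => ?_⟩
    simp only [Function.comp_apply, ← map_mul, EmbeddingLike.apply_eq_iff_eq]
  | succ r ih =>
    rw [wlEquiv_succ]
    refine ⟨ih g, fun x => ⟨φ x, fun i => ?_⟩, fun y => ⟨φ.symm y, fun i => ?_⟩⟩
    · simpa only [Function.comp_update] using ih (Function.update g i x)
    · simpa only [Function.comp_update, φ.apply_symm_apply] using
        ih (Function.update g i (φ.symm y))

/-- If the tuples `g` and `h` are equivalent, then every tuple over the first group has an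
equivalent tuple over the second group, at the price of one round for each entry. -/
theorem WLEquiv.exists_tuple {r : ℕ} {g : Fin k → G} {h : Fin k → H} (e : WLEquiv (r + k) g h)
    (g' : Fin k → G) : ∃ h' : Fin k → H, WLEquiv r g' h' := by
  -- Hybrid tuples: the first `j` entries come from `g'`, the others from `g`. Each exchange uses
  -- one round, and only the replacement at position `j`.
  suffices ∀ j ≤ k, ∃ h', WLEquiv (r + (k - j)) (fun i : Fin k => if i < j then g' i else g i) h' by
    obtain ⟨h', hh⟩ := this k le_rfl
    exact ⟨h', by simpa using hh⟩
  intro j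
  induction j with
  | zero => exact fun _ => ⟨h, by simpa using e⟩
  | succ j ih =>
    intro hj
    obtain ⟨h', hh⟩ := ih (by omega)
    have : r + (k - j) = r + (k - (j + 1)) + 1 := by omega
    rw [this, wlEquiv_succ] at hh
    obtain ⟨y, hy⟩ := hh.2.1 (g' ⟨j, hj⟩)
    refine ⟨_, (congrArg (WLEquiv _ · _) ?_).mp (hy ⟨j, hj⟩)⟩
    funext i
    by_cases hi : i = ⟨j, hj⟩
    · subst hi; simp
    · have : (i : ℕ) ≠ j := fun h => hi (Fin.ext h)
      rw [Function.update_of_ne hi]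
      congr 1
      apply propext; omega

end WLEquiv

/-- The predicate `P` on tuples of group elements takes the same value on tuples of pebbled
elements of any two groups that are equivalent after `r` rounds of the `k`-dimensional
refinement. -/
def WLInv (k r : ℕ) {α : Type} (P : ∀ (K : Type) [Group K], (α → K) → Prop) : Prop :=
  ∀ (G H : Type) [Group G] [Group H] (g : Fin k → G) (h : Fin k → H), WLEquiv r g h →
    ∀ σ : α → Fin k, P G (g ∘ σ) ↔ P H (h ∘ σ)

namespace WLInv

variable {k r : ℕ} {α β : Type} {P Q : ∀ (K : Type) [Group K], (α → K) → Prop}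

theorem mono {s : ℕ} (h : WLInv k r P) (hrs : r ≤ s) : WLInv k s P :=
  fun G H _ _ g g' e σ => h G H g g' (e.mono hrs) σ

theorem reindex (h : WLInv k r P) (f : α → β) :
    WLInv k r (fun K _ (v : β → K) => P K (fun a => v (f a))) :=
  fun G H _ _ g g' e σ => h G H g g' e (σ ∘ f)

theorem and (hP : WLInv k r P) (hQ : WLInv k r Q) : WLInv k r (fun K _ v => P K v ∧ Q K v) :=
  fun G H _ _ g g' e σ => and_congr (hP G H g g' e σ) (hQ G H g g' e σ)

theorem or (hP : WLInv k r P) (hQ : WLInv k r Q) : WLInv k r (fun K _ v => P K v ∨ Q K v) :=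
  fun G H _ _ g g' e σ => or_congr (hP G H g g' e σ) (hQ G H g g' e σ)

theorem not (hP : WLInv k r P) : WLInv k r (fun K _ v => ¬ P K v) :=
  fun G H _ _ g g' e σ => not_congr (hP G H g g' e σ)

theorem imp (hP : WLInv k r P) (hQ : WLInv k r Q) : WLInv k r (fun K _ v => P K v → Q K v) :=
  fun G H _ _ g g' e σ => imp_congr (hP G H g g' e σ) (hQ G H g g' e σ)

theorem iff (hP : WLInv k r P) (hQ : WLInv k r Q) : WLInv k r (fun K _ v => (P K v ↔ Q K v)) :=
  fun G H _ _ g g' e σ => iff_congr (hP G H g g' e σ) (hQ G H g g' e σ)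

theorem congr (hP : WLInv k r P) (h : ∀ (K : Type) [Group K] (v : α → K), P K v ↔ Q K v) :
    WLInv k r Q :=
  fun G H _ _ g g' e σ => ((h G _).symm.trans (hP G H g g' e σ)).trans (h H _)

theorem eq (a b : α) : WLInv k r (fun _ _ v => v a = v b) :=
  fun _ _ _ _ _ _ e σ => (wlEquiv_zero.1 (e.mono r.zero_le)).1 (σ a) (σ b)

theorem mul (a b c : α) : WLInv k r (fun _ _ v => v a * v b = v c) :=
  fun _ _ _ _ _ _ e σ => (wlEquiv_zero.1 (e.mono r.zero_le)).2 (σ a) (σ b) (σ c)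

/-- With fewer named elements than pebbles, some position lies outside the range of `σ`. The witness
is placed there without disturbing the named elements, and the other side answers in one round. -/
theorem ex [Fintype α] (hk : Fintype.card α < k)
    {P : ∀ (K : Type) [Group K], K → (α → K) → Prop}
    (hP : WLInv k r (α := Option α) fun K _ v => P K (v none) (fun a => v (some a))) :
    WLInv k (r + 1) (fun K _ v => ∃ x, P K x v) := by
  intro G H _ _ g h e σ
  obtain ⟨i, hi⟩ : ∃ i, i ∉ Set.range σ := by
    by_contra hc
    push Not at hc
    have := Fintype.card_le_of_surjective σ hc
    simp at this; omega
  have hne : ∀ a, σ a ≠ i := fun a ha => hi ⟨a, ha⟩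
  have key : ∀ x y, WLEquiv r (Function.update g i x) (Function.update h i y) →
      (P G x (g ∘ σ) ↔ P H y (h ∘ σ)) := by
    intro x y exy
    have := hP G H _ _ exy (fun o => o.elim i σ)
    have h1 : ∀ {K : Type} (f : Fin k → K) (z : K),
        (fun a => Function.update f i z (σ a)) = f ∘ σ := by
      intro K f z; funext a; simp [hne a]
    simpa [h1] using this
  rw [wlEquiv_succ] at e
  constructor
  · rintro ⟨x, hx⟩
    obtain ⟨y, hy⟩ := e.2.1 x
    exact ⟨y, (key x y (hy i)).1 hx⟩
  · rintro ⟨y, hy⟩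
    obtain ⟨x, hx⟩ := e.2.2 y
    exact ⟨x, (key x y (hx i)).2 hy⟩

theorem all [Fintype α] (hk : Fintype.card α < k)
    {P : ∀ (K : Type) [Group K], K → (α → K) → Prop}
    (hP : WLInv k r (α := Option α) fun K _ v => P K (v none) (fun a => v (some a))) :
    WLInv k (r + 1) (fun K _ v => ∀ x, P K x v) :=
  (ex (P := fun K _ x v => ¬ P K x v) hk hP.not).not.congr fun _ _ _ => by simp

end WLInv

/-- Composition of a list of binary relations. -/
def RelComp {K : Type} : List (K → K → Prop) → K → K → Prop
  | [], x, y => x = y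
  | R :: l, x, y => ∃ z, R x z ∧ RelComp l z y

theorem relComp_append {K : Type} (l₁ l₂ : List (K → K → Prop)) (x y : K) :
    RelComp (l₁ ++ l₂) x y ↔ ∃ z, RelComp l₁ x z ∧ RelComp l₂ z y := by
  induction l₁ generalizing x with
  | nil => simp [RelComp]
  | cons R l ih =>
    simp only [List.cons_append, RelComp, ih]
    constructor
    · rintro ⟨z, hz, w, h₁, h₂⟩; exact ⟨w, ⟨z, hz, h₁⟩, h₂⟩
    · rintro ⟨w, ⟨z, hz, h₁⟩, h₂⟩; exact ⟨z, hz, w, h₁, h₂⟩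

/-- Families of binary relations on groups with parameters indexed by `α`. -/
abbrev RelFamily (α : Type) := ∀ (K : Type) [Group K], (α → K) → K → K → Prop

/-- Composing a list of length at most `2 ^ s` costs `s` rounds. -/
theorem WLInv.relComp {k r : ℕ} {α : Type} [Fintype α] (hk : Fintype.card α + 3 ≤ k) (s : ℕ)
    (l : List (RelFamily α)) (hl : l.length ≤ 2 ^ s)
    (h : ∀ R ∈ l, WLInv k r (α := Option (Option α))
      fun K _ v => R K (fun a => v (some (some a))) (v (some none)) (v none)) :
    WLInv k (r + s) (α := Option (Option α)) fun K _ v =>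
      RelComp (l.map fun R => R K (fun a => v (some (some a)))) (v (some none)) (v none) := by
  induction s generalizing l with
  | zero =>
    match l, hl with
    | [], _ => exact WLInv.eq _ _
    | [R], _ => exact (h R (by simp)).congr fun K _ v => by simp [RelComp]
  | succ s ih =>
    -- Halving: one quantifier guesses the midpoint, and both halves are tested at the same round.
    -- So a doubling of the length costs a single round.
    have h₁ := ih (l.take (2 ^ s)) (by simp) fun R hR => h R (List.mem_of_mem_take hR)
    have h₂ := ih (l.drop (2 ^ s)) (by simp; omega) fun R hR => h R (List.mem_of_mem_drop hR)
    have key := WLInv.ex (k := k) (r := r + s) (α := Option (Option α)) (by simp; omega)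
      (P := fun K _ z v =>
        RelComp ((l.take (2 ^ s)).map fun R => R K (fun a => v (some (some a)))) (v (some none)) z ∧
        RelComp ((l.drop (2 ^ s)).map fun R => R K (fun a => v (some (some a)))) z (v none))
      ((h₁.reindex fun o => o.elim none fun o => o.elim (some (some none)) fun a =>
          some (some (some a))).and
        (h₂.reindex fun o => o.elim (some none) fun o => o.elim none fun a =>
          some (some (some a))))
    refine key.congr fun K _ v => ?_
    rw [← relComp_append, ← List.map_append, List.take_append_drop]

/-- The relation `y = x ^ e` with `e ≤ 2 ^ 2 ^ t` costs `O(t)` rounds. -/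
theorem WLInv.pow {k : ℕ} (hk : 6 ≤ k) (t e : ℕ) (he : e ≤ 2 ^ 2 ^ t) :
    WLInv k (3 * t + 1) (α := Fin 2) fun _ _ v => v 1 = v 0 ^ e := by
  induction t generalizing e with
  | zero =>
    have : e = 0 ∨ e = 1 ∨ e = 2 := by simp at he; omega
    rcases this with rfl | rfl | rfl
    · exact ((WLInv.mul 1 1 1).mono (Nat.zero_le _)).congr fun K _ v => by simp
    · exact (WLInv.eq 1 0).congr fun K _ v => by simp
    · exact (WLInv.mul 0 0 1).congr fun K _ v => by rw [pow_two, eq_comm]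
  | succ t ih =>
    -- `B` is the square root of the new bound. In `x ^ e = (x ^ (e / B)) ^ B * x ^ (e % B)` all
    -- three exponents are at most `B`, and the three intermediate values cost three rounds.
    set B := 2 ^ 2 ^ t with hB
    have hBB : 2 ^ 2 ^ (t + 1) = B * B := by rw [pow_succ, mul_two, pow_add]
    have hB0 : 0 < B := by positivity
    have hq : e / B ≤ B := Nat.div_le_of_le_mul (by rw [← hBB]; exact he)
    have hr : e % B ≤ B := (Nat.mod_lt _ hB0).le
    have key : WLInv k (3 * t + 1 + 1 + 1 + 1) (α := Fin 2) fun K _ v =>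
        ∃ u, ∃ w, ∃ z, u = v 0 ^ (e / B) ∧ w = u ^ B ∧ z = v 0 ^ (e % B) ∧ w * z = v 1 := by
      apply WLInv.ex (by simp; omega)
      apply WLInv.ex (by simp; omega)
      apply WLInv.ex (by simp; omega)
      exact ((ih _ hq).reindex ![some (some (some 0)), some (some none)]).and
        (((ih _ le_rfl).reindex ![some (some none), some none]).and
        (((ih _ hr).reindex ![some (some (some 0)), none]).and (WLInv.mul _ _ _)))
    refine (key.mono (by omega)).congr fun K _ v => ?_
    simp only [exists_and_left, exists_eq_left, ← pow_mul, ← pow_add]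
    rw [mul_comm, Nat.div_add_mod, eq_comm]

/-! ### The Heisenberg group -/

/-- The Heisenberg group over `ZMod p`. -/
@[ext] structure Heis (p : ℕ) where
  a : ZMod p
  b : ZMod p
  c : ZMod p

namespace Heis

variable {p : ℕ}

instance : Mul (Heis p) := ⟨fun x y => ⟨x.a + y.a, x.b + y.b, x.c + y.c + x.a * y.b⟩⟩
instance : One (Heis p) := ⟨⟨0, 0, 0⟩⟩
instance : Inv (Heis p) := ⟨fun x => ⟨-x.a, -x.b, -x.c + x.a * x.b⟩⟩

@[simp] theorem mul_a (x y : Heis p) : (x * y).a = x.a + y.a := rfl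
@[simp] theorem mul_b (x y : Heis p) : (x * y).b = x.b + y.b := rfl
@[simp] theorem mul_c (x y : Heis p) : (x * y).c = x.c + y.c + x.a * y.b := rfl
@[simp] theorem one_a : (1 : Heis p).a = 0 := rfl
@[simp] theorem one_b : (1 : Heis p).b = 0 := rfl
@[simp] theorem one_c : (1 : Heis p).c = 0 := rfl
@[simp] theorem inv_a (x : Heis p) : x⁻¹.a = -x.a := rfl
@[simp] theorem inv_b (x : Heis p) : x⁻¹.b = -x.b := rfl
@[simp] theorem inv_c (x : Heis p) : x⁻¹.c = -x.c + x.a * x.b := rfl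

instance : Group (Heis p) :=
  Group.ofLeftAxioms
    (fun x y z => by ext <;> simp <;> ring)
    (fun x => by ext <;> simp)
    (fun x => by ext <;> simp)

theorem commute_iff (x y : Heis p) : x * y = y * x ↔ x.a * y.b = y.a * x.b := by
  constructor
  · intro h
    have := congrArg Heis.c h
    simp only [mul_c] at this
    linear_combination this
  · intro h
    ext
    · simp [add_comm]
    · simp [add_comm]
    · simp only [mul_c]; linear_combination h

open scoped commutatorElement in
theorem commutator_a (x y : Heis p) : ⁅x, y⁆.a = 0 := by
  simp [commutatorElement_def]

open scoped commutatorElement in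
theorem commutator_b (x y : Heis p) : ⁅x, y⁆.b = 0 := by
  simp [commutatorElement_def]

open scoped commutatorElement in
theorem commutator_c (x y : Heis p) : ⁅x, y⁆.c = x.a * y.b - y.a * x.b := by
  simp [commutatorElement_def]; ring

theorem pow_a (x : Heis p) (n : ℕ) : (x ^ n).a = n * x.a := by
  induction n with
  | zero => simp
  | succ n ih => rw [pow_succ, mul_a, ih]; push_cast; ring

theorem pow_b (x : Heis p) (n : ℕ) : (x ^ n).b = n * x.b := by
  induction n with
  | zero => simp
  | succ n ih => rw [pow_succ, mul_b, ih]; push_cast; ring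

/-- In general the central coordinate of `x ^ n` also contains `n.choose 2` times `x.a * x.b`. The
hypothesis removes this term, and it holds for the images of generators used below. -/
theorem pow_c (x : Heis p) (h : x.a * x.b = 0) (n : ℕ) : (x ^ n).c = n * x.c := by
  induction n with
  | zero => simp
  | succ n ih => rw [pow_succ, mul_c, ih, pow_a, mul_assoc, h]; push_cast; ring

end Heis

/-! ### Mekler groups -/

section Mekler

open scoped commutatorElement Classical IsMulCommutative

variable {p : ℕ} {W : Type} {Γ : SimpleGraph W}

/-- The generator of the Mekler group that belongs to a vertex. -/
def gen (p : ℕ) (Γ : SimpleGraph W) (w : W) : MeklerGroup p Γ := PresentedGroup.of w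

theorem gen_pow (w : W) : gen p Γ w ^ p = 1 :=
  (map_pow (PresentedGroup.mk _) _ _).symm.trans
    (PresentedGroup.one_of_mem (rels := meklerRels p Γ) (Or.inl (Or.inl ⟨w, rfl⟩)))

theorem gen_triple (x y z : W) : ⁅⁅gen p Γ x, gen p Γ y⁆, gen p Γ z⁆ = 1 := by
  have := PresentedGroup.one_of_mem (rels := meklerRels p Γ)
    (Or.inl (Or.inr ⟨x, y, z, rfl⟩))
  rwa [map_commutatorElement, map_commutatorElement] at this

theorem gen_adj {x y : W} (h : Γ.Adj x y) : ⁅gen p Γ x, gen p Γ y⁆ = 1 := by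
  have := PresentedGroup.one_of_mem (rels := meklerRels p Γ) (Or.inr ⟨x, y, h, rfl⟩)
  rwa [map_commutatorElement] at this

/-- The universal property of Mekler groups. -/
theorem exists_meklerHom {K : Type} [Group K] (f : W → K) (h₁ : ∀ w, f w ^ p = 1)
    (h₂ : ∀ x y z, ⁅⁅f x, f y⁆, f z⁆ = 1) (h₃ : ∀ x y, Γ.Adj x y → ⁅f x, f y⁆ = 1) :
    ∃ φ : MeklerGroup p Γ →* K, ∀ w, φ (gen p Γ w) = f w := by
  have : ∀ r ∈ meklerRels p Γ, FreeGroup.lift f r = 1 := by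
    rintro r ((⟨x, rfl⟩ | ⟨x, y, z, rfl⟩) | ⟨x, y, hxy, rfl⟩)
    · simpa using h₁ x
    · simpa using h₂ x y z
    · simpa using h₃ x y hxy
  exact ⟨PresentedGroup.toGroup this, fun w => PresentedGroup.toGroup.of this⟩

theorem eq_top_of_gen_mem {S : Subgroup (MeklerGroup p Γ)} (h : ∀ w, gen p Γ w ∈ S) : S = ⊤ := by
  rw [← top_le_iff, ← PresentedGroup.closure_range_of, Subgroup.closure_le]
  rintro _ ⟨w, rfl⟩
  exact h w

theorem mekler_hom_ext {K : Type} [Group K] {φ ψ : MeklerGroup p Γ →* K}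
    (h : ∀ w, φ (gen p Γ w) = ψ (gen p Γ w)) : φ = ψ := PresentedGroup.ext h

/-! ### Exponent vectors and Heisenberg quotients -/

theorem exists_vecHom (p : ℕ) (Γ : SimpleGraph W) :
    ∃ φ : MeklerGroup p Γ →* Multiplicative (W → ZMod p),
      ∀ w, φ (gen p Γ w) = Multiplicative.ofAdd (Pi.single w 1) := by
  refine exists_meklerHom _ (fun w => ?_) (fun x y z => ?_) fun x y _ => ?_
  · rw [← ofAdd_nsmul]
    convert ofAdd_zero
    funext i
    simp
  · rw [commutatorElement_eq_one_iff_mul_comm]; exact mul_comm _ _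
  · rw [commutatorElement_eq_one_iff_mul_comm]; exact mul_comm _ _

/-- The exponents of the generators in an element of a Mekler group. -/
noncomputable def vec (g : MeklerGroup p Γ) : W → ZMod p :=
  Multiplicative.toAdd ((exists_vecHom p Γ).choose g)

theorem vec_mul (g h : MeklerGroup p Γ) : vec (g * h) = vec g + vec h := by
  simp [vec]

theorem vec_one : vec (1 : MeklerGroup p Γ) = 0 := by
  simp [vec]

theorem vec_inv (g : MeklerGroup p Γ) : vec g⁻¹ = -vec g := by
  simp [vec]

theorem vec_gen (w : W) : vec (gen p Γ w) = Pi.single w 1 := by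
  simp [vec, (exists_vecHom p Γ).choose_spec]

theorem vec_pow (g : MeklerGroup p Γ) (n : ℕ) : vec (g ^ n) = n • vec g := by
  simp [vec]

theorem vec_commutator (g h : MeklerGroup p Γ) : vec ⁅g, h⁆ = 0 := by
  simp [commutatorElement_def, vec_mul, vec_inv]

/-- The generators of `u` and `v` go to the two standard noncommuting elements and all other
generators to `1`. The commutator relators survive because `u` and `v` are not adjacent, and the
`p`-th powers vanish because no generator has both coordinates nonzero. -/
theorem exists_heisHom [Fact (1 < p)] {u v : W} (huv : u ≠ v) (hna : ¬ Γ.Adj u v) :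
    ∃ φ : MeklerGroup p Γ →* Heis p,
      (∀ w, φ (gen p Γ w) = ⟨(Pi.single u 1 : W → ZMod p) w, (Pi.single v 1 : W → ZMod p) w, 0⟩) ∧
      ∀ g, (φ g).a = vec g u ∧ (φ g).b = vec g v := by
  have hc : ∀ w, (Pi.single u (1 : ZMod p) : W → ZMod p) w *
      (Pi.single v 1 : W → ZMod p) w = 0 := by
    intro w
    by_cases h : w = u
    · subst h; simp [huv]
    · simp [h]
  let f : W → Heis p := fun w =>
    ⟨(Pi.single u 1 : W → ZMod p) w, (Pi.single v 1 : W → ZMod p) w, 0⟩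
  have h₁ : ∀ w, f w ^ p = 1 := by
    intro w
    ext
    · simp [Heis.pow_a]
    · simp [Heis.pow_b]
    · rw [Heis.pow_c]
      · simp
      · exact hc w
  have h₂ : ∀ x y z, ⁅⁅f x, f y⁆, f z⁆ = 1 := by
    intro x y z
    rw [commutatorElement_eq_one_iff_mul_comm, Heis.commute_iff, Heis.commutator_a,
      Heis.commutator_b]
    simp
  have h₃ : ∀ x y, Γ.Adj x y → ⁅f x, f y⁆ = 1 := by
    intro x y hxy
    rw [commutatorElement_eq_one_iff_mul_comm, Heis.commute_iff]
    simp only [f, Pi.single_apply]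
    by_cases h₁ : x = u <;> by_cases h₂ : y = v <;> by_cases h₃ : y = u <;> by_cases h₄ : x = v <;>
      simp_all [Γ.adj_comm]
  obtain ⟨φ, hφ⟩ := exists_meklerHom (p := p) (Γ := Γ) f h₁ h₂ h₃
  refine ⟨φ, hφ, fun g => ?_⟩
  let S : Subgroup (MeklerGroup p Γ) :=
    { carrier := {g | (φ g).a = vec g u ∧ (φ g).b = vec g v}
      mul_mem' := by
        rintro x y ⟨h₁, h₂⟩ ⟨h₃, h₄⟩
        simp [vec_mul, h₁, h₂, h₃, h₄]
      one_mem' := by simp [vec_one]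
      inv_mem' := by
        rintro x ⟨h₁, h₂⟩
        simp [vec_inv, h₁, h₂] }
  have hS : S = ⊤ := eq_top_of_gen_mem fun w => by
    change (φ (gen p Γ w)).a = _ ∧ (φ (gen p Γ w)).b = _
    simp [hφ, f, vec_gen, Pi.single_apply, eq_comm]
  exact (hS ▸ Subgroup.mem_top g : g ∈ S)

theorem gen_commutator_mem_center (u v : W) :
    ⁅gen p Γ u, gen p Γ v⁆ ∈ Subgroup.center (MeklerGroup p Γ) := by
  have : Subgroup.centralizer {⁅gen p Γ u, gen p Γ v⁆} = ⊤ := by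
    refine eq_top_of_gen_mem fun w => ?_
    rw [Subgroup.mem_centralizer_singleton_iff]
    have := gen_triple (p := p) (Γ := Γ) u v w
    rw [commutatorElement_eq_one_iff_mul_comm] at this
    exact this.symm
  rw [Subgroup.mem_center_iff]
  intro g
  have hg : g ∈ Subgroup.centralizer {⁅gen p Γ u, gen p Γ v⁆} := this ▸ Subgroup.mem_top g
  rwa [Subgroup.mem_centralizer_singleton_iff] at hg

/-- The commutators of the generators. -/
def genComm (p : ℕ) (Γ : SimpleGraph W) (e : W × W) : Subgroup.center (MeklerGroup p Γ) :=
  ⟨⁅gen p Γ e.1, gen p Γ e.2⁆, gen_commutator_mem_center _ _⟩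

theorem genComm_swap (e : W × W) : genComm p Γ e.swap = (genComm p Γ e)⁻¹ :=
  Subtype.ext (commutatorElement_inv _ _).symm

/-- As the commutator `c` of `x` and `y` is central, moving `y` past `x ^ n` gives `x ^ n * y = c ^
n * (y * x ^ n)`. For `n = p` the powers of `x` disappear. -/
theorem genComm_pow (e : W × W) : genComm p Γ e ^ p = 1 := by
  apply Subtype.ext
  change ⁅gen p Γ e.1, gen p Γ e.2⁆ ^ p = 1
  set c := ⁅gen p Γ e.1, gen p Γ e.2⁆ with hc
  have hcz : ∀ g, g * c = c * g := Subgroup.mem_center_iff.1 (gen_commutator_mem_center _ _)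
  have h : gen p Γ e.1 * gen p Γ e.2 = c * (gen p Γ e.2 * gen p Γ e.1) := by
    rw [hc, commutatorElement_def]; group
  have key : ∀ n : ℕ, gen p Γ e.1 ^ n * gen p Γ e.2 = c ^ n * (gen p Γ e.2 * gen p Γ e.1 ^ n) := by
    intro n
    induction n with
    | zero => simp
    | succ n ih =>
      rw [pow_succ, mul_assoc, h, ← mul_assoc, hcz, mul_assoc, ← mul_assoc (_ ^ n), ih, pow_succ c,
        (Commute.self_pow c n).symm.eq]
      simp only [mul_assoc]
  have := key p
  rw [gen_pow, one_mul, mul_one] at this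
  exact (mul_eq_right.1 this.symm)

/-- The subgroup generated by the commutators of the generators. -/
def derivedPart (p : ℕ) (Γ : SimpleGraph W) : Subgroup (MeklerGroup p Γ) :=
  Subgroup.closure (Set.range fun e : W × W => ⁅gen p Γ e.1, gen p Γ e.2⁆)

theorem derivedPart_le_center : derivedPart p Γ ≤ Subgroup.center (MeklerGroup p Γ) := by
  rw [derivedPart, Subgroup.closure_le]
  rintro _ ⟨e, rfl⟩
  exact gen_commutator_mem_center _ _

theorem pow_val_add {Q : Type} [Monoid Q] [NeZero p] {x : Q} (hx : x ^ p = 1) (a b : ZMod p) :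
    x ^ (a + b).val = x ^ a.val * x ^ b.val := by
  rw [ZMod.val_add, ← pow_eq_pow_mod _ hx, pow_add]

/-- Modulo the derived part the generators commute, so the quotient is abelian. There the quotient
map agrees with the product of the powers prescribed by `vec`, both being homomorphisms with the
same values on generators. Hence `vec g = 0` makes the image trivial. -/
theorem mem_derivedPart_of_vec_eq_zero [Fintype W] [Fact (1 < p)] {g : MeklerGroup p Γ}
    (hg : vec g = 0) : g ∈ derivedPart p Γ := by
  have : NeZero p := ⟨by have := Fact.out (p := 1 < p); omega⟩
  have hN : (derivedPart p Γ).Normal := by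
    refine ⟨fun n hn g => ?_⟩
    rw [Subgroup.mem_center_iff.1 (derivedPart_le_center hn) g, mul_inv_cancel_right]
    exact hn
  let q := QuotientGroup.mk' (derivedPart p Γ)
  have hq : ∀ u v, q (gen p Γ u) * q (gen p Γ v) = q (gen p Γ v) * q (gen p Γ u) := by
    intro u v
    rw [← commutatorElement_eq_one_iff_mul_comm, ← map_commutatorElement]
    exact (QuotientGroup.eq_one_iff _).2 (Subgroup.subset_closure ⟨(u, v), rfl⟩)
  have h₁ : ∀ v g, q g * q (gen p Γ v) = q (gen p Γ v) * q g := by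
    intro v g
    have : (Subgroup.centralizer {q (gen p Γ v)}).comap q = ⊤ := by
      refine eq_top_of_gen_mem fun w => ?_
      rw [Subgroup.mem_comap, Subgroup.mem_centralizer_singleton_iff]
      exact hq _ _
    have hg : g ∈ (Subgroup.centralizer {q (gen p Γ v)}).comap q := this ▸ Subgroup.mem_top g
    rwa [Subgroup.mem_comap, Subgroup.mem_centralizer_singleton_iff] at hg
  have h₂ : ∀ g h, q g * q h = q h * q g := by
    intro g h
    have : (Subgroup.centralizer {q h}).comap q = ⊤ := by
      refine eq_top_of_gen_mem fun w => ?_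
      rw [Subgroup.mem_comap, Subgroup.mem_centralizer_singleton_iff]
      exact (h₁ _ _).symm
    have hg : g ∈ (Subgroup.centralizer {q h}).comap q := this ▸ Subgroup.mem_top g
    rwa [Subgroup.mem_comap, Subgroup.mem_centralizer_singleton_iff] at hg
  let _ : CommGroup (MeklerGroup p Γ ⧸ derivedPart p Γ) :=
    { mul_comm := fun a b => by
        obtain ⟨g, rfl⟩ := QuotientGroup.mk'_surjective _ a
        obtain ⟨h, rfl⟩ := QuotientGroup.mk'_surjective _ b
        exact h₂ g h }
  have hp : ∀ w, q (gen p Γ w) ^ p = 1 := fun w => by rw [← map_pow, gen_pow, map_one]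
  let ψ : MeklerGroup p Γ →* MeklerGroup p Γ ⧸ derivedPart p Γ :=
    { toFun := fun g => ∏ w, q (gen p Γ w) ^ (vec g w).val
      map_one' := by simp [vec_one]
      map_mul' := fun g h => by
        rw [← Finset.prod_mul_distrib]
        refine Finset.prod_congr rfl fun w _ => ?_
        rw [vec_mul, Pi.add_apply, pow_val_add (hp w)] }
  have hψ : ψ = q := by
    refine mekler_hom_ext fun w => ?_
    change ∏ u, q (gen p Γ u) ^ (vec (gen p Γ w) u).val = _
    rw [Finset.prod_eq_single w]
    · simp [vec_gen, ZMod.val_one]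
    · intro u _ hu
      simp [vec_gen, hu]
    · simp
  have : q g = 1 := by
    rw [← hψ]
    change ∏ u, q (gen p Γ u) ^ (vec g u).val = _
    simp [hg]
  exact (QuotientGroup.eq_one_iff _).1 this

/-- Elements of the derived part are products of powers of commutators of generators; the
exponents are visible in the Heisenberg quotients. -/
theorem exists_exponents [Fintype W] [Fact (1 < p)] {z : MeklerGroup p Γ}
    (hz : z ∈ derivedPart p Γ) :
    ∃ c : W × W → ZMod p, z = (∏ e, genComm p Γ e ^ (c e).val : Subgroup.center _) ∧
      ∀ u v, u ≠ v → ¬ Γ.Adj u v → ∀ φ : MeklerGroup p Γ →* Heis p,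
        (∀ w, φ (gen p Γ w) = ⟨(Pi.single u 1 : W → ZMod p) w, (Pi.single v 1 : W → ZMod p) w, 0⟩) →
        (φ z).a = 0 ∧ (φ z).b = 0 ∧ (φ z).c = c (u, v) - c (v, u) := by
  have : NeZero p := ⟨by have := Fact.out (p := 1 < p); omega⟩
  have hadd : ∀ c d : W × W → ZMod p, (∏ e, genComm p Γ e ^ ((c + d) e).val) =
      (∏ e, genComm p Γ e ^ (c e).val) * ∏ e, genComm p Γ e ^ (d e).val := by
    intro c d
    rw [← Finset.prod_mul_distrib]
    exact Finset.prod_congr rfl fun e _ => pow_val_add (genComm_pow e) _ _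
  rw [derivedPart] at hz
  induction hz using Subgroup.closure_induction with
  | mem x hx =>
    obtain ⟨e, rfl⟩ := hx
    refine ⟨Pi.single e 1, ?_, fun u v huv hna φ hφ => ?_⟩
    · rw [Finset.prod_eq_single e]
      · simp [ZMod.val_one, genComm]
      · intro f _ hf; simp [hf]
      · simp
    · simp only [map_commutatorElement, hφ, Heis.commutator_a, Heis.commutator_b,
        Heis.commutator_c, true_and]
      obtain ⟨x, y⟩ := e
      simp only [Pi.single_apply, Prod.mk.injEq]
      congr 1
      · by_cases h₁ : x = u <;> by_cases h₂ : y = v <;> simp [h₁, h₂, @eq_comm W u, @eq_comm W v]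
      · by_cases h₁ : y = u <;> by_cases h₂ : x = v <;> simp [h₁, h₂, @eq_comm W u, @eq_comm W v]
  | one => exact ⟨0, by simp, fun u v huv hna φ hφ => by simp⟩
  | mul x y _ _ hx hy =>
    obtain ⟨c, hc, hc'⟩ := hx
    obtain ⟨d, hd, hd'⟩ := hy
    refine ⟨c + d, ?_, fun u v huv hna φ hφ => ?_⟩
    · rw [hadd, Subgroup.coe_mul, ← hc, ← hd]
    · obtain ⟨h₁, h₂, h₃⟩ := hc' u v huv hna φ hφ
      obtain ⟨h₄, h₅, h₆⟩ := hd' u v huv hna φ hφ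
      simp [h₁, h₂, h₃, h₄, h₅, h₆]
      ring
  | inv x _ hx =>
    obtain ⟨c, hc, hc'⟩ := hx
    refine ⟨-c, ?_, fun u v huv hna φ hφ => ?_⟩
    · have := hadd c (-c)
      simp only [add_neg_cancel, Pi.zero_apply, ZMod.val_zero, pow_zero, Finset.prod_const_one]
        at this
      rw [eq_inv_of_mul_eq_one_right this.symm, Subgroup.coe_inv, ← hc]
    · obtain ⟨h₁, h₂, h₃⟩ := hc' u v huv hna φ hφ
      simp [h₁, h₂, h₃]
      ring

theorem pow_eq_one_of_mem_derivedPart [Fintype W] [Fact (1 < p)] {z : MeklerGroup p Γ}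
    (hz : z ∈ derivedPart p Γ) : z ^ p = 1 := by
  obtain ⟨c, rfl, -⟩ := exists_exponents hz
  rw [← Subgroup.coe_pow, ← Finset.prod_pow]
  rw [Finset.prod_eq_one]
  · rfl
  · intro e _
    rw [← pow_mul, mul_comm, pow_mul, genComm_pow, one_pow]

/-- The derived part is detected by the Heisenberg quotients. -/
theorem eq_one_of_heis [Fintype W] [Fact (1 < p)] (hp : Odd p) {z : MeklerGroup p Γ}
    (hz : z ∈ derivedPart p Γ)
    (h : ∀ u v, u ≠ v → ¬ Γ.Adj u v → ∀ φ : MeklerGroup p Γ →* Heis p,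
        (∀ w, φ (gen p Γ w) = ⟨(Pi.single u 1 : W → ZMod p) w, (Pi.single v 1 : W → ZMod p) w, 0⟩) →
          φ z = 1) : z = 1 := by
  have : NeZero p := ⟨by have := Fact.out (p := 1 < p); omega⟩
  obtain ⟨c, hc, hc'⟩ := exists_exponents hz
  -- Exchanging the entries of a pair inverts its commutator. Multiplying the product by its
  -- reindexed copy therefore leaves the exponents `c (u, v) - c (v, u)`, which is what Heisenberg
  -- quotients see at nonadjacent pairs. Diagonal pairs cancel, and adjacent pairs have trivial
  -- commutator.
  have hsq : z ^ 2 = 1 := by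
    set y := ∏ e, genComm p Γ e ^ (c e).val with hy
    suffices y * y = 1 by rw [hc, pow_two, ← Subgroup.coe_mul, this]; rfl
    have hswap : y = ∏ e, (genComm p Γ e ^ (c e.swap).val)⁻¹ := by
      rw [hy, ← Equiv.prod_comp (Equiv.prodComm W W)]
      refine Finset.prod_congr rfl fun e _ => ?_
      rw [Equiv.prodComm_apply, genComm_swap, inv_pow]
    nth_rewrite 2 [hswap]
    rw [hy, ← Finset.prod_mul_distrib]
    refine Finset.prod_eq_one fun e _ => ?_
    obtain ⟨u, v⟩ := e
    by_cases huv : u = v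
    · subst huv
      rw [Prod.swap_prod_mk, mul_inv_cancel]
    by_cases hna : Γ.Adj u v
    · have : genComm p Γ (u, v) = 1 := Subtype.ext (gen_adj hna)
      simp [this]
    · obtain ⟨φ, hφ, -⟩ := exists_heisHom (p := p) huv hna
      have h₁ := (hc' u v huv hna φ hφ).2.2
      rw [h u v huv hna φ hφ, Heis.one_c] at h₁
      rw [Prod.swap_prod_mk, sub_eq_zero.1 h₁.symm, mul_inv_cancel]
  -- The exponent of `z` divides both `2` and the odd number `p`.
  obtain ⟨m, rfl⟩ := hp
  have hpow := pow_eq_one_of_mem_derivedPart hz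
  rwa [pow_succ, pow_mul, hsq, one_pow, one_mul] at hpow

/-- Two elements of a Mekler group commute iff their exponents are proportional on all pairs of
nonadjacent vertices. -/
theorem mekler_commute_iff [Fintype W] [Fact (1 < p)] (hp : Odd p) (g h : MeklerGroup p Γ) :
    g * h = h * g ↔ ∀ u v, u ≠ v → ¬ Γ.Adj u v → vec g u * vec h v = vec h u * vec g v := by
  constructor
  · intro hgh u v huv hna
    obtain ⟨φ, -, hφ⟩ := exists_heisHom (p := p) huv hna
    have := congrArg φ hgh
    rw [map_mul, map_mul, Heis.commute_iff] at this
    simpa [hφ] using this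
  · intro H
    rw [← commutatorElement_eq_one_iff_mul_comm]
    refine eq_one_of_heis hp (mem_derivedPart_of_vec_eq_zero (vec_commutator g h)) ?_
    intro u v huv hna φ hφ
    rw [map_commutatorElement, commutatorElement_eq_one_iff_mul_comm, Heis.commute_iff]
    obtain ⟨ψ, hψ, hψ'⟩ := exists_heisHom (p := p) huv hna
    have : φ = ψ := mekler_hom_ext fun w => by rw [hφ, hψ]
    subst this
    simpa [hψ'] using H u v huv hna

/-- The product of the powers `gen w ^ a w`, in some order of the vertices. -/
noncomputable def ofVec [Fintype W] (Γ : SimpleGraph W) (a : W → ZMod p) : MeklerGroup p Γ :=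
  (Finset.univ.toList.map fun w => gen p Γ w ^ (a w).val).prod

theorem vec_list_prod (l : List (MeklerGroup p Γ)) : vec l.prod = (l.map vec).sum := by
  induction l with
  | nil => simp [vec_one]
  | cons x l ih => simp [vec_mul, ih]

theorem vec_gen_pow [NeZero p] (w : W) (a : ZMod p) : vec (gen p Γ w ^ a.val) = Pi.single w a := by
  rw [vec_pow, vec_gen]
  funext i
  by_cases h : i = w
  · subst h; simp
  · simp [h]

theorem vec_ofVec [Fintype W] [NeZero p] (a : W → ZMod p) : vec (ofVec Γ a) = a := by
  rw [ofVec, vec_list_prod, List.map_map]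
  have : (vec ∘ fun w => gen p Γ w ^ (a w).val) = fun w => Pi.single w (a w) := by
    funext w; exact vec_gen_pow w (a w)
  rw [this, Finset.sum_map_toList]
  exact Finset.univ_sum_single a

/-- Every element is a factor from the derived part, given by exponents on pairs of vertices, times
the normal form of its exponent vector. -/
instance finite_mekler [Fintype W] [Fact (1 < p)] : Finite (MeklerGroup p Γ) := by
  have : NeZero p := ⟨by have := Fact.out (p := 1 < p); omega⟩
  refine Finite.of_surjective
    (fun x : (W × W → ZMod p) × (W → ZMod p) =>
      ((∏ e, genComm p Γ e ^ (x.1 e).val : Subgroup.center _) : MeklerGroup p Γ) * ofVec Γ x.2)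
    fun g => ?_
  have : g * (ofVec Γ (vec g))⁻¹ ∈ derivedPart p Γ :=
    mem_derivedPart_of_vec_eq_zero (by simp [vec_mul, vec_inv, vec_ofVec])
  obtain ⟨c, hc, -⟩ := exists_exponents this
  exact ⟨(c, vec g), by simp only [← hc]; simp⟩

/-- This bounds the number of vertices by the logarithm of the group order, which is what makes
`O(log log n)` rounds suffice. -/
theorem pow_card_le_card_mekler [Fintype W] [Fact (1 < p)] :
    p ^ Fintype.card W ≤ Nat.card (MeklerGroup p Γ) := by
  have : NeZero p := ⟨by have := Fact.out (p := 1 < p); omega⟩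
  have := Nat.card_le_card_of_surjective (vec (p := p) (Γ := Γ)) fun a => ⟨_, vec_ofVec a⟩
  simpa [Nat.card_eq_fintype_card, ZMod.card] using this

end Mekler

/-! ### Predicates that recover the graph from its Mekler group -/

section Predicates

variable {K : Type} [Group K]

/-- `x` is central. -/
def IsCentral (x : K) : Prop := ∀ y, x * y = y * x

/-- `x` is a noncentral element with a nonabelian centralizer. In the Mekler groups considered
below these are the elements that are powers of a generator up to central elements. -/
def IsVertexLike (x : K) : Prop :=
  ¬ IsCentral x ∧ ∃ y, ∃ z, x * y = y * x ∧ x * z = z * x ∧ ¬ y * z = z * y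

/-- `x` and `y` have the same centralizer. -/
def SameCentralizer (x y : K) : Prop := ∀ z, x * z = z * x ↔ y * z = z * y

/-- `b` arises from `a` by multiplication by a central element or by a vertex-like element whose
centralizer is not that of `x`. -/
def AvoidStep (x a b : K) : Prop :=
  ∃ c, a * c = b ∧ (IsCentral c ∨ (IsVertexLike c ∧ ¬ SameCentralizer x c))

/-- `y` is a product of `2 ^ t` elements that are central or vertex-like with a centralizer
different from that of `x`. -/
def Avoids (t : ℕ) (x y : K) : Prop :=
  -- The only idempotent of a group is `1`; this names the identity by a product relation alone.
  ∃ o, o * o = o ∧ RelComp (List.replicate (2 ^ t) (AvoidStep x)) o y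

end Predicates

/-- Names of the pebbled elements: a root and one element for each colour. -/
abbrev Pebble : Type := Option (Fin 10)

/-- `y` is vertex-like, belongs to a neighbour of `x`, and occurs in the pebbled element of the
colour `c`. -/
def ColorStep (t : ℕ) (c : Fin 10) : RelFamily Pebble := fun _ _ q x y =>
  IsVertexLike y ∧ x * y = y * x ∧ ¬ SameCentralizer x y ∧ ¬ Avoids t y (q (some c))

/-- `y` belongs to the end of the path from the root along the colours `l` and occurs with exponent
`1` in the pebbled element of the colour `c`. -/
def AtPath (t : ℕ) (l : List (Fin 10)) (c : Fin 10) (K : Type) [Group K] (q : Pebble → K) (y : K) :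
    Prop :=
  IsVertexLike y ∧
    (∃ x, RelComp ((l.map (ColorStep t)).map fun R => R K q) (q none) x ∧ SameCentralizer x y) ∧
    ∃ d, d * y = q (some c) ∧ Avoids t y d

/-- `b` is `a` times the `e`-th power of the commutator of two elements that satisfy the predicates
`A` and `B`. -/
def CommPowStep (A B : ∀ (K : Type) [Group K], (Pebble → K) → K → Prop) (e : ℕ) :
    RelFamily Pebble := fun K _ q a b =>
  ∃ x, ∃ y, ∃ c, ∃ d, A K q x ∧ B K q y ∧ x * y = c * (y * x) ∧ d = c ^ e ∧ a * d = b

/-! ### Round counts for the predicates -/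

section Invariance

variable {k r : ℕ}

/-- Here and below, the bound `20 ≤ k` leaves room for the eleven pebbled elements and all
simultaneously bound variables. The free `r` lets predicates be combined at a common round. -/
theorem inv_comm (hk : 20 ≤ k) :
    WLInv k (r + 1) (α := Fin 2) fun _ _ v => v 0 * v 1 = v 1 * v 0 := by
  have : WLInv k (r + 1) (α := Fin 2) fun _ _ v => ∃ x, v 0 * v 1 = x ∧ v 1 * v 0 = x := by
    apply WLInv.ex (by simp; omega)
    exact (WLInv.mul (some 0) (some 1) none).and (WLInv.mul (some 1) (some 0) none)
  exact this.congr fun K _ v => by simp [eq_comm]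

theorem inv_isCentral (hk : 20 ≤ k) :
    WLInv k (r + 2) (α := Fin 1) fun _ _ v => IsCentral (v 0) := by
  unfold IsCentral
  apply WLInv.all (by simp; omega)
  exact (inv_comm hk).reindex ![some 0, none]

theorem inv_sameCentralizer (hk : 20 ≤ k) :
    WLInv k (r + 2) (α := Fin 2) fun _ _ v => SameCentralizer (v 0) (v 1) := by
  unfold SameCentralizer
  apply WLInv.all (by simp; omega)
  exact ((inv_comm hk).reindex ![some 0, none]).iff ((inv_comm hk).reindex ![some 1, none])

theorem inv_isVertexLike (hk : 20 ≤ k) :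
    WLInv k (r + 3) (α := Fin 1) fun _ _ v => IsVertexLike (v 0) := by
  unfold IsVertexLike
  refine ((inv_isCentral (r := r + 1) hk).not).and ?_
  apply WLInv.ex (by simp; omega)
  apply WLInv.ex (by simp; omega)
  exact ((inv_comm hk).reindex ![some (some 0), some none]).and
    (((inv_comm hk).reindex ![some (some 0), none]).and
      ((inv_comm hk).reindex ![some none, none]).not)

/-- A single step takes four rounds, the composition of `2 ^ t` steps takes `t` more by halving, and
naming the identity takes one. -/
theorem inv_avoids (hk : 20 ≤ k) (t : ℕ) :
    WLInv k (r + t + 5) (α := Fin 2) fun _ _ v => Avoids t (v 0) (v 1) := by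
  have h₁ : WLInv k (r + 4) (α := Option (Option (Fin 1))) fun _ _ v =>
      AvoidStep (v (some (some 0))) (v (some none)) (v none) := by
    unfold AvoidStep
    apply WLInv.ex (by simp; omega)
    exact (WLInv.mul _ _ _).and
      (((inv_isCentral (r := r + 1) hk).reindex ![none]).or
        (((inv_isVertexLike hk).reindex ![none]).and
          ((inv_sameCentralizer (r := r + 1) hk).reindex ![some (some (some 0)), none]).not))
  have h₂ := WLInv.relComp (k := k) (r := r + 4) (α := Fin 1) (by simp; omega) t
    (List.replicate (2 ^ t) fun _ _ v => AvoidStep (v 0)) (by simp)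
    (fun R hR => by rw [List.eq_of_mem_replicate hR]; exact h₁)
  have h₃ : WLInv k (r + 4 + t + 1) (α := Fin 2) fun _ _ v => Avoids t (v 0) (v 1) := by
    unfold Avoids
    apply WLInv.ex (by simp; omega)
    refine (WLInv.mul none none none).and ?_
    refine (h₂.reindex fun o => o.elim (some 1) fun o => o.elim none fun _ => some 0).congr ?_
    intro K _ v
    rw [List.map_replicate]
    rfl
  exact h₃.mono (by omega)

theorem inv_colorStep (hk : 20 ≤ k) (t : ℕ) (c : Fin 10) :
    WLInv k (t + 5) (α := Option (Option Pebble)) fun K _ v =>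
      ColorStep t c K (fun a => v (some (some a))) (v (some none)) (v none) := by
  unfold ColorStep
  refine WLInv.and ?_ (WLInv.and ?_ (WLInv.and (WLInv.not ?_) (WLInv.not ?_)))
  · exact ((inv_isVertexLike (r := t + 2) hk).reindex ![none])
  · exact ((inv_comm (r := t + 4) hk).reindex ![some none, none])
  · exact ((inv_sameCentralizer (r := t + 3) hk).reindex ![some none, none])
  · exact (((inv_avoids (r := 0) hk t).mono (by omega)).reindex ![none, some (some (some c))])

/-- Halving the path adds `s` rounds to the `t + 5` of a colour step, and its end point is
quantified in one more. -/
theorem inv_atPath (hk : 20 ≤ k) (t s : ℕ) (l : List (Fin 10)) (hl : l.length ≤ 2 ^ s)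
    (c : Fin 10) :
    WLInv k (t + s + 6) (α := Option Pebble) fun K _ v =>
      AtPath t l c K (fun a => v (some a)) (v none) := by
  unfold AtPath
  refine WLInv.and ?_ (WLInv.and ?_ ?_)
  · exact ((inv_isVertexLike (r := t + s + 3) hk).reindex ![none])
  · apply WLInv.ex (by simp; omega)
    refine WLInv.and ?_ ((inv_sameCentralizer (r := t + s + 3) hk).reindex ![none, some none])
    have := WLInv.relComp (k := k) (r := t + 5) (α := Pebble) (by simp; omega) s
      (l.map (ColorStep t)) (by simpa using hl) (by
        intro R hR
        obtain ⟨c, -, rfl⟩ := List.mem_map.1 hR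
        exact inv_colorStep hk t c)
    exact (this.mono (by omega)).reindex fun o => o.elim none fun o =>
      o.elim (some (some none)) fun a => some (some a)
  · apply WLInv.ex (by simp; omega)
    exact (WLInv.mul _ _ _).and
      (((inv_avoids (r := 0) hk t).mono (by omega)).reindex ![some none, none])

/-- The commutator enters as the unique `c` with `x * y = c * (y * x)`, so inverses never have to be
expressed. -/
theorem inv_commPowStep (hk : 20 ≤ k) {A B : ∀ (K : Type) [Group K], (Pebble → K) → K → Prop}
    (hA : WLInv k r (α := Option Pebble) fun K _ v => A K (fun a => v (some a)) (v none))
    (hB : WLInv k r (α := Option Pebble) fun K _ v => B K (fun a => v (some a)) (v none))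
    (t e : ℕ) (he : e ≤ 2 ^ 2 ^ t) :
    WLInv k (r + 3 * t + 7) (α := Option (Option Pebble)) fun K _ v =>
      CommPowStep A B e K (fun a => v (some (some a))) (v (some none)) (v none) := by
  unfold CommPowStep
  have h₁ : WLInv k (r + 3 * t + 3) (α := Fin 3) fun _ _ v => v 0 * v 1 = v 2 * (v 1 * v 0) := by
    have : WLInv k (r + 3 * t + 3) (α := Fin 3) fun _ _ v =>
        ∃ m, v 1 * v 0 = m ∧ ∃ n, v 2 * m = n ∧ v 0 * v 1 = n := by
      apply WLInv.ex (by simp; omega)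
      refine WLInv.and (WLInv.mul (some 1) (some 0) none) ?_
      apply WLInv.ex (by simp; omega)
      exact (WLInv.mul (some (some 2)) (some none) none).and
        (WLInv.mul (some (some 0)) (some (some 1)) none)
    exact this.congr fun K _ v => by simp
  iterate 4 apply WLInv.ex (by simp; omega)
  refine WLInv.and ?_ (WLInv.and ?_ (WLInv.and ?_ (WLInv.and ?_ ?_)))
  · exact (hA.mono (by omega)).reindex fun o => o.elim (some (some (some none))) fun a =>
      some (some (some (some (some (some a)))))
  · exact (hB.mono (by omega)).reindex fun o => o.elim (some (some none)) fun a =>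
      some (some (some (some (some (some a)))))
  · exact h₁.reindex ![some (some (some none)), some (some none), some none]
  · exact ((WLInv.pow (by omega) t e he).mono (by omega)).reindex ![some none, none]
  · exact WLInv.mul _ _ _

end Invariance

/-! ### The predicates in Mekler groups of sparse graphs -/

open scoped commutatorElement Classical

/-- Connected graphs without triangles and `4`-cycles and with all degrees at least `2`, together
with a colouring in which the neighbours of each vertex have different colours. -/
structure IsSparse {W : Type} (Γ : SimpleGraph W) (col : W → Fin 10) : Prop where
  connected : Γ.Connected
  triangle : ∀ x y z, Γ.Adj x y → Γ.Adj y z → ¬ Γ.Adj x z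
  square : ∀ u v x y, u ≠ v → x ≠ y → Γ.Adj u x → Γ.Adj u y → Γ.Adj v x → ¬ Γ.Adj v y
  degree : ∀ w, ∃ u v, u ≠ v ∧ Γ.Adj w u ∧ Γ.Adj w v
  color : ∀ w u v, Γ.Adj w u → Γ.Adj w v → col u = col v → u = v

/-- A vertex two steps away from `w` works, since there are no triangles. -/
theorem IsSparse.exists_nonadj {W : Type} {Γ : SimpleGraph W} {col : W → Fin 10}
    (h : IsSparse Γ col) (w : W) : ∃ v, w ≠ v ∧ ¬ Γ.Adj w v := by
  obtain ⟨u, -, -, hu, -⟩ := h.degree w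
  obtain ⟨a, b, hab, ha, hb⟩ := h.degree u
  by_cases hw : w = a
  · exact ⟨b, by rw [hw]; exact hab, h.triangle w u b hu hb⟩
  · exact ⟨a, hw, h.triangle w u a hu ha⟩

section Sparse

variable {p : ℕ} [Fact p.Prime] {W : Type} [Fintype W] {Γ : SimpleGraph W} {col : W → Fin 10}

/-- In the criterion for commuting elements only pairs containing `w` impose a condition. Thus the
centralizer consists of the elements supported on the closed neighbourhood of `w`. -/
theorem comm_single_iff (hp : Odd p) {g : MeklerGroup p Γ} {w : W} {s : ZMod p} (hs : s ≠ 0)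
    (hg : vec g = Pi.single w s) (h : MeklerGroup p Γ) :
    g * h = h * g ↔ ∀ v, w ≠ v → ¬ Γ.Adj w v → vec h v = 0 := by
  rw [mekler_commute_iff hp, hg]
  constructor
  · intro H v hv hna
    have := H w v hv hna
    simp only [Pi.single_eq_same, Pi.single_eq_of_ne hv.symm, mul_zero, mul_eq_zero] at this
    exact this.resolve_left hs
  · intro H u v huv hna
    by_cases h₁ : u = w
    · subst h₁
      simp [H v huv hna, huv.symm]
    · by_cases h₂ : v = w
      · subst h₂
        simp [H u huv.symm (fun h => hna h.symm), huv]
      · simp [h₁, h₂]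

/-- Commuting with the generator of a vertex nonadjacent to `w` kills the coordinate at `w`. -/
theorem isCentral_iff (h : IsSparse Γ col) (hp : Odd p) (g : MeklerGroup p Γ) :
    IsCentral g ↔ vec g = 0 := by
  constructor
  · intro hg
    funext w
    obtain ⟨v, hv, hna⟩ := h.exists_nonadj w
    have := hg (gen p Γ v)
    rw [eq_comm, comm_single_iff hp one_ne_zero (vec_gen v)] at this
    exact this w hv.symm fun h => hna h.symm
  · intro hg y
    rw [mekler_commute_iff hp, hg]
    simp

/-- Suppose two vertices `w`, `w'` lie in the support of `g`, and let `y`, `z` commute with `g`. At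
a nonadjacent pair `u`, `v` where `g` does not vanish, the coordinates of `y` and `z` are
proportional to those of `g`, hence to each other. Where `g` vanishes at both, a failure would make
`u` and `v` common neighbours of `w` and `w'`, a 4-cycle. Conversely, two neighbours of a vertex are
nonadjacent, so their generators lie in its centralizer without commuting. -/
theorem isVertexLike_iff (h : IsSparse Γ col) (hp : Odd p) (g : MeklerGroup p Γ) :
    IsVertexLike g ↔ ∃ w s, s ≠ 0 ∧ vec g = Pi.single w s := by
  constructor
  · rintro ⟨hc, y, z, hy, hz, hyz⟩
    rw [isCentral_iff h hp] at hc
    obtain ⟨w, hw⟩ := Function.ne_iff.1 hc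
    refine ⟨w, vec g w, hw, funext fun w' => ?_⟩
    by_cases hww : w' = w
    · subst hww; simp
    rw [Pi.single_eq_of_ne hww]
    by_contra hw'
    apply hyz
    rw [mekler_commute_iff hp] at hy hz ⊢
    intro u v huv hna
    -- If `b` commutes with `g` and is nonzero at a vertex where `g` vanishes, that vertex is
    -- adjacent to the whole support of `g`.
    have key : ∀ (b : MeklerGroup p Γ) (a a' : W), a ≠ a' → vec g a = 0 →
        (∀ u v, u ≠ v → ¬ Γ.Adj u v → vec g u * vec b v = vec b u * vec g v) → vec b a ≠ 0 →
        vec g a' ≠ 0 → Γ.Adj a a' := by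
      intro b a a' haa hga hb hba hga'
      by_contra hn
      have := hb a a' haa hn
      rw [hga, zero_mul] at this
      exact mul_ne_zero hba hga' this.symm
    have hy' := hy u v huv hna
    have hz' := hz u v huv hna
    by_cases hu : vec g u = 0
    · by_cases hv : vec g v = 0
      · have hadj : ∀ a, vec g a = 0 → (vec y a ≠ 0 ∨ vec z a ≠ 0) →
            Γ.Adj a w ∧ Γ.Adj a w' := by
          intro a ha hor
          have h₁ : a ≠ w := by rintro rfl; exact hw ha
          have h₂ : a ≠ w' := by rintro rfl; exact hw' ha
          rcases hor with hor | hor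
          · exact ⟨key y a w h₁ ha hy hor hw, key y a w' h₂ ha hy hor hw'⟩
          · exact ⟨key z a w h₁ ha hz hor hw, key z a w' h₂ ha hz hor hw'⟩
        by_cases hu' : vec y u ≠ 0 ∨ vec z u ≠ 0
        · by_cases hv' : vec y v ≠ 0 ∨ vec z v ≠ 0
          · exact absurd (hadj v hv hv').2 (h.square u v w w' huv (Ne.symm hww) (hadj u hu hu').1
              (hadj u hu hu').2 (hadj v hv hv').1)
          · push Not at hv'
            simp [hv'.1, hv'.2]
        · push Not at hu'
          simp [hu'.1, hu'.2]
      · rw [hu, zero_mul, zero_eq_mul, or_iff_left hv] at hy' hz'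
        simp [hy', hz']
    · refine mul_left_cancel₀ hu ?_
      linear_combination -vec y u * (-hz') - vec z u * hy'
  · rintro ⟨w, s, hs, hg⟩
    refine ⟨?_, ?_⟩
    · rw [isCentral_iff h hp, hg]
      intro h0
      exact hs (by simpa using congrFun h0 w)
    · obtain ⟨u, v, huv, hu, hv⟩ := h.degree w
      have hnuv : ¬ Γ.Adj u v := h.triangle u w v hu.symm hv
      refine ⟨gen p Γ u, gen p Γ v, ?_, ?_, ?_⟩
      · rw [comm_single_iff hp hs hg, vec_gen]
        intro x _ hx
        rw [Pi.single_eq_of_ne]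
        rintro rfl; exact hx hu
      · rw [comm_single_iff hp hs hg, vec_gen]
        intro x _ hx
        rw [Pi.single_eq_of_ne]
        rintro rfl; exact hx hv
      · rw [comm_single_iff hp one_ne_zero (vec_gen u), vec_gen]
        intro H
        have := H v huv hnuv
        simp at this

/-- For `w ≠ w'`, two neighbours of `w` cannot both lie in the closed neighbourhood of `w'`: this
would be a triangle or a 4-cycle. The generator of one outside it separates the centralizers. -/
theorem sameCentralizer_iff (h : IsSparse Γ col) (hp : Odd p) {g g' : MeklerGroup p Γ} {w w' : W}
    {s s' : ZMod p} (hs : s ≠ 0) (hs' : s' ≠ 0) (hg : vec g = Pi.single w s)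
    (hg' : vec g' = Pi.single w' s') : SameCentralizer g g' ↔ w = w' := by
  constructor
  · intro H
    by_contra hww
    obtain ⟨v, hv, hvw, hva⟩ : ∃ v, Γ.Adj w v ∧ w' ≠ v ∧ ¬ Γ.Adj w' v := by
      obtain ⟨a, b, hab, ha, hb⟩ := h.degree w
      by_contra hc
      push Not at hc
      by_cases h₁ : w' = a
      · subst h₁
        exact h.triangle w w' b ha (hc b hb hab) hb
      by_cases h₂ : w' = b
      · subst h₂
        exact h.triangle w w' a hb (hc a ha hab.symm) ha
      exact h.square w w' a b hww hab ha hb (hc a ha h₁) (hc b hb h₂)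
    have := H (gen p Γ v)
    rw [comm_single_iff hp hs hg, comm_single_iff hp hs' hg', vec_gen] at this
    have h₁ := this.1 (fun x _ hx => by
      rw [Pi.single_eq_of_ne]
      rintro rfl; exact hx hv) v hvw hva
    simp at h₁
  · rintro rfl z
    rw [comm_single_iff hp hs hg, comm_single_iff hp hs' hg']

/-- No allowed factor has a nonzero coordinate at `w`. Conversely, an element vanishing there is a
product of powers of the other generators and a central correction. -/
theorem avoids_iff (h : IsSparse Γ col) (hp : Odd p) {t : ℕ} (ht : Fintype.card W < 2 ^ t)
    {g : MeklerGroup p Γ} {w : W} {s : ZMod p} (hs : s ≠ 0) (hg : vec g = Pi.single w s)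
    (y : MeklerGroup p Γ) : Avoids t g y ↔ vec y w = 0 := by
  have hbase : ∀ c : MeklerGroup p Γ, IsCentral c ∨ (IsVertexLike c ∧ ¬ SameCentralizer g c) →
      vec c w = 0 := by
    rintro c (hc | ⟨hc, hn⟩)
    · rw [isCentral_iff h hp] at hc
      simp [hc]
    · obtain ⟨u, a, ha, hu⟩ := (isVertexLike_iff h hp c).1 hc
      rw [sameCentralizer_iff h hp hs ha hg hu] at hn
      rw [hu, Pi.single_eq_of_ne hn]
  constructor
  · rintro ⟨o, ho, hr⟩
    obtain rfl : o = 1 := by simpa using ho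
    have : ∀ (n : ℕ) (x : MeklerGroup p Γ), vec x w = 0 →
        RelComp (List.replicate n (AvoidStep g)) x y → vec y w = 0 := by
      intro n
      induction n with
      | zero =>
        intro x hx hxy
        exact (show x = y from hxy) ▸ hx
      | succ n ih =>
        rintro x hx ⟨z, ⟨c, rfl, hc⟩, hz⟩
        refine ih _ ?_ hz
        rw [vec_mul, Pi.add_apply, hx, hbase c hc, add_zero]
    exact this _ 1 (by simp [vec_one]) hr
  · intro hy
    refine ⟨1, mul_one 1, ?_⟩
    have hcent : ∀ c : MeklerGroup p Γ, vec c = 0 → ∀ x, AvoidStep g x (x * c) := fun c hc x =>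
      ⟨c, rfl, Or.inl ((isCentral_iff h hp c).2 hc)⟩
    have hpad : ∀ (n : ℕ) (x : MeklerGroup p Γ),
        RelComp (List.replicate n (AvoidStep g)) x x := by
      intro n
      induction n with
      | zero => exact fun x => rfl
      | succ n ih => exact fun x => ⟨x, by simpa using hcent 1 vec_one x, ih x⟩
    have hlist : ∀ (l : List (MeklerGroup p Γ)) (x : MeklerGroup p Γ),
        (∀ c ∈ l, IsCentral c ∨ (IsVertexLike c ∧ ¬ SameCentralizer g c)) →
        RelComp (List.replicate l.length (AvoidStep g)) x (x * l.prod) := by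
      intro l
      induction l with
      | nil => intro x _; simp [RelComp]
      | cons c l ih =>
        intro x hl
        refine ⟨x * c, ⟨c, rfl, hl c (by simp)⟩, ?_⟩
        rw [List.prod_cons, ← mul_assoc]
        exact ih _ fun d hd => hl d (by simp [hd])
    -- One factor per vertex and a central one at the end, `|W| + 1 ≤ 2 ^ t` in all. Factors with
    -- exponent `0` count as central, and the remaining places are filled with `1`.
    let l : List (MeklerGroup p Γ) :=
      (Finset.univ.toList.map fun u => gen p Γ u ^ (vec y u).val) ++ [(ofVec Γ (vec y))⁻¹ * y]
    have hprod : l.prod = y := by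
      simp only [l, List.prod_append, List.prod_singleton]
      exact mul_inv_cancel_left (ofVec Γ (vec y)) y
    have hlen : l.length = Fintype.card W + 1 := by simp [l, Finset.card_univ]
    have hl := hlist l 1 (by
      intro c hc
      rcases List.mem_append.1 hc with hc | hc
      · obtain ⟨u, -, rfl⟩ := List.mem_map.1 hc
        by_cases h0 : vec y u = 0
        · left; rw [isCentral_iff h hp, vec_gen_pow, h0, Pi.single_zero]
        · right
          refine ⟨(isVertexLike_iff h hp _).2 ⟨u, _, h0, vec_gen_pow u _⟩, ?_⟩
          rw [sameCentralizer_iff h hp hs h0 hg (vec_gen_pow u _)]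
          rintro rfl
          exact h0 hy
      · left
        rw [List.mem_singleton.1 hc, isCentral_iff h hp, vec_mul, vec_inv, vec_ofVec,
          neg_add_cancel])
    rw [one_mul, hprod, hlen] at hl
    have h2 : 2 ^ t = (Fintype.card W + 1) + (2 ^ t - (Fintype.card W + 1)) := by omega
    rw [h2, List.replicate_add, relComp_append]
    exact ⟨y, hl, hpad _ _⟩

/-- The pebbled elements: the generator of the root and the products of the generators of the
vertices of each colour. -/
noncomputable def pebbles (p : ℕ) (Γ : SimpleGraph W) (col : W → Fin 10) (root : W) :
    Pebble → MeklerGroup p Γ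
  | none => gen p Γ root
  | some c => ofVec Γ fun w => if col w = c then 1 else 0

/-- Commuting elements supported at different single vertices belong to adjacent vertices. The
pebbled product of colour `c` has a nonzero coordinate exactly at the vertices of that colour. -/
theorem colorStep_iff (h : IsSparse Γ col) (hp : Odd p) {t : ℕ} (ht : Fintype.card W < 2 ^ t)
    (root : W) {x : MeklerGroup p Γ} {w : W} {s : ZMod p} (hs : s ≠ 0)
    (hx : vec x = Pi.single w s) (c : Fin 10) (y : MeklerGroup p Γ) :
    ColorStep t c _ (pebbles p Γ col root) x y ↔
      ∃ w' s', s' ≠ 0 ∧ vec y = Pi.single w' s' ∧ Γ.Adj w w' ∧ col w' = c := by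
  have hq : vec (pebbles p Γ col root (some c)) = fun w => if col w = c then 1 else 0 :=
    vec_ofVec _
  constructor
  · rintro ⟨hv, hxy, hne, hav⟩
    obtain ⟨w', s', hs', hy⟩ := (isVertexLike_iff h hp y).1 hv
    rw [sameCentralizer_iff h hp hs hs' hx hy] at hne
    rw [avoids_iff h hp ht hs' hy, hq] at hav
    rw [comm_single_iff hp hs hx, hy] at hxy
    refine ⟨w', s', hs', hy, ?_, by simpa using hav⟩
    by_contra hn
    exact hs' (by simpa using hxy w' hne hn)
  · rintro ⟨w', s', hs', hy, hadj, hc⟩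
    refine ⟨(isVertexLike_iff h hp y).2 ⟨w', s', hs', hy⟩, ?_, ?_, ?_⟩
    · rw [comm_single_iff hp hs hx, hy]
      intro v _ hv
      rw [Pi.single_eq_of_ne]
      rintro rfl; exact hv hadj
    · rw [sameCentralizer_iff h hp hs hs' hx hy]
      exact hadj.ne
    · rw [avoids_iff h hp ht hs' hy, hq]
      simp [hc]

/-- Neighbours of a vertex have different colours, so the colours along a walk determine it from its
start. Only the exponents remain undetermined. -/
theorem relComp_colorStep (h : IsSparse Γ col) (hp : Odd p) {t : ℕ}
    (ht : Fintype.card W < 2 ^ t) (root : W) {w w' : W} (P : Γ.Walk w w') :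
    ∃ l : List (Fin 10), l.length = P.length ∧
      ∀ (x : MeklerGroup p Γ) (s : ZMod p), s ≠ 0 → vec x = Pi.single w s →
        (∃ y, RelComp ((l.map (ColorStep t)).map fun R => R _ (pebbles p Γ col root)) x y) ∧
        ∀ y, RelComp ((l.map (ColorStep t)).map fun R => R _ (pebbles p Γ col root)) x y →
          ∃ s', s' ≠ 0 ∧ vec y = Pi.single w' s' := by
  induction P with
  | nil =>
    refine ⟨[], rfl, fun x s hs hx => ⟨⟨x, rfl⟩, ?_⟩⟩
    rintro y (rfl : x = y)
    exact ⟨s, hs, hx⟩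
  | @cons u v w' hadj P ih =>
    obtain ⟨l, hl, H⟩ := ih
    refine ⟨col v :: l, by simp [hl], fun x s hs hx => ⟨?_, ?_⟩⟩
    · obtain ⟨y, hy⟩ := (H (gen p Γ v) 1 one_ne_zero (vec_gen v)).1
      refine ⟨y, gen p Γ v, ?_, hy⟩
      exact (colorStep_iff h hp ht root hs hx _ _).2 ⟨v, 1, one_ne_zero, vec_gen v, hadj, rfl⟩
    · rintro y ⟨z, hz, hzy⟩
      obtain ⟨v', s', hs', hz', hadj', hcol⟩ := (colorStep_iff h hp ht root hs hx _ _).1 hz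
      obtain rfl := h.color u v' v hadj' hadj hcol
      exact (H z s' hs' hz').2 y hzy

/-- A path repeats no vertex, so its length is below `|W| < 2 ^ t`. The exponent is then normalised:
removing `y` from the product of its colour must clear the coordinate at `w`, and that coordinate is
`1`. -/
theorem exists_atPath (h : IsSparse Γ col) (hp : Odd p) {t : ℕ} (ht : Fintype.card W < 2 ^ t)
    (root w : W) : ∃ l : List (Fin 10), l.length ≤ 2 ^ t ∧ ∀ y : MeklerGroup p Γ,
      AtPath t l (col w) _ (pebbles p Γ col root) y ↔ vec y = Pi.single w 1 := by
  obtain ⟨P, hP⟩ := (h.connected.preconnected root w).exists_isPath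
  obtain ⟨l, hl, H⟩ := relComp_colorStep h hp ht root P
  obtain ⟨⟨x, hx⟩, H₂⟩ := H (pebbles p Γ col root none) 1 one_ne_zero (vec_gen root)
  have hq : vec (pebbles p Γ col root (some (col w))) = fun u => if col u = col w then 1 else 0 :=
    vec_ofVec _
  refine ⟨l, by have := hP.length_lt; omega, fun y => ⟨?_, fun hy => ?_⟩⟩
  · rintro ⟨hv, ⟨x', hx', hsame⟩, d, hd, hav⟩
    obtain ⟨w', s, hs, hy⟩ := (isVertexLike_iff h hp y).1 hv
    obtain ⟨s', hs', hx''⟩ := H₂ x' hx'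
    rw [sameCentralizer_iff h hp hs' hs hx'' hy] at hsame
    subst hsame
    rw [avoids_iff h hp ht hs hy] at hav
    have := congrFun (congrArg vec hd) w
    rw [vec_mul, hq, Pi.add_apply, hav, hy] at this
    simp only [Pi.single_eq_same, if_true, zero_add] at this
    rw [hy, this]
  · refine ⟨(isVertexLike_iff h hp y).2 ⟨w, 1, one_ne_zero, hy⟩, ⟨x, hx, ?_⟩, ?_⟩
    · obtain ⟨s', hs', hx''⟩ := H₂ x hx
      exact (sameCentralizer_iff h hp hs' one_ne_zero hx'' hy).2 rfl
    · refine ⟨_ * y⁻¹, inv_mul_cancel_right _ y, ?_⟩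
      rw [avoids_iff h hp ht one_ne_zero hy, vec_mul, hq, vec_inv, hy]
      simp

end Sparse

/-! ### Identification of Mekler groups -/

open scoped commutatorElement Classical IsMulCommutative

section Identification

variable {p : ℕ} [Fact p.Prime] {W : Type} [Fintype W] {Γ : SimpleGraph W} {col : W → Fin 10}

/-- A homomorphism from a Mekler group that is injective on the derived part is injective. -/
theorem mekler_injective (h : IsSparse Γ col) (hp : Odd p) {H : Type} [Group H]
    (φ : MeklerGroup p Γ →* H) (hφ : ∀ z ∈ derivedPart p Γ, φ z = 1 → z = 1) :
    Function.Injective φ := by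
  rw [injective_iff_map_eq_one]
  intro g hg
  by_cases hv : vec g = 0
  · exact hφ g (mem_derivedPart_of_vec_eq_zero hv) hg
  -- All commutators of a kernel element `g` lie in the kernel and in the derived part, hence are
  -- trivial. So `g` would be central, which means `vec g = 0`.
  · exfalso
    apply hv
    rw [← isCentral_iff h hp]
    intro y
    rw [← commutatorElement_eq_one_iff_mul_comm]
    refine hφ _ (mem_derivedPart_of_vec_eq_zero (vec_commutator g y)) ?_
    rw [map_commutatorElement, hg, commutatorElement_one_left]

/-- Elements with the same exponents differ by a central factor, which cancels in commutators.
Witnesses of `AtPath` may therefore be chosen freely. -/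
theorem commutator_eq_of_vec {x y x' y' : MeklerGroup p Γ} (h : IsSparse Γ col) (hp : Odd p)
    (hx : vec x = vec x') (hy : vec y = vec y') : ⁅x, y⁆ = ⁅x', y'⁆ := by
  have cx : IsCentral (x'⁻¹ * x) := (isCentral_iff h hp _).2 (by simp [vec_mul, vec_inv, hx])
  have cy : IsCentral (y'⁻¹ * y) := (isCentral_iff h hp _).2 (by simp [vec_mul, vec_inv, hy])
  obtain ⟨a, ha, rfl⟩ : ∃ a, IsCentral a ∧ x = x' * a := ⟨_, cx, by group⟩
  obtain ⟨b, hb, rfl⟩ : ∃ b, IsCentral b ∧ y = y' * b := ⟨_, cy, by group⟩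
  have e₁ : x' * a * (y' * b) = x' * y' * (a * b) := by
    rw [mul_assoc, ← mul_assoc a, ha y']; simp only [mul_assoc]
  have e₂ : y' * b * (x' * a) = y' * x' * (a * b) := by
    rw [mul_assoc, ← mul_assoc b, hb x', ha b]; simp only [mul_assoc]
  have : ∀ u v : MeklerGroup p Γ, ⁅u, v⁆ = u * v * (v * u)⁻¹ := fun u v => by
    rw [commutatorElement_def]; group
  rw [this, this, e₁, e₂]
  group

/-- If the tuple with the pebbles of a Mekler group is equivalent to a tuple over another
group, after sufficiently many rounds, then the Mekler group embeds into the other group. -/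
theorem exists_embedding (h : IsSparse Γ col) (hp : Odd p) {t k : ℕ} (hk : 20 ≤ k)
    (ht : Fintype.card W < 2 ^ t) (hpt : p ≤ 2 ^ 2 ^ t) (root : W) (σ : Pebble → Fin k)
    {H : Type} [Group H] {g : Fin k → MeklerGroup p Γ} {g' : Fin k → H}
    (hσ : g ∘ σ = pebbles p Γ col root) (e : WLEquiv (7 * t + 14) g g') :
    ∃ φ : MeklerGroup p Γ →* H, Function.Injective φ := by
  choose l hl hAt using exists_atPath h hp ht root
  let A : W → ∀ (K : Type) [Group K], (Pebble → K) → K → Prop := fun w K _ q y =>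
    AtPath t (l w) (col w) K q y
  have hA : ∀ w, WLInv k (t + t + 6) (α := Option Pebble) fun K _ v =>
      A w K (fun a => v (some a)) (v none) := fun w => inv_atPath hk t t (l w) (hl w) (col w)
  -- In the Mekler group, `A w` describes exactly the generator of `w` up to central factors. The
  -- relators are now checked for all such elements there and transferred to `H`.
  have hAG : ∀ w y, A w _ (g ∘ σ) y ↔ vec y = Pi.single w 1 := by rw [hσ]; exact hAt
  set q' := g' ∘ σ with hq'
  have ex : ∀ w, ∃ y, A w H q' y := by
    intro w
    have : WLInv k (t + t + 7) (α := Pebble) fun K _ v => ∃ y, A w K v y :=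
      WLInv.ex (by simp; omega) (hA w)
    exact (this _ _ g g' (e.mono (by omega)) σ).1 ⟨gen p Γ w, (hAG w _).2 (vec_gen w)⟩
  have hpow : ∀ w y, A w H q' y → y ^ p = 1 := by
    intro w
    have : WLInv k (3 * t + t + t + 8) (α := Pebble) fun K _ v => ∀ y, A w K v y → y ^ p = 1 := by
      have h₁ : WLInv k (3 * t + t + t + 8) (α := Pebble) fun K _ v => ∀ y, A w K v y →
          ∃ z, z = y ^ p ∧ z * z = z := by
        apply WLInv.all (by simp; omega)
        refine WLInv.imp ((hA w).mono (by omega)) ?_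
        apply WLInv.ex (by simp; omega)
        exact (((WLInv.pow (by omega) t p hpt).mono (by omega)).reindex ![some none, none]).and
          (WLInv.mul none none none)
      exact h₁.congr fun K _ v => by simp
    refine (this _ _ g g' (e.mono (by omega)) σ).1 fun y hy => ?_
    -- Here `y` is the generator times an element of the derived part, which is central and has
    -- trivial `p`-th power.
    rw [hAG] at hy
    have hz : (gen p Γ w)⁻¹ * y ∈ derivedPart p Γ :=
      mem_derivedPart_of_vec_eq_zero (by simp [vec_mul, vec_inv, vec_gen, hy])
    have hc : Commute (gen p Γ w) ((gen p Γ w)⁻¹ * y) :=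
      Subgroup.mem_center_iff.1 (derivedPart_le_center hz) _
    rw [← mul_inv_cancel_left (gen p Γ w) y, hc.mul_pow, gen_pow, one_mul,
      pow_eq_one_of_mem_derivedPart hz]
  have hclass : ∀ x y z : H, ⁅⁅x, y⁆, z⁆ = 1 := by
    have : WLInv k 7 (α := Pebble) fun K _ _ => ∀ x y z : K, ⁅⁅x, y⁆, z⁆ = 1 := by
      -- Here `m` and `n` name the two products, and `c * n = m` forces `c` to be the commutator.
      have h₁ : WLInv k 7 (α := Pebble) fun K _ _ => ∀ x : K, ∀ y : K, ∀ m : K, ∀ n : K, ∀ c : K,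
          x * y = m → y * x = n → c * n = m → IsCentral c := by
        iterate 5 apply WLInv.all (by simp; omega)
        exact (WLInv.mul _ _ _).imp ((WLInv.mul _ _ _).imp ((WLInv.mul _ _ _).imp
          ((inv_isCentral (r := 0) hk).reindex ![none])))
      refine h₁.congr fun K _ v => ⟨fun H x y z => ?_, fun H x y m n c h₁ h₂ h₃ z => ?_⟩
      · rw [commutatorElement_eq_one_iff_mul_comm]
        refine H x y _ _ ⁅x, y⁆ rfl rfl ?_ z
        rw [commutatorElement_def]; group
      · have : c = ⁅x, y⁆ := by
          rw [eq_mul_inv_of_mul_eq h₃, ← h₁, ← h₂, commutatorElement_def]; group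
        rw [this, ← commutatorElement_eq_one_iff_mul_comm]
        exact H x y z
    refine (this _ _ g g' (e.mono (by omega)) σ).1 fun x y z => ?_
    rw [commutatorElement_eq_one_iff_mul_comm]
    exact (isCentral_iff h hp _).2 (vec_commutator x y) z
  have hadj : ∀ u v, Γ.Adj u v → ∀ x y, A u H q' x → A v H q' y → ⁅x, y⁆ = 1 := by
    intro u v huv
    have : WLInv k (t + t + 8) (α := Pebble) fun K _ q => ∀ x, ∀ y, A u K q x → A v K q y →
        x * y = y * x := by
      iterate 2 apply WLInv.all (by simp; omega)
      refine WLInv.imp ?_ (WLInv.imp ?_ ?_)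
      · exact (hA u).reindex fun o => o.elim (some none) fun a => some (some a)
      · exact (hA v).reindex fun o => o.elim none fun a => some (some a)
      · exact (inv_comm (r := t + t + 5) hk).reindex ![some none, none]
    intro x y hx hy
    rw [commutatorElement_eq_one_iff_mul_comm]
    refine (this _ _ g g' (e.mono (by omega)) σ).1 (fun x y hx hy => ?_) x y hx hy
    rw [hAG] at hx hy
    rw [comm_single_iff hp one_ne_zero hx, hy]
    intro w _ hw
    rw [Pi.single_eq_of_ne]
    rintro rfl; exact hw huv
  choose f hf using ex
  obtain ⟨φ, hφ⟩ := exists_meklerHom (p := p) (Γ := Γ) f (fun w => hpow w _ (hf w))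
    (fun x y z => hclass _ _ _) fun u v huv => hadj u v huv _ _ (hf u) (hf v)
  refine ⟨φ, mekler_injective h hp φ fun z hz hz1 => ?_⟩
  obtain ⟨c, hc, -⟩ := exists_exponents hz
  -- The list spells out `z` as a product of powers of commutators of definable elements. It has
  -- `|W| ^ 2 ≤ 2 ^ (2 * t)` entries, so its composition costs `2 * t` rounds.
  let L : List (RelFamily Pebble) := Finset.univ.toList.map fun e : W × W =>
    CommPowStep (A e.1) (A e.2) (c e).val
  -- The rounds add up to the assumed `7 * t + 14`. The identity `o` is both start and end of the
  -- composition, so the predicate says that the spelled-out product can be trivial.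
  have hL : WLInv k (t + t + 6 + 3 * t + 7 + 2 * t + 1) (α := Pebble) fun K _ q =>
      ∃ o, o * o = o ∧ RelComp (L.map fun R => R K q) o o := by
    apply WLInv.ex (by simp; omega)
    refine (WLInv.mul none none none).and ?_
    have := WLInv.relComp (k := k) (r := t + t + 6 + 3 * t + 7) (α := Pebble) (by simp; omega)
      (2 * t) L (by
        have : Fintype.card W * Fintype.card W ≤ 2 ^ t * 2 ^ t := Nat.mul_le_mul ht.le ht.le
        simpa [L, Finset.card_univ, two_mul, pow_add] using this) (by
        intro R hR
        obtain ⟨e, -, rfl⟩ := List.mem_map.1 hR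
        exact inv_commPowStep hk (hA e.1) (hA e.2) t _ ((ZMod.val_lt _).le.trans hpt))
    exact this.reindex fun o => o.elim none fun o => o.elim none some
  have hprod : ∀ (l : List (W × W)),
      RelComp ((l.map fun e : W × W => CommPowStep (A e.1) (A e.2) (c e).val).map
        fun R => R H q') 1
          (φ ((l.map fun e => genComm p Γ e ^ (c e).val).prod : Subgroup.center _)) := by
    suffices ∀ (l : List (W × W)) (x : H),
      RelComp ((l.map fun e : W × W => CommPowStep (A e.1) (A e.2) (c e).val).map
        fun R => R H q') x
        (x * φ ((l.map fun e => genComm p Γ e ^ (c e).val).prod : Subgroup.center _)) from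
      fun l => by simpa using this l 1
    intro l
    induction l with
    | nil => intro x; simp [RelComp]
    | cons e l ih =>
      intro x
      refine ⟨x * ⁅f e.1, f e.2⁆ ^ (c e).val, ⟨f e.1, f e.2, ⁅f e.1, f e.2⁆, _, hf _, hf _, ?_, rfl,
        rfl⟩, ?_⟩
      · rw [commutatorElement_def]; group
      · have : φ ((genComm p Γ e : Subgroup.center _) : MeklerGroup p Γ) = ⁅f e.1, f e.2⁆ := by
          rw [← hφ, ← hφ, ← map_commutatorElement]; rfl
        rw [List.map_cons, List.prod_cons, Subgroup.coe_mul, map_mul, Subgroup.coe_pow, map_pow,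
          this, ← mul_assoc]
        exact ih _
  have hH : ∃ o, o * o = o ∧ RelComp (L.map fun R => R H q') o o := by
    refine ⟨1, mul_one 1, ?_⟩
    have := hprod Finset.univ.toList
    rwa [Finset.prod_map_toList, ← hc, hz1] at this
  obtain ⟨o, ho, hG⟩ := (hL _ _ g g' (e.mono (by omega)) σ).2 hH
  obtain rfl : o = 1 := by simpa using ho
  -- On the Mekler side commutators do not depend on the witnesses, so the composition is
  -- multiplication by `z`. The transferred statement then reads `z = 1`.
  have huniq : ∀ (l : List (W × W)) (x y : MeklerGroup p Γ),
      RelComp ((l.map fun e : W × W => CommPowStep (A e.1) (A e.2) (c e).val).map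
        fun R => R _ (g ∘ σ)) x y →
      y = x * ((l.map fun e => genComm p Γ e ^ (c e).val).prod : Subgroup.center _) := by
    intro l
    induction l with
    | nil => intro x y hxy; simpa using (show x = y from hxy).symm
    | cons e l ih =>
      rintro x y ⟨z, ⟨a, b, m, d, ha, hb, hm, rfl, rfl⟩, hzy⟩
      rw [hAG] at ha hb
      have hm' : m = ⁅gen p Γ e.1, gen p Γ e.2⁆ := by
        rw [← commutator_eq_of_vec h hp (ha.trans (vec_gen _).symm) (hb.trans (vec_gen _).symm),
          eq_mul_inv_of_mul_eq hm.symm, commutatorElement_def]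
        group
      rw [ih _ _ hzy, List.map_cons, List.prod_cons, Subgroup.coe_mul, Subgroup.coe_pow, hm',
        mul_assoc]
      rfl
  have := huniq _ _ _ hG
  rw [Finset.prod_map_toList, ← hc, one_mul] at this
  exact this.symm

theorem lt_two_pow_two_pow_loglog (n : ℕ) : n < 2 ^ 2 ^ (loglog n + 1) := by
  have h₁ : Nat.log 2 n < 2 ^ (loglog n + 1) := Nat.lt_pow_succ_log_self one_lt_two _
  exact (Nat.lt_pow_succ_log_self one_lt_two n).trans_le (Nat.pow_le_pow_right two_pos h₁)

/-- Mekler groups of sparse graphs are identified by `O(log log n)` rounds of the count-free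
refinement of constant dimension among the groups of the same order. -/
theorem mekler_iso_of_wlEquiv (h : IsSparse Γ col) (hp : Odd p) {H : Type} [Group H] [Finite H]
    (hcard : Nat.card (MeklerGroup p Γ) = Nat.card H) {g : Fin 20 → MeklerGroup p Γ}
    {g' : Fin 20 → H} {r : ℕ} (hr : 48 * loglog (Nat.card (MeklerGroup p Γ)) ≤ r)
    (e : WLEquiv r g g') : Nonempty (MeklerGroup p Γ ≃* H) := by
  have := h.connected.nonempty
  obtain ⟨root⟩ := this
  set n := Nat.card (MeklerGroup p Γ) with hn
  have hn1 : p ^ Fintype.card W ≤ n := pow_card_le_card_mekler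
  have hp2 : 2 ≤ p := (Fact.out : p.Prime).two_le
  have hlog : Fintype.card W ≤ Nat.log 2 n :=
    Nat.le_log_of_pow_le one_lt_two ((Nat.pow_le_pow_left hp2 _).trans hn1)
  have hW : 2 ≤ Fintype.card W := by
    obtain ⟨u, v, huv, -⟩ := h.degree root
    exact Fintype.one_lt_card_iff.2 ⟨u, v, huv⟩
  have hll : 1 ≤ loglog n := Nat.le_log_of_pow_le one_lt_two (by simpa using hW.trans hlog)
  have hpn : p ≤ n := le_trans (by
    calc p = p ^ 1 := (pow_one p).symm
      _ ≤ p ^ Fintype.card W := Nat.pow_le_pow_right (by omega) (by omega)) hn1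
  have ht : Fintype.card W < 2 ^ (loglog n + 1) :=
    hlog.trans_lt (Nat.lt_pow_succ_log_self one_lt_two _)
  let σ : Pebble → Fin 20 := fun o => o.elim 0 fun c => ⟨c + 1, by omega⟩
  have hσ : Function.Injective σ := by
    rintro (_ | a) (_ | b) hab
    · rfl
    · exact absurd (congrArg Fin.val hab) (Nat.succ_ne_zero _).symm
    · exact absurd (congrArg Fin.val hab) (Nat.succ_ne_zero _)
    · exact congrArg some (Fin.ext (Nat.succ_injective (congrArg Fin.val hab)))
  -- Only eleven of the twenty positions carry pebbles; the others are filled with `1`.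
  obtain ⟨g₁, hg₁⟩ : ∃ g₁ : Fin 20 → MeklerGroup p Γ, g₁ ∘ σ = pebbles p Γ col root :=
    ⟨Function.extend σ (pebbles p Γ col root) 1, Function.extend_comp hσ _ _⟩
  -- Twenty rounds move the given equivalence to the pebbled tuple. With `t = loglog n + 1` the
  -- total is `7 * loglog n + 41`, at most `48 * loglog n` because `loglog n ≥ 1`.
  obtain ⟨h₁, e₁⟩ := (e.mono (r := 7 * (loglog n + 1) + 14 + 20) (by omega)).exists_tuple g₁
  obtain ⟨φ, hφ⟩ := exists_embedding h hp le_rfl ht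
    (hpn.trans (lt_two_pow_two_pow_loglog n).le) root σ hg₁ e₁
  have hb : Function.Bijective φ := by
    have : Finite (MeklerGroup p Γ) := inferInstance
    exact (Nat.bijective_iff_injective_and_card φ).2 ⟨hφ, hcard⟩
  exact ⟨MulEquiv.ofBijective φ hb⟩

end Identification

/-! ### The CFI graphs of cubic graphs -/

section Cubic

open scoped Classical

variable {V : Type} {Γ : SimpleGraph V}

/-- Every vertex has exactly three neighbours. -/
def IsCubic (Γ : SimpleGraph V) : Prop :=
  ∀ v, ∃ a b c, a ≠ b ∧ a ≠ c ∧ b ≠ c ∧ ∀ w, Γ.Adj v w ↔ w = a ∨ w = b ∨ w = c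

theorem IsBaseGraph.isCubic (h : IsBaseGraph Γ) : IsCubic Γ := by
  obtain ⟨_, _, hl, hr⟩ := h
  intro v
  have := hr v
  rw [SimpleGraph.degree, Finset.card_eq_three] at this
  obtain ⟨a, b, c, hab, hac, hbc, h⟩ := this
  refine ⟨a, b, c, hab, hac, hbc, fun w => ?_⟩
  rw [← SimpleGraph.mem_neighborFinset, h]
  simp

/-- Even sets of neighbours of `v`. -/
def EvenNbrs (Γ : SimpleGraph V) (v : V) (S : Finset V) : Prop :=
  (∀ w ∈ S, Γ.Adj v w) ∧ Even S.card

/-- Sets that agree at two of the three neighbours can differ only at the third, and parity decides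
that one. -/
theorem EvenNbrs.eq_of_agree (h : IsCubic Γ) {v : V} {S S' : Finset V} (hS : EvenNbrs Γ v S)
    (hS' : EvenNbrs Γ v S') {w w' : V} (hw : Γ.Adj v w) (hw' : Γ.Adj v w') (hne : w ≠ w')
    (h₁ : w ∈ S ↔ w ∈ S') (h₂ : w' ∈ S ↔ w' ∈ S') : S = S' := by
  obtain ⟨x, hx, hx₁⟩ : ∃ x, Γ.Adj v x ∧ ∀ y, Γ.Adj v y → y = w ∨ y = w' ∨ y = x := by
    obtain ⟨a, b, c, -, -, -, hN⟩ := h v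
    have hall := fun y => (hN y).1
    rcases (hN w).1 hw with rfl | rfl | rfl <;> rcases (hN w').1 hw' with rfl | rfl | rfl
    · exact absurd rfl hne
    · exact ⟨c, (hN c).2 (by simp), fun y hy => by have := hall y hy; tauto⟩
    · exact ⟨b, (hN b).2 (by simp), fun y hy => by have := hall y hy; tauto⟩
    · exact ⟨c, (hN c).2 (by simp), fun y hy => by have := hall y hy; tauto⟩
    · exact absurd rfl hne
    · exact ⟨a, (hN a).2 (by simp), fun y hy => by have := hall y hy; tauto⟩
    · exact ⟨b, (hN b).2 (by simp), fun y hy => by have := hall y hy; tauto⟩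
    · exact ⟨a, (hN a).2 (by simp), fun y hy => by have := hall y hy; tauto⟩
    · exact absurd rfl hne
  have agree : ∀ y, y ≠ x → (y ∈ S ↔ y ∈ S') := by
    intro y hy
    by_cases hvy : Γ.Adj v y
    · rcases hx₁ y hvy with rfl | rfl | rfl
      · exact h₁
      · exact h₂
      · exact absurd rfl hy
    · exact ⟨fun h => absurd (hS.1 y h) hvy, fun h => absurd (hS'.1 y h) hvy⟩
  have herase : S.erase x = S'.erase x := by
    ext y
    by_cases hy : y = x
    · simp [hy]
    · simp [hy, agree y hy]
  have hxx : x ∈ S ↔ x ∈ S' := by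
    have e₁ := hS.2
    have e₂ := hS'.2
    by_contra hc
    by_cases hxS : x ∈ S
    · have hxS' : x ∉ S' := fun h' => hc ⟨fun _ => h', fun _ => hxS⟩
      rw [← Finset.card_erase_add_one hxS, herase, Finset.erase_eq_of_notMem hxS',
        Nat.even_add_one] at e₁
      exact e₁ e₂
    · have hxS' : x ∈ S' := by
        by_contra h'
        exact hc ⟨fun h => absurd h hxS, fun h => absurd h h'⟩
      rw [← Finset.card_erase_add_one hxS', ← herase, Finset.erase_eq_of_notMem hxS,
        Nat.even_add_one] at e₂
      exact e₂ e₁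
  ext y
  by_cases hy : y = x
  · subst hy; exact hxx
  · exact agree y hy

/-- Otherwise the two sets would partition the three neighbours, but two even numbers do not add up
to three. -/
theorem EvenNbrs.exists_agree (h : IsCubic Γ) {v : V} {S S' : Finset V} (hS : EvenNbrs Γ v S)
    (hS' : EvenNbrs Γ v S') : ∃ w, Γ.Adj v w ∧ (w ∈ S ↔ w ∈ S') := by
  by_contra hc
  push Not at hc
  obtain ⟨a, b, c, hab, hac, hbc, hN⟩ := h v
  have hdis : Disjoint S S' := by
    rw [Finset.disjoint_left]
    intro y hy hy'
    rcases hc y (hS.1 y hy) with h | h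
    · exact h.2 hy'
    · exact h.1 hy
  have hun : S ∪ S' = {a, b, c} := by
    ext y
    rw [Finset.mem_union]
    simp only [Finset.mem_insert, Finset.mem_singleton]
    rw [← hN]
    constructor
    · rintro (hy | hy)
      · exact hS.1 y hy
      · exact hS'.1 y hy
    · intro hy
      rcases hc y hy with h | h
      · exact Or.inl h.1
      · exact Or.inr h.2
  have hcard := Finset.card_union_of_disjoint hdis
  rw [hun, Finset.card_eq_three.2 ⟨a, b, c, hab, hac, hbc, rfl⟩] at hcard
  have := hS.2.add hS'.2
  rw [← hcard] at this
  exact absurd this (by decide)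

/-- The third neighbour is free to repair the parity. -/
theorem exists_evenNbrs (h : IsCubic Γ) {v w w' : V} (hw : Γ.Adj v w) (hw' : Γ.Adj v w')
    (hne : w ≠ w') (P Q : Prop) : ∃ S, EvenNbrs Γ v S ∧ (w ∈ S ↔ P) ∧ (w' ∈ S ↔ Q) := by
  obtain ⟨x, hx, hxw, hxw'⟩ : ∃ x, Γ.Adj v x ∧ x ≠ w ∧ x ≠ w' := by
    obtain ⟨a, b, c, hab, hac, hbc, hN⟩ := h v
    by_contra hc
    push Not at hc
    have h₁ := hc a ((hN a).2 (by simp))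
    have h₂ := hc b ((hN b).2 (by simp))
    have h₃ := hc c ((hN c).2 (by simp))
    by_cases haw : a = w
    · have hb := h₂ (fun h => hab (haw.trans h.symm))
      have hc := h₃ (fun h => hac (haw.trans h.symm))
      exact hbc (hb.trans hc.symm)
    · have ha := h₁ haw
      by_cases hbw : b = w
      · exact hac (ha.trans (h₃ fun h => hbc (hbw.trans h.symm)).symm)
      · exact hab (ha.trans (h₂ hbw).symm)
  have pair : ∀ {y z : V}, Γ.Adj v y → Γ.Adj v z → y ≠ z → EvenNbrs Γ v {y, z} := by
    intro y z hy hz hyz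
    refine ⟨?_, ?_⟩
    · intro u hu
      rcases Finset.mem_insert.1 hu with rfl | hu
      · exact hy
      · rw [Finset.mem_singleton.1 hu]; exact hz
    · rw [Finset.card_pair hyz]; decide
  by_cases hP : P <;> by_cases hQ : Q
  · exact ⟨{w, w'}, pair hw hw' hne, by simp [hP], by simp [hQ]⟩
  · exact ⟨{w, x}, pair hw hx hxw.symm, by simp [hP], by simp [hQ, hne.symm, hxw'.symm]⟩
  · exact ⟨{w', x}, pair hw' hx hxw'.symm, by simp [hP, hne, hxw.symm], by simp [hQ]⟩
  · exact ⟨∅, ⟨by simp, by simp⟩, by simp [hP], by simp [hQ]⟩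

theorem IsCubic.exists_other (h : IsCubic Γ) (v w : V) : ∃ w', Γ.Adj v w' ∧ w ≠ w' := by
  obtain ⟨a, b, c, hab, -, -, hN⟩ := h v
  by_cases hw : w = a
  · exact ⟨b, (hN b).2 (by simp), by rw [hw]; exact hab⟩
  · exact ⟨a, (hN a).2 (by simp), hw⟩

/-- The internal vertex that belongs to an even set of neighbours. -/
def intV {v : V} {S : Finset V} (h : EvenNbrs Γ v S) : CFIVertex Γ := .int v S h.1 h.2

theorem intV_inj {v v' : V} {S S' : Finset V} {h : EvenNbrs Γ v S} {h' : EvenNbrs Γ v' S'} :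
    intV h = intV h' ↔ v = v' ∧ S = S' := by simp [intV]

theorem cfi_cases (x : CFIVertex Γ) :
    (∃ d b, x = .ext d b) ∨ ∃ v S, ∃ h : EvenNbrs Γ v S, x = intV h := by
  rcases x with ⟨d, b⟩ | ⟨v, S, h₁, h₂⟩
  · exact Or.inl ⟨d, b, rfl⟩
  · exact Or.inr ⟨v, S, ⟨h₁, h₂⟩, rfl⟩

/-! ### Short cycles, connectedness and degrees in CFI graphs -/

section Adjacency

variable {T : Set (Sym2 V)}

theorem adj_ext_ext {d d' : Γ.Dart} {b b' : Bool} :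
    (twistedCFI Γ T).Adj (.ext d b) (.ext d' b') ↔ d' = d.symm ∧ (b' = b ↔ d.edge ∉ T) := Iff.rfl

theorem adj_ext_int {d : Γ.Dart} {b : Bool} {v : V} {S : Finset V} {h : EvenNbrs Γ v S} :
    (twistedCFI Γ T).Adj (.ext d b) (intV h) ↔ d.fst = v ∧ (b = true ↔ d.snd ∈ S) := Iff.rfl

theorem adj_int_ext {d : Γ.Dart} {b : Bool} {v : V} {S : Finset V} {h : EvenNbrs Γ v S} :
    (twistedCFI Γ T).Adj (intV h) (.ext d b) ↔ d.fst = v ∧ (b = true ↔ d.snd ∈ S) := Iff.rfl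

theorem not_adj_int_int {v v' : V} {S S' : Finset V} {h : EvenNbrs Γ v S} {h' : EvenNbrs Γ v' S'} :
    ¬ (twistedCFI Γ T).Adj (intV h) (intV h') := id

theorem dart_eq {d d' : Γ.Dart} (h₁ : d.fst = d'.fst) (h₂ : d.snd = d'.snd) : d = d' :=
  SimpleGraph.Dart.ext _ _ (Prod.ext h₁ h₂)

theorem exists_adj_int {v : V} {S : Finset V} {x : CFIVertex Γ} (h : EvenNbrs Γ v S)
    (hx : (twistedCFI Γ T).Adj (intV h) x) :
    ∃ d b, x = .ext d b ∧ d.fst = v ∧ (b = true ↔ d.snd ∈ S) := by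
  rcases cfi_cases x with ⟨d, b, rfl⟩ | ⟨v, S, h', rfl⟩
  · exact ⟨d, b, rfl, hx⟩
  · exact absurd hx not_adj_int_int

theorem bool_eq_of_iff {b b' : Bool} {P : Prop} (h : b = true ↔ P) (h' : b' = true ↔ P) : b = b' :=
  Bool.eq_iff_iff.2 (h.trans h'.symm)

theorem twisted_bool {b b' c : Bool} {P : Prop} (h : c = b ↔ P) (h' : c = b' ↔ P) : b = b' := by
  revert h h'
  cases b <;> cases b' <;> cases c <;> simp

/-- An external vertex has only one external neighbour, and an internal vertex has no internal ones.
A 4-cycle would therefore contain two internal vertices with two common neighbours; these lie in one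
gadget and agree at two neighbours of its base vertex, so they coincide. -/
theorem cfi_square (h : IsCubic Γ) {u v x y : CFIVertex Γ} (huv : u ≠ v) (hxy : x ≠ y)
    (hux : (twistedCFI Γ T).Adj u x) (huy : (twistedCFI Γ T).Adj u y)
    (hvx : (twistedCFI Γ T).Adj v x) : ¬ (twistedCFI Γ T).Adj v y := by
  intro hvy
  -- two internal vertices with two common neighbours are equal
  have key : ∀ {a a' : V} {S S' : Finset V} (hS : EvenNbrs Γ a S) (hS' : EvenNbrs Γ a' S')
      {x y : CFIVertex Γ}, x ≠ y → (twistedCFI Γ T).Adj (intV hS) x →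
      (twistedCFI Γ T).Adj (intV hS) y → (twistedCFI Γ T).Adj (intV hS') x →
      (twistedCFI Γ T).Adj (intV hS') y → intV hS = intV hS' := by
    intro a a' S S' hS hS' x y hxy h₁ h₂ h₃ h₄
    obtain ⟨d, b, rfl, rfl, hb⟩ := exists_adj_int hS h₁
    obtain ⟨d', b', rfl, hd', hb'⟩ := exists_adj_int hS h₂
    obtain ⟨rfl, hb₁⟩ := adj_int_ext.1 h₃
    have hb₂ := (adj_int_ext.1 h₄).2
    have hne : d.snd ≠ d'.snd := by
      intro hs
      obtain rfl := dart_eq hd'.symm hs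
      exact hxy (congrArg _ (bool_eq_of_iff hb hb'))
    rw [intV_inj]
    exact ⟨rfl, EvenNbrs.eq_of_agree h hS hS' d.adj (hd' ▸ d'.adj) hne (hb.symm.trans hb₁)
      (hb'.symm.trans hb₂)⟩
  rcases cfi_cases u with ⟨d, b, rfl⟩ | ⟨a, S, hS, rfl⟩ <;>
    rcases cfi_cases v with ⟨d', b', rfl⟩ | ⟨a', S', hS', rfl⟩
  · have hdd : ∀ {e c}, (twistedCFI Γ T).Adj (.ext d b) (.ext e c) →
        ¬ (twistedCFI Γ T).Adj (.ext d' b') (.ext e c) := by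
      intro e c h₁ h₂
      obtain ⟨rfl, h₄⟩ := adj_ext_ext.1 h₁
      obtain ⟨h₃, h₅⟩ := adj_ext_ext.1 h₂
      have hd : d = d' := by rw [← d.symm_symm, h₃, d'.symm_symm]
      subst hd
      exact huv (congrArg _ (twisted_bool h₄ h₅))
    rcases cfi_cases x with ⟨e, c, rfl⟩ | ⟨a, S, hS, rfl⟩
    · exact hdd hux hvx
    rcases cfi_cases y with ⟨e, c, rfl⟩ | ⟨a', S', hS', rfl⟩
    · exact hdd huy hvy
    exact hxy (key hS hS' huv hux.symm hvx.symm huy.symm hvy.symm)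
  · obtain ⟨e, c, rfl, he, hc⟩ := exists_adj_int hS' hvx
    obtain ⟨e', c', rfl, he', hc'⟩ := exists_adj_int hS' hvy
    obtain rfl := (adj_ext_ext.1 hux).1
    obtain rfl := (adj_ext_ext.1 huy).1
    exact hxy (congrArg _ (bool_eq_of_iff hc hc'))
  · obtain ⟨e, c, rfl, he, hc⟩ := exists_adj_int hS hux
    obtain ⟨e', c', rfl, he', hc'⟩ := exists_adj_int hS huy
    obtain rfl := (adj_ext_ext.1 hvx).1
    obtain rfl := (adj_ext_ext.1 hvy).1
    exact hxy (congrArg _ (bool_eq_of_iff hc hc'))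
  · exact huv (key hS hS' hxy hux huy hvx hvy)

/-- Adjacent external vertices lie in different gadgets, so they have no common internal neighbour.
Three external vertices cannot be pairwise adjacent, and internal vertices are never adjacent. -/
theorem cfi_triangle {x y z : CFIVertex Γ} (hxy : (twistedCFI Γ T).Adj x y)
    (hyz : (twistedCFI Γ T).Adj y z) : ¬ (twistedCFI Γ T).Adj x z := by
  intro hxz
  have key : ∀ {d d' : Γ.Dart} {b b' : Bool} {v : V} {S : Finset V} (hS : EvenNbrs Γ v S),
      (twistedCFI Γ T).Adj (.ext d b) (.ext d' b') → (twistedCFI Γ T).Adj (.ext d b) (intV hS) →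
      ¬ (twistedCFI Γ T).Adj (.ext d' b') (intV hS) := by
    intro d d' b b' v S hS h₁ h₂ h₃
    obtain rfl := (adj_ext_ext.1 h₁).1
    have e₁ := (adj_ext_int.1 h₂).1
    have e₂ : d.snd = v := (adj_ext_int.1 h₃).1
    exact d.adj.ne (e₁.trans e₂.symm)
  rcases cfi_cases x with ⟨d, b, rfl⟩ | ⟨a, S, hS, rfl⟩
  · rcases cfi_cases y with ⟨d', b', rfl⟩ | ⟨a', S', hS', rfl⟩
    · rcases cfi_cases z with ⟨d'', b'', rfl⟩ | ⟨a'', S'', hS'', rfl⟩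
      · obtain rfl := (adj_ext_ext.1 hxy).1
        obtain rfl := (adj_ext_ext.1 hyz).1
        have := (adj_ext_ext.1 hxz).1
        rw [d.symm_symm] at this
        exact d.symm_ne this.symm
      · exact key hS'' hxy hxz hyz
    · obtain ⟨d'', b'', rfl, -⟩ := exists_adj_int hS' hyz
      exact key hS' hxz hxy hyz.symm
  · obtain ⟨d', b', rfl, -⟩ := exists_adj_int hS hxy
    obtain ⟨d'', b'', rfl, -⟩ := exists_adj_int hS hxz
    exact key hS hyz hxy.symm hxz.symm

/-- The dart from `v` to `w`. -/
def dartOf {v w : V} (h : Γ.Adj v w) : Γ.Dart := ⟨(v, w), h⟩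

theorem exists_ext_adj (d : Γ.Dart) (b : Bool) :
    ∃ b', (twistedCFI Γ T).Adj (.ext d b) (.ext d.symm b') := by
  by_cases h : d.edge ∈ T
  · exact ⟨!b, rfl, by simp [h]⟩
  · exact ⟨b, rfl, by simp [h]⟩

theorem exists_int_adj (h : IsCubic Γ) (d : Γ.Dart) (b : Bool) :
    ∃ S, ∃ hS : EvenNbrs Γ d.fst S, (twistedCFI Γ T).Adj (.ext d b) (intV hS) := by
  obtain ⟨w', hw', hne⟩ := h.exists_other d.fst d.snd
  obtain ⟨S, hS, h₁, -⟩ := exists_evenNbrs h d.adj hw' hne (b = true) True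
  exact ⟨S, hS, rfl, h₁.symm⟩

theorem int_adj_ext {v w : V} {S : Finset V} (hS : EvenNbrs Γ v S) (hw : Γ.Adj v w) :
    (twistedCFI Γ T).Adj (intV hS) (.ext (dartOf hw) (decide (w ∈ S))) :=
  adj_int_ext.2 ⟨rfl, by simp [dartOf]⟩

theorem int_adj_ext_of_agree {v w : V} {S S' : Finset V} (hS : EvenNbrs Γ v S) (hw : Γ.Adj v w)
    (h : w ∈ S ↔ w ∈ S') :
    (twistedCFI Γ T).Adj (intV hS) (.ext (dartOf hw) (decide (w ∈ S'))) :=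
  adj_int_ext.2 ⟨rfl, by simp [dartOf, h]⟩

/-- Two even sets agree at some neighbour, which gives a common external neighbour. -/
theorem int_reachable_int (h : IsCubic Γ) {v : V} {S S' : Finset V} (hS : EvenNbrs Γ v S)
    (hS' : EvenNbrs Γ v S') : (twistedCFI Γ T).Reachable (intV hS) (intV hS') := by
  obtain ⟨w, hw, hag⟩ := EvenNbrs.exists_agree h hS hS'
  exact (int_adj_ext_of_agree hS hw hag).reachable.trans (int_adj_ext hS' hw).symm.reachable

/-- Walks of the base graph lift to the internal vertices of empty sets: each base edge connects two
gadgets, and within a gadget all internal vertices are connected. -/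
theorem cfi_connected (h : IsCubic Γ) (hc : Γ.Connected) : (twistedCFI Γ T).Connected := by
  have hempty : ∀ v, EvenNbrs Γ v ∅ := fun v => ⟨by simp, by simp⟩
  have hstep : ∀ {v w : V}, Γ.Adj v w →
      (twistedCFI Γ T).Reachable (intV (hempty v)) (intV (hempty w)) := by
    intro v w hvw
    obtain ⟨b, hb⟩ := exists_ext_adj (T := T) (dartOf hvw) (decide (w ∈ (∅ : Finset V)))
    obtain ⟨S, hS, hS'⟩ := exists_int_adj (T := T) h (dartOf hvw).symm b
    exact (int_adj_ext (hempty v) hvw).reachable.trans (hb.reachable.trans (hS'.reachable.trans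
      (int_reachable_int h hS (hempty w))))
  have hwalk : ∀ v w : V, (twistedCFI Γ T).Reachable (intV (hempty v)) (intV (hempty w)) := by
    intro v w
    obtain ⟨P⟩ := hc.preconnected v w
    induction P with
    | nil => exact SimpleGraph.Reachable.refl _
    | cons hadj _ ih => exact (hstep hadj).trans ih
  have hto : ∀ x : CFIVertex Γ, ∃ v, (twistedCFI Γ T).Reachable x (intV (hempty v)) := by
    intro x
    rcases cfi_cases x with ⟨d, b, rfl⟩ | ⟨v, S, hS, rfl⟩
    · obtain ⟨S, hS, hadj⟩ := exists_int_adj (T := T) h d b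
      exact ⟨d.fst, hadj.reachable.trans (int_reachable_int h hS _)⟩
    · exact ⟨v, int_reachable_int h hS _⟩
  obtain ⟨v₀⟩ := hc.nonempty
  have : Nonempty (CFIVertex Γ) := ⟨intV (hempty v₀)⟩
  refine ⟨fun x y => ?_⟩
  obtain ⟨v, hv⟩ := hto x
  obtain ⟨w, hw⟩ := hto y
  exact hv.trans ((hwalk v w).trans hw.symm)

/-- At an external vertex one membership is fixed, so the set of an internal neighbour is determined
by membership of one further neighbour `w`: two choices, besides the external partner. -/
theorem cfi_nbrs (h : IsCubic Γ) (x : CFIVertex Γ) :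
    ∃ f : Fin 3 → CFIVertex Γ, ∀ y, (twistedCFI Γ T).Adj x y → ∃ i, f i = y := by
  rcases cfi_cases x with ⟨d, b, rfl⟩ | ⟨v, S, hS, rfl⟩
  · obtain ⟨b', hb'⟩ := exists_ext_adj (T := T) d b
    obtain ⟨w, hw, hne⟩ := h.exists_other d.fst d.snd
    obtain ⟨S₁, hS₁, h₁, h₁'⟩ := exists_evenNbrs h d.adj hw hne (b = true) True
    obtain ⟨S₂, hS₂, h₂, h₂'⟩ := exists_evenNbrs h d.adj hw hne (b = true) False
    refine ⟨![.ext d.symm b', intV hS₁, intV hS₂], fun y hy => ?_⟩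
    rcases cfi_cases y with ⟨e, c, rfl⟩ | ⟨v, S, hS, rfl⟩
    · obtain ⟨rfl, hc⟩ := adj_ext_ext.1 hy
      refine ⟨0, congrArg (CFIVertex.ext d.symm) ?_⟩
      have hb := (adj_ext_ext.1 hb').2
      rw [eq_comm] at hb hc
      exact twisted_bool hb hc
    · obtain ⟨rfl, hb⟩ := adj_ext_int.1 hy
      by_cases hwS : w ∈ S
      · exact ⟨1, (intV_inj (h := hS₁)).2 ⟨rfl, EvenNbrs.eq_of_agree h hS₁ hS d.adj hw hne
          (h₁.trans hb) (by simp [h₁', hwS])⟩⟩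
      · exact ⟨2, (intV_inj (h := hS₂)).2 ⟨rfl, EvenNbrs.eq_of_agree h hS₂ hS d.adj hw hne
          (h₂.trans hb) (by simp [h₂', hwS])⟩⟩
  · obtain ⟨a, b, c, -, -, -, hN⟩ := h v
    refine ⟨![.ext (dartOf ((hN a).2 (by simp))) (decide (a ∈ S)),
      .ext (dartOf ((hN b).2 (by simp))) (decide (b ∈ S)),
      .ext (dartOf ((hN c).2 (by simp))) (decide (c ∈ S))], fun y hy => ?_⟩
    obtain ⟨d, β, rfl, rfl, hβ⟩ := exists_adj_int hS hy
    have hβ' : β = decide (d.snd ∈ S) := bool_eq_of_iff hβ (by simp)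
    rcases (hN d.snd).1 d.adj with hs | hs | hs
    · subst hs; exact ⟨0, by rw [hβ']; rfl⟩
    · subst hs; exact ⟨1, by rw [hβ']; rfl⟩
    · subst hs; exact ⟨2, by rw [hβ']; rfl⟩

end Adjacency

/-- In a finite graph of maximal degree `3` there is a colouring with `10` colours in which the
neighbours of each vertex have different colours. -/
theorem exists_nbr_coloring {W : Type} [Finite W] (Δ : SimpleGraph W)
    (h : ∀ x, ∃ f : Fin 3 → W, ∀ y, Δ.Adj x y → ∃ i, f i = y) :
    ∃ col : W → Fin 10, ∀ w u v, Δ.Adj w u → Δ.Adj w v → col u = col v → u = v := by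
  choose f hf using h
  have := Fintype.ofFinite W
  suffices ∀ s : Finset W, ∃ col : W → Fin 10,
      ∀ w, ∀ u ∈ s, ∀ v ∈ s, Δ.Adj w u → Δ.Adj w v → col u = col v → u = v by
    obtain ⟨col, hcol⟩ := this Finset.univ
    exact ⟨col, fun w u v => hcol w u (Finset.mem_univ u) v (Finset.mem_univ v)⟩
  intro s
  induction s using Finset.induction_on with
  | empty => exact ⟨fun _ => 0, by simp⟩
  | insert x s hx ih =>
    obtain ⟨col, hcol⟩ := ih
    -- Greedy colouring: at most `3 * 3 = 9` vertices are reached from `x` in two steps, so a tenth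
    -- colour is free.
    let B : Finset (Fin 10) :=
      Finset.univ.image fun ij : Fin 3 × Fin 3 => col (f (f x ij.1) ij.2)
    obtain ⟨c, hc⟩ : ∃ c, c ∉ B := by
      by_contra hall
      push Not at hall
      have h₁ : B = Finset.univ := Finset.eq_univ_of_forall hall
      have h₂ : B.card ≤ 9 := Finset.card_image_le.trans (by simp)
      rw [h₁] at h₂
      simp at h₂
    have hB : ∀ w v, Δ.Adj w x → Δ.Adj w v → col v ≠ c := by
      rintro w v hwx hwv rfl
      obtain ⟨i, rfl⟩ := hf x w hwx.symm
      obtain ⟨j, rfl⟩ := hf _ v hwv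
      exact hc (Finset.mem_image.2 ⟨(i, j), Finset.mem_univ _, rfl⟩)
    refine ⟨Function.update col x c, ?_⟩
    intro w u hu v hv hwu hwv huv
    by_cases hux : u = x
    · subst hux
      by_contra hne
      rw [Function.update_self, Function.update_of_ne (Ne.symm hne)] at huv
      exact hB w v hwu hwv huv.symm
    · rw [Function.update_of_ne hux] at huv
      by_cases hvx : v = x
      · subst hvx
        rw [Function.update_self] at huv
        exact absurd huv (hB w u hwv hwu)
      · rw [Function.update_of_ne hvx] at huv
        exact hcol w u ((Finset.mem_insert.1 hu).resolve_left hux) v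
          ((Finset.mem_insert.1 hv).resolve_left hvx) hwu hwv huv

instance finite_cfiVertex [Finite V] : Finite (CFIVertex Γ) := by
  have := Fintype.ofFinite V
  have : Finite Γ.Dart := inferInstance
  refine Finite.of_injective (β := (Γ.Dart × Bool) ⊕ (V × Finset V))
    (fun x => match x with
      | .ext d b => Sum.inl (d, b)
      | .int v S _ _ => Sum.inr (v, S)) ?_
  rintro (⟨d, b⟩ | ⟨v, S, h₁, h₂⟩) (⟨d', b'⟩ | ⟨v', S', h₁', h₂'⟩) h <;> simp_all

theorem exists_isSparse_twistedCFI (h : IsBaseGraph Γ) (T : Set (Sym2 V)) :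
    ∃ col, IsSparse (twistedCFI Γ T) col := by
  have hc := h.isCubic
  have := h.1
  obtain ⟨col, hcol⟩ := exists_nbr_coloring (twistedCFI Γ T) (cfi_nbrs hc)
  refine ⟨col, cfi_connected hc h.2.1, fun x y z => cfi_triangle, fun u v x y => cfi_square hc,
    fun w => ?_, hcol⟩
  rcases cfi_cases w with ⟨d, b, rfl⟩ | ⟨v, S, hS, rfl⟩
  · obtain ⟨b', hb'⟩ := exists_ext_adj (T := T) d b
    obtain ⟨S, hS, hS'⟩ := exists_int_adj (T := T) hc d b
    exact ⟨_, _, by simp [intV], hb', hS'⟩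
  · obtain ⟨a, b, c, hab, -, -, hN⟩ := hc v
    refine ⟨_, _, ?_, int_adj_ext hS ((hN a).2 (by simp)), int_adj_ext hS ((hN b).2 (by simp))⟩
    intro he
    simp only [CFIVertex.ext.injEq] at he
    exact hab (congrArg (fun d : Γ.Dart => d.snd) he.1)

end Cubic

/-! ### The CFI graph and the twisted CFI graph are not isomorphic -/

section NotIso

open scoped Classical

variable {V : Type} {Γ : SimpleGraph V} {T : Set (Sym2 V)}

/-- Any two neighbours of `x` are joined by a path of length `4` that avoids `x` in its second and
fourth vertices. -/
def OnHexagons {W : Type} (Δ : SimpleGraph W) (x : W) : Prop :=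
  ∀ y y', y ≠ y' → Δ.Adj x y → Δ.Adj x y' →
    ∃ s t s', s ≠ x ∧ s' ≠ x ∧ Δ.Adj y s ∧ Δ.Adj s t ∧ Δ.Adj t s' ∧ Δ.Adj s' y'

theorem OnHexagons.map {W W' : Type} {Δ : SimpleGraph W} {Δ' : SimpleGraph W'} (φ : Δ ≃g Δ')
    {x : W} (h : OnHexagons Δ x) : OnHexagons Δ' (φ x) := by
  intro y y' hne hy hy'
  obtain ⟨z, rfl⟩ := φ.surjective y
  obtain ⟨z', rfl⟩ := φ.surjective y'
  rw [φ.map_adj_iff] at hy hy'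
  obtain ⟨s, t, s', hs, hs', h₁, h₂, h₃, h₄⟩ := h z z' (fun h => hne (by rw [h])) hy hy'
  exact ⟨φ s, φ t, φ s', φ.injective.ne hs, φ.injective.ne hs', φ.map_adj_iff.2 h₁,
    φ.map_adj_iff.2 h₂, φ.map_adj_iff.2 h₃, φ.map_adj_iff.2 h₄⟩

/-- Take even sets that agree with `S` at exactly one of the two given neighbours, each at a
different one. They disagree at both, but must agree somewhere, so they share an external vertex,
the middle of the path. -/
theorem onHexagons_int (h : IsCubic Γ) {v : V} {S : Finset V} (hS : EvenNbrs Γ v S) :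
    OnHexagons (twistedCFI Γ T) (intV hS) := by
  intro y y' hne hy hy'
  obtain ⟨d, b, rfl, rfl, hb⟩ := exists_adj_int hS hy
  obtain ⟨d', b', rfl, hd', hb'⟩ := exists_adj_int hS hy'
  have hsnd : d.snd ≠ d'.snd := by
    intro hs
    obtain rfl := dart_eq hd'.symm hs
    exact hne (congrArg _ (bool_eq_of_iff hb hb'))
  have had' : Γ.Adj d.fst d'.snd := hd' ▸ d'.adj
  obtain ⟨S₁, hS₁, h₁, h₁'⟩ := exists_evenNbrs h d.adj had' hsnd (d.snd ∈ S) (d'.snd ∉ S)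
  obtain ⟨S₂, hS₂, h₂, h₂'⟩ := exists_evenNbrs h d.adj had' hsnd (d.snd ∉ S) (d'.snd ∈ S)
  obtain ⟨w, hw, hag⟩ := EvenNbrs.exists_agree h hS₁ hS₂
  refine ⟨intV hS₁, .ext (dartOf hw) (decide (w ∈ S₂)), intV hS₂, ?_, ?_, ?_, ?_, ?_, ?_⟩
  · rw [Ne, intV_inj]
    rintro ⟨-, rfl⟩
    tauto
  · rw [Ne, intV_inj]
    rintro ⟨-, rfl⟩
    tauto
  · exact adj_ext_int.2 ⟨rfl, hb.trans h₁.symm⟩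
  · exact int_adj_ext_of_agree hS₁ hw hag
  · exact (int_adj_ext hS₂ hw).symm
  · exact adj_int_ext.2 ⟨hd', hb'.trans h₂'.symm⟩

/-- Take an internal neighbour and the external partner. A path between them that avoids the vertex
must pass between the gadgets of `d.fst` and `d.snd` by an external edge parallel to `d`. Its end
next to the internal neighbour is then the vertex itself. -/
theorem not_onHexagons_ext (h : IsCubic Γ) (d : Γ.Dart) (b : Bool) :
    ¬ OnHexagons (twistedCFI Γ T) (.ext d b) := by
  intro H
  obtain ⟨b', hb'⟩ := exists_ext_adj (T := T) d b
  obtain ⟨S, hS, hadj⟩ := exists_int_adj (T := T) h d b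
  obtain ⟨s, t, s', hs, hs', h₁, h₂, h₃, h₄⟩ := H _ _ (by simp [intV]) hadj hb'
  obtain ⟨e, c, rfl, he, hc⟩ := exists_adj_int hS h₁
  rcases cfi_cases s' with ⟨e', c', rfl⟩ | ⟨a, S', hS', rfl⟩
  · obtain ⟨h₅, h₆⟩ := adj_ext_ext.1 h₄.symm
    rw [d.symm_symm] at h₅
    subst h₅
    have h₇ := (adj_ext_ext.1 hb'.symm).2
    rw [eq_comm] at h₆ h₇
    exact hs' (congrArg _ (twisted_bool h₆ h₇))
  · have ha : d.snd = a := (adj_int_ext.1 h₄).1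
    obtain ⟨e', c', rfl, he', -⟩ := exists_adj_int hS' h₃.symm
    obtain rfl := (adj_ext_ext.1 h₂).1
    have hes : e.snd = d.snd := he'.trans ha.symm
    obtain rfl := dart_eq he hes
    exact hs (congrArg _ (bool_eq_of_iff hc (adj_ext_int.1 hadj).2))

/-- Even sets of neighbours, one at each vertex, cannot disagree along exactly one edge. -/
theorem no_odd_section [Finite V] {S : V → Finset V} (hS : ∀ v, EvenNbrs Γ v (S v)) {e : Sym2 V}
    (he : e ∈ Γ.edgeSet)
    (h : ∀ d : Γ.Dart, (d.fst ∈ S d.snd ↔ d.snd ∈ S d.fst) ↔ d.edge ∉ ({e} : Set (Sym2 V))) :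
    False := by
  have := Fintype.ofFinite V
  obtain ⟨d₀, hd₀⟩ : ∃ d : Γ.Dart, d.edge = e := by
    induction e using Sym2.ind with
    | _ x y => exact ⟨⟨(x, y), he⟩, rfl⟩
  subst hd₀
  -- Double counting modulo 2: `x` sums to the total size of the even sets, which is `0`. The
  -- function `δ` marks one orientation of the exceptional edge and sums to `1`. Yet `x + δ` cancels
  -- on every pair of opposite darts.
  let x : Γ.Dart → ZMod 2 := fun d => if d.snd ∈ S d.fst then 1 else 0
  let δ : Γ.Dart → ZMod 2 := fun d => if d = d₀ then 1 else 0
  have hsym : ∀ d, x d + δ d + (x d.symm + δ d.symm) = 0 := by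
    intro d
    have hd := h d
    have h2 : (1 : ZMod 2) + 1 = 0 := by decide
    have hx : x d.symm = if d.fst ∈ S d.snd then 1 else 0 := rfl
    by_cases h₁ : d = d₀
    · subst h₁
      have hδ : δ d.symm = 0 := if_neg d.symm_ne
      have hδ' : δ d = 1 := if_pos rfl
      rw [hδ, hδ', hx]
      simp only [x]
      have : ¬ (d.fst ∈ S d.snd ↔ d.snd ∈ S d.fst) := fun hc => (hd.1 hc) rfl
      by_cases a₁ : d.fst ∈ S d.snd <;> by_cases a₂ : d.snd ∈ S d.fst <;> simp [a₁, a₂, h2] <;>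
        tauto
    · have hδ' : δ d = 0 := if_neg h₁
      by_cases h₃ : d.symm = d₀
      · have hδ : δ d.symm = 1 := if_pos h₃
        rw [hδ, hδ', hx]
        simp only [x]
        have : ¬ (d.fst ∈ S d.snd ↔ d.snd ∈ S d.fst) := fun hc => (hd.1 hc) (by simp [← h₃])
        by_cases a₁ : d.fst ∈ S d.snd <;> by_cases a₂ : d.snd ∈ S d.fst <;>
          simp [a₁, a₂, h2] <;> tauto
      · have hδ : δ d.symm = 0 := if_neg h₃
        have hmem : d.edge ∉ ({d₀.edge} : Set (Sym2 V)) := by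
          rw [Set.mem_singleton_iff, SimpleGraph.dart_edge_eq_iff]
          rintro (h | h)
          · exact h₁ h
          · exact h₃ (by rw [h, d₀.symm_symm])
        have := hd.2 hmem
        rw [hδ, hδ', hx]
        simp only [x]
        by_cases a₁ : d.fst ∈ S d.snd <;> by_cases a₂ : d.snd ∈ S d.fst <;>
          simp [a₁, a₂, h2] <;> tauto
  have hsum : ∑ d, (x d + δ d) = 0 :=
    Finset.sum_involution (fun d _ => d.symm) (fun d _ => hsym d) (fun d _ _ => d.symm_ne)
      (fun d _ => Finset.mem_univ _) (fun d _ => d.symm_symm)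
  have hδ : ∑ d, δ d = 1 := by simp [δ]
  have hx : ∑ d, x d = 0 := by
    have h₁ : ∑ d, x d =
        ((Finset.univ.filter fun d : Γ.Dart => d.snd ∈ S d.fst).card : ZMod 2) := by
      simp [x]
    have h₂ : (Finset.univ.filter fun d : Γ.Dart => d.snd ∈ S d.fst).card =
        (Finset.univ.sigma S).card := by
      refine Finset.card_bij (fun d _ => ⟨d.fst, d.snd⟩) ?_ ?_ ?_
      · intro d hd
        simpa using hd
      · intro d _ d' _ hdd
        simp only [Sigma.mk.injEq, heq_eq_eq] at hdd
        exact dart_eq hdd.1 hdd.2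
      · rintro ⟨v, w⟩ hvw
        have hw : w ∈ S v := by simpa using hvw
        exact ⟨dartOf ((hS v).1 w hw), by simpa [dartOf] using hw, rfl⟩
    rw [h₁, h₂, Finset.card_sigma, Nat.cast_sum]
    exact Finset.sum_eq_zero fun v _ => (ZMod.natCast_eq_zero_iff_even).2 (hS v).2
  rw [Finset.sum_add_distrib, hx, hδ] at hsum
  exact absurd hsum (by decide)

/-- Let `M` be the image of the internal vertices of empty sets. Hexagons force `M` to consist of
internal vertices. No two members share a neighbour, and from each neighbour of a member an external
edge leads towards another member. In the twisted graph this makes `M` a choice of one even set per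
gadget whose disagreements are exactly the twists. -/
theorem cfi_not_iso [Finite V] (h : IsCubic Γ) (hc : Γ.Connected) {e : Sym2 V}
    (he : e ∈ Γ.edgeSet) : IsEmpty (CFI Γ ≃g twistedCFI Γ {e}) := by
  refine ⟨fun φ => ?_⟩
  have hempty : ∀ v, EvenNbrs Γ v ∅ := fun v => ⟨by simp, by simp⟩
  let M : Set (CFIVertex Γ) := Set.range fun v => φ (intV (hempty v))
  have hMint : ∀ m ∈ M, ∃ v S, ∃ hS : EvenNbrs Γ v S, m = intV hS := by
    rintro _ ⟨v, rfl⟩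
    rcases cfi_cases (φ (intV (hempty v))) with ⟨d, b, hd⟩ | hm
    · have := (onHexagons_int (T := ∅) h (hempty v)).map φ
      rw [hd] at this
      exact absurd this (not_onHexagons_ext h d b)
    · exact hm
  have hsep : ∀ m ∈ M, ∀ m' ∈ M, ∀ u, (twistedCFI Γ {e}).Adj m u → (twistedCFI Γ {e}).Adj m' u →
      m = m' := by
    rintro _ ⟨v, rfl⟩ _ ⟨v', rfl⟩ u hu hu'
    obtain ⟨u, rfl⟩ := φ.surjective u
    rw [φ.map_adj_iff] at hu hu'
    obtain ⟨d, b, rfl, rfl, -⟩ := exists_adj_int (hempty v) hu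
    obtain rfl := (adj_int_ext.1 hu').1
    rfl
  have hnext : ∀ m ∈ M, ∀ u, (twistedCFI Γ {e}).Adj m u → ∃ u', (twistedCFI Γ {e}).Adj u u' ∧
      ∃ m' ∈ M, (twistedCFI Γ {e}).Adj u' m' := by
    rintro _ ⟨v, rfl⟩ u hu
    obtain ⟨u, rfl⟩ := φ.surjective u
    rw [φ.map_adj_iff] at hu
    obtain ⟨d, b, rfl, rfl, hb⟩ := exists_adj_int (hempty v) hu
    refine ⟨φ (.ext d.symm b), φ.map_adj_iff.2 ⟨rfl, by simp⟩, _, ⟨d.snd, rfl⟩,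
      φ.map_adj_iff.2 (adj_ext_int.2 ⟨rfl, ?_⟩)⟩
    simpa using hb
  have hstep : ∀ (d : Γ.Dart) (S : Finset V) (hS : EvenNbrs Γ d.fst S), intV hS ∈ M →
      ∃ S', ∃ hS' : EvenNbrs Γ d.snd S', intV hS' ∈ M ∧
        ((d.fst ∈ S' ↔ d.snd ∈ S) ↔ d.edge ∉ ({e} : Set (Sym2 V))) := by
    intro d S hS hm
    obtain ⟨u', hu', m', hm', hum'⟩ := hnext _ hm _ (int_adj_ext (T := {e}) hS d.adj)
    obtain ⟨v', S', hS', rfl⟩ := hMint m' hm'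
    obtain ⟨d', b', rfl, hd', hb'⟩ := exists_adj_int hS' hum'.symm
    obtain ⟨rfl, hbb⟩ := adj_ext_ext.1 hu'
    have hv' : d.snd = v' := hd'
    subst hv'
    have hb'' : b' = true ↔ d.fst ∈ S' := hb'
    refine ⟨S', hS', hm', Iff.trans ?_ hbb⟩
    rw [← hb'', Bool.eq_iff_iff (b := decide _), decide_eq_true_iff]
  have hreach : ∀ v, ∃ S, ∃ hS : EvenNbrs Γ v S, intV hS ∈ M := by
    obtain ⟨v₀⟩ := hc.nonempty
    obtain ⟨v₁, S₁, hS₁, hm₁⟩ := hMint _ ⟨v₀, rfl⟩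
    have hM₁ : intV hS₁ ∈ M := hm₁ ▸ ⟨v₀, rfl⟩
    intro v
    obtain ⟨P⟩ := hc.preconnected v₁ v
    clear hm₁
    induction P generalizing S₁ with
    | nil => exact ⟨S₁, hS₁, hM₁⟩
    | cons hadj _ ih =>
      obtain ⟨S', hS', hm', -⟩ := hstep (dartOf hadj) S₁ hS₁ hM₁
      exact ih S' hS' hm'
  choose S hS hM using hreach
  refine no_odd_section hS he fun d => ?_
  obtain ⟨S', hS', hm', hag⟩ := hstep d (S d.fst) (hS d.fst) (hM d.fst)
  -- Internal vertices of one gadget always have a common neighbour, so `hsep` leaves at most one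
  -- member of `M` per gadget.
  obtain ⟨w, hw, hww⟩ := EvenNbrs.exists_agree h hS' (hS d.snd)
  have := hsep _ hm' _ (hM d.snd) _ (int_adj_ext_of_agree hS' hw hww) (int_adj_ext (hS d.snd) hw)
  rw [intV_inj] at this
  rw [← this.2]
  exact hag

end NotIso

/-! ### Recovering a graph from its Mekler group -/

section GroupToGraph

open scoped Classical

variable {p : ℕ} [Fact p.Prime]

/-- Isomorphic tuples are equivalent after any number of rounds, so round-invariant predicates are
isomorphism-invariant. Unused positions of the tuple are filled with `1`. -/
theorem wlInv_mulEquiv {G H : Type} [Group G] [Group H] {α : Type} [Fintype α] {k r : ℕ}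
    {P : ∀ (K : Type) [Group K], (α → K) → Prop} (hP : WLInv k r P)
    (hk : Fintype.card α ≤ k) (φ : G ≃* H) (v : α → G) : P G v ↔ P H (φ ∘ v) := by
  let σ : α → Fin k := fun a => Fin.castLE hk (Fintype.equivFin α a)
  have hσ : Function.Injective σ :=
    (Fin.castLE_injective hk).comp (Fintype.equivFin α).injective
  have := hP G H (Function.extend σ v 1) _ (WLEquiv.of_mulEquiv φ r _) σ
  rwa [Function.comp_assoc, Function.extend_comp hσ] at this

theorem adj_iff_of_single {W : Type} [Fintype W] {Γ : SimpleGraph W} {col : W → Fin 10}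
    (h : IsSparse Γ col) (hp : Odd p) {g g' : MeklerGroup p Γ} {w w' : W} {s s' : ZMod p}
    (hs : s ≠ 0) (hs' : s' ≠ 0) (hg : vec g = Pi.single w s) (hg' : vec g' = Pi.single w' s') :
    Γ.Adj w w' ↔ g * g' = g' * g ∧ ¬ SameCentralizer g g' := by
  rw [sameCentralizer_iff h hp hs hs' hg hg', comm_single_iff hp hs hg, hg']
  constructor
  · intro hadj
    refine ⟨fun v _ hv => ?_, hadj.ne⟩
    rw [Pi.single_eq_of_ne]
    rintro rfl; exact hv hadj
  · rintro ⟨H, hne⟩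
    by_contra hn
    exact hs' (by simpa using H w' hne hn)

/-- A sparse graph is determined by its Mekler group. -/
theorem graph_iso_of_mekler_iso {W W' : Type} [Fintype W] [Fintype W'] {Γ : SimpleGraph W}
    {Γ' : SimpleGraph W'} {col : W → Fin 10} {col' : W' → Fin 10} (h : IsSparse Γ col)
    (h' : IsSparse Γ' col') (hp : Odd p) (φ : MeklerGroup p Γ ≃* MeklerGroup p Γ') :
    Nonempty (Γ ≃g Γ') := by
  have key : ∀ {W W' : Type} [Fintype W] [Fintype W'] {Γ : SimpleGraph W} {Γ' : SimpleGraph W'}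
      {col : W → Fin 10} {col' : W' → Fin 10}, IsSparse Γ col → IsSparse Γ' col' →
      (MeklerGroup p Γ ≃* MeklerGroup p Γ') →
      ∃ f : W → W', Function.Injective f ∧ ∀ u v, Γ'.Adj (f u) (f v) ↔ Γ.Adj u v := by
    intro W W' _ _ Γ Γ' col col' h h' φ
    have hv : ∀ w, ∃ w' s, s ≠ 0 ∧ vec (φ (gen p Γ w)) = Pi.single w' s := by
      intro w
      rw [← isVertexLike_iff h' hp]
      exact (wlInv_mulEquiv (inv_isVertexLike (k := 20) (r := 0) le_rfl) (by simp) φ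
        ![gen p Γ w]).1 ((isVertexLike_iff h hp _).2 ⟨w, 1, one_ne_zero, vec_gen w⟩)
    choose f s hs hf using hv
    have hsame : ∀ u v, SameCentralizer (gen p Γ u) (gen p Γ v) ↔
        SameCentralizer (φ (gen p Γ u)) (φ (gen p Γ v)) := fun u v =>
      wlInv_mulEquiv (inv_sameCentralizer (k := 20) (r := 0) le_rfl) (by simp) φ
        ![gen p Γ u, gen p Γ v]
    refine ⟨f, fun u v huv => ?_, fun u v => ?_⟩
    · rw [← sameCentralizer_iff h hp one_ne_zero one_ne_zero (vec_gen u) (vec_gen v), hsame,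
        sameCentralizer_iff h' hp (hs u) (hs v) (hf u) (hf v)]
      exact huv
    · rw [adj_iff_of_single h hp one_ne_zero one_ne_zero (vec_gen u) (vec_gen v),
        adj_iff_of_single h' hp (hs u) (hs v) (hf u) (hf v), hsame, ← map_mul, ← map_mul,
        EmbeddingLike.apply_eq_iff_eq]
  -- The inverse isomorphism also gives an injection of vertices, so the orders agree and `f` is
  -- bijective.
  obtain ⟨f, hf, hadj⟩ := key h h' φ
  obtain ⟨f', hf', -⟩ := key h' h φ.symm
  have hcard : Fintype.card W = Fintype.card W' :=
    le_antisymm (Fintype.card_le_of_injective f hf) (Fintype.card_le_of_injective f' hf')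
  have hb : Function.Bijective f := (Fintype.bijective_iff_injective_and_card f).2 ⟨hf, hcard⟩
  exact ⟨⟨Equiv.ofBijective f hb, hadj _ _⟩⟩

end GroupToGraph

/-! ### First-order definable families of relations -/

section Definable

open FirstOrder FirstOrder.Language

variable {α β : Type} {R S : ∀ n : ℕ, (α → Fin (n + 2)) → Prop}

namespace FODefinable

theorem congr (h : FODefinable R) (hRS : ∀ n v, R n v ↔ S n v) : FODefinable S := by
  obtain ⟨φ, hφ⟩ := h
  exact ⟨φ, fun n v => (hRS n v).symm.trans (hφ n v)⟩

theorem not (h : FODefinable R) : FODefinable fun n v => ¬ R n v := by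
  obtain ⟨φ, hφ⟩ := h
  exact ⟨φ.not, fun n v => (not_congr (hφ n v)).trans Formula.realize_not.symm⟩

theorem and (hR : FODefinable R) (hS : FODefinable S) : FODefinable fun n v => R n v ∧ S n v := by
  obtain ⟨φ, hφ⟩ := hR
  obtain ⟨ψ, hψ⟩ := hS
  exact ⟨φ ⊓ ψ, fun n v => (and_congr (hφ n v) (hψ n v)).trans Formula.realize_inf.symm⟩

theorem or (hR : FODefinable R) (hS : FODefinable S) : FODefinable fun n v => R n v ∨ S n v :=
  (hR.not.and hS.not).not.congr fun n v => by tauto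

theorem imp (hR : FODefinable R) (hS : FODefinable S) : FODefinable fun n v => R n v → S n v :=
  (hR.and hS.not).not.congr fun n v => by tauto

theorem iff (hR : FODefinable R) (hS : FODefinable S) : FODefinable fun n v => (R n v ↔ S n v) :=
  ((hR.imp hS).and (hS.imp hR)).congr fun n v => by tauto

theorem false : FODefinable fun n (_ : α → Fin (n + 2)) => False :=
  ⟨⊥, fun n v => by simp [Formula.Realize]⟩

theorem true : FODefinable fun n (_ : α → Fin (n + 2)) => True :=
  false.not.congr fun n v => by simp

theorem const (P : Prop) : FODefinable fun n (_ : α → Fin (n + 2)) => P := by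
  by_cases h : P
  · exact true.congr fun n v => by simp [h]
  · exact false.congr fun n v => by simp [h]

theorem reindex (h : FODefinable R) (f : α → β) :
    FODefinable fun n (v : β → Fin (n + 2)) => R n (fun a => v (f a)) := by
  obtain ⟨φ, hφ⟩ := h
  exact ⟨φ.relabel f, fun n v => (hφ n _).trans Formula.realize_relabel.symm⟩

theorem ex {R : ∀ n : ℕ, Fin (n + 2) → (α → Fin (n + 2)) → Prop}
    (h : FODefinable (α := Option α) fun n v => R n (v none) (fun a => v (some a))) :
    FODefinable fun n v => ∃ x, R n x v := by
  obtain ⟨φ, hφ⟩ := h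
  refine ⟨(φ.relabel fun o => o.elim (Sum.inr ()) Sum.inl : arith.Formula (α ⊕ Unit)).iExs Unit,
    fun n v => ?_⟩
  rw [Formula.realize_iExs]
  simp only [Formula.realize_relabel, ← hφ]
  exact ⟨fun ⟨x, hx⟩ => ⟨fun _ => x, hx⟩, fun ⟨i, hi⟩ => ⟨i (), hi⟩⟩

theorem all {R : ∀ n : ℕ, Fin (n + 2) → (α → Fin (n + 2)) → Prop}
    (h : FODefinable (α := Option α) fun n v => R n (v none) (fun a => v (some a))) :
    FODefinable fun n v => ∀ x, R n x v :=
  (ex (R := fun n x v => ¬ R n x v) h.not).not.congr fun n v => by simp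

theorem exists_finite {ι : Type} [Finite ι] {R : ι → ∀ n : ℕ, (α → Fin (n + 2)) → Prop}
    (h : ∀ i, FODefinable (R i)) : FODefinable fun n v => ∃ i, R i n v := by
  have := Fintype.ofFinite ι
  suffices ∀ l : List ι, FODefinable fun n v => ∃ i ∈ l, R i n v from
    (this Finset.univ.toList).congr fun n v => by simp
  intro l
  induction l with
  | nil => exact false.congr fun n v => by simp
  | cons i l ih => exact ((h i).or ih).congr fun n v => by simp

theorem forall_finite {ι : Type} [Finite ι] {R : ι → ∀ n : ℕ, (α → Fin (n + 2)) → Prop}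
    (h : ∀ i, FODefinable (R i)) : FODefinable fun n v => ∀ i, R i n v :=
  (exists_finite (R := fun i n v => ¬ R i n v) fun i => (h i).not).not.congr fun n v => by simp

theorem eq (a b : α) : FODefinable fun _ v => v a = v b :=
  ⟨Term.equal (Term.var a) (Term.var b), fun n v => by simp [Formula.realize_equal]⟩

theorem lt (a b : α) : FODefinable fun _ v => (v a : ℕ) < v b :=
  ⟨Relations.formula (L := arith) (n := 2) ArithRel.lt ![Term.var a, Term.var b],
    fun _ _ => Iff.rfl⟩

theorem add (a b c : α) : FODefinable fun _ v => (v a : ℕ) + v b = v c :=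
  ⟨Relations.formula (L := arith) (n := 3) ArithRel.add ![Term.var a, Term.var b, Term.var c],
    fun _ _ => Iff.rfl⟩

theorem mul (a b c : α) : FODefinable fun _ v => (v a : ℕ) * v b = v c :=
  ⟨Relations.formula (L := arith) (n := 3) ArithRel.mul ![Term.var a, Term.var b, Term.var c],
    fun _ _ => Iff.rfl⟩

theorem bit (a b : α) : FODefinable fun _ v => Nat.testBit (v b : ℕ) (v a : ℕ) = Bool.true :=
  ⟨Relations.formula (L := arith) (n := 2) ArithRel.bit ![Term.var a, Term.var b],
    fun _ _ => Iff.rfl⟩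

end FODefinable

/-- A family of number-valued functions has a definable graph. The values may exceed the range of
the variables. -/
def FOTerm (f : ∀ n : ℕ, (α → Fin (n + 2)) → ℕ) : Prop :=
  FODefinable (α := Option α) fun n v => f n (fun a => v (some a)) = (v none : ℕ)

namespace FOTerm

variable {f g : ∀ n : ℕ, (α → Fin (n + 2)) → ℕ}

theorem var (a : α) : FOTerm fun _ v => (v a : ℕ) :=
  (FODefinable.eq (some a) none).congr fun _ _ => Fin.ext_iff

theorem reindex (h : FOTerm f) (e : α → β) :
    FOTerm fun n (v : β → Fin (n + 2)) => f n (fun a => v (e a)) :=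
  FODefinable.reindex h (Option.map e)

theorem eq_var (h : FOTerm f) (a : α) : FODefinable fun n v => f n v = (v a : ℕ) :=
  FODefinable.reindex h fun o => o.elim a id

theorem lt_var (h : FOTerm f) (a : α) : FODefinable fun n v => f n v < (v a : ℕ) := by
  have : FODefinable fun n (v : α → Fin (n + 2)) => ∃ x : Fin (n + 2), f n v = x ∧ (x : ℕ) < v a :=
    FODefinable.ex (FODefinable.and h (FODefinable.lt none (some a)))
  refine this.congr fun n v => ?_
  refine ⟨fun ⟨x, h₁, h₂⟩ => h₁ ▸ h₂, fun h => ?_⟩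
  exact ⟨⟨f n v, h.trans (v a).isLt⟩, rfl, h⟩

theorem var_le (h : FOTerm f) (a : α) : FODefinable fun n v => (v a : ℕ) ≤ f n v :=
  (h.lt_var a).not.congr fun _ _ => not_lt

/-- A bound on one side suffices: if the values agree, the common value is in the range of the
variables. -/
theorem eq_of_lt (hf : FOTerm f) (hg : FOTerm g) (hb : ∀ n v, g n v < n + 2) :
    FODefinable fun n v => f n v = g n v := by
  have : FODefinable fun n (v : α → Fin (n + 2)) => ∃ x : Fin (n + 2), f n v = x ∧ g n v = x :=
    FODefinable.ex (FODefinable.and hf hg)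
  refine this.congr fun n v => ?_
  refine ⟨fun ⟨x, h₁, h₂⟩ => h₁.trans h₂.symm, fun h => ?_⟩
  exact ⟨⟨g n v, hb n v⟩, h, rfl⟩

theorem var_lt (hg : FOTerm g) (hb : ∀ n v, g n v < n + 2) (a : α) :
    FODefinable fun n v => (v a : ℕ) < g n v := by
  have : FODefinable fun n (v : α → Fin (n + 2)) => ∃ x : Fin (n + 2), g n v = x ∧ (v a : ℕ) < x :=
    FODefinable.ex (FODefinable.and hg (FODefinable.lt (some a) none))
  refine this.congr fun n v => ?_
  refine ⟨fun ⟨x, h₁, h₂⟩ => h₁ ▸ h₂, fun h => ?_⟩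
  exact ⟨⟨g n v, hb n v⟩, rfl, h⟩

theorem zero : FOTerm fun n (_ : α → Fin (n + 2)) => 0 := by
  have : FODefinable (α := Option α) fun n v => ∀ x : Fin (n + 2), ¬ (x : ℕ) < v none :=
    FODefinable.all (FODefinable.lt none (some none)).not
  refine this.congr fun n v => ?_
  beta_reduce
  refine ⟨fun h => ?_, fun (h : 0 = (v none : ℕ)) x => by omega⟩
  have := h 0
  simp only [Fin.val_zero, not_lt, nonpos_iff_eq_zero] at this
  exact this.symm

theorem one : FOTerm fun n (_ : α → Fin (n + 2)) => 1 := by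
  have : FODefinable (α := Option α) fun n v => ∀ x : Fin (n + 2), (x : ℕ) < v none ↔ 0 = (x : ℕ) :=
    FODefinable.all ((FODefinable.lt none (some none)).iff zero)
  refine this.congr fun n v => ?_
  beta_reduce
  refine ⟨fun h => ?_, fun (h : 1 = (v none : ℕ)) x => by omega⟩
  have h0 := (h 0).2 rfl
  have h1 := h 1
  simp only [Fin.val_zero, Fin.val_one] at h0 h1
  omega

theorem add (hf : FOTerm f) (hg : FOTerm g) : FOTerm fun n v => f n v + g n v := by
  have : FODefinable (α := Option α) fun n v => ∃ x : Fin (n + 2), ∃ y : Fin (n + 2),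
      f n (fun a => v (some a)) = x ∧ g n (fun a => v (some a)) = y ∧ (x : ℕ) + y = v none := by
    apply FODefinable.ex
    apply FODefinable.ex
    exact (FODefinable.reindex hf fun o => o.elim (some none) fun a => some (some (some a))).and
      ((FODefinable.reindex hg fun o => o.elim none fun a => some (some (some a))).and
        (FODefinable.add (some none) none (some (some none))))
  refine this.congr fun n v => ?_
  beta_reduce
  refine ⟨fun ⟨x, y, h₁, h₂, h₃⟩ => by rw [h₁, h₂, h₃], fun h => ?_⟩
  have := (v none).isLt
  exact ⟨⟨f n _, by omega⟩, ⟨g n _, by omega⟩, rfl, rfl, h⟩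

theorem mul (hf : FOTerm f) (hg : FOTerm g) : FOTerm fun n v => f n v * g n v := by
  have h0 : FOTerm fun n (_ : α → Fin (n + 2)) => 0 := zero
  have hb : ∀ (n : ℕ) (_ : α → Fin (n + 2)), 0 < n + 2 := fun n _ => by omega
  -- A product in range has both factors in range unless one of them is `0`; in that case the other
  -- factor may be too large to be quantified.
  have : FODefinable (α := Option α) fun n v => (∃ x : Fin (n + 2), ∃ y : Fin (n + 2),
      f n (fun a => v (some a)) = x ∧ g n (fun a => v (some a)) = y ∧ (x : ℕ) * y = v none) ∨
      (0 = (v none : ℕ) ∧ (f n (fun a => v (some a)) = 0 ∨ g n (fun a => v (some a)) = 0)) := by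
    refine FODefinable.or ?_ (FODefinable.and h0 (FODefinable.or ?_ ?_))
    · apply FODefinable.ex
      apply FODefinable.ex
      exact (FODefinable.reindex hf fun o => o.elim (some none) fun a => some (some (some a))).and
        ((FODefinable.reindex hg fun o => o.elim none fun a => some (some (some a))).and
          (FODefinable.mul (some none) none (some (some none))))
    · exact (hf.eq_of_lt h0 hb).reindex some
    · exact (hg.eq_of_lt h0 hb).reindex some
  refine this.congr fun n v => ?_
  beta_reduce
  refine ⟨?_, fun h => ?_⟩
  · rintro (⟨x, y, h₁, h₂, h₃⟩ | ⟨h₁, h₂ | h₂⟩)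
    · rw [h₁, h₂, h₃]
    · rw [h₂, ← h₁, zero_mul]
    · rw [h₂, ← h₁, mul_zero]
  · have hlt := (v none).isLt
    by_cases hf0 : f n (fun a => v (some a)) = 0
    · exact Or.inr ⟨by rw [← h, hf0, zero_mul], Or.inl hf0⟩
    by_cases hg0 : g n (fun a => v (some a)) = 0
    · exact Or.inr ⟨by rw [← h, hg0, mul_zero], Or.inr hg0⟩
    have h₁ := Nat.le_mul_of_pos_right (f n (fun a => v (some a))) (Nat.pos_of_ne_zero hg0)
    have h₂ := Nat.le_mul_of_pos_left (g n (fun a => v (some a))) (Nat.pos_of_ne_zero hf0)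
    exact Or.inl ⟨⟨f n _, by omega⟩, ⟨g n _, by omega⟩, rfl, rfl, h⟩

theorem const (c : ℕ) : FOTerm fun n (_ : α → Fin (n + 2)) => c := by
  induction c with
  | zero => exact zero
  | succ c ih => exact ih.add one

/-- The input length `n` is the penultimate number: exactly one number lies above it. -/
theorem length : FOTerm fun n (_ : α → Fin (n + 2)) => n := by
  have : FODefinable (α := Option α) fun n v => ∃ x : Fin (n + 2), (v none : ℕ) < x ∧
      ∀ y : Fin (n + 2), (v none : ℕ) < y → y = x := by
    apply FODefinable.ex
    refine (FODefinable.lt (some none) none).and ?_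
    apply FODefinable.all
    exact (FODefinable.lt (some (some none)) none).imp (FODefinable.eq none (some none))
  refine this.congr fun n v => ?_
  beta_reduce
  refine ⟨fun ⟨x, h₁, h₂⟩ => ?_, fun h => ?_⟩
  · have h₃ := h₂ ⟨n + 1, by omega⟩ (by have := x.isLt; simp only; omega)
    by_contra hne
    have hlt := (v none).isLt
    have hx : (x : ℕ) = n + 1 := by rw [← h₃]
    have h₄ := h₂ ⟨n, by omega⟩ (by simp only; omega)
    rw [← h₄] at hx
    simp at hx
  · refine ⟨⟨n + 1, by omega⟩, by simp only; omega, fun y hy => Fin.ext ?_⟩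
    have := y.isLt
    simp only; omega

/-- The logarithm is the position of the highest bit; `0` has none and is treated by convention. -/
theorem log_var (a : α) : FOTerm fun _ v => Nat.log 2 (v a) := by
  have : FODefinable (α := Option α) fun n v =>
      (Nat.testBit (v (some a) : ℕ) (v none : ℕ) = Bool.true ∧
        ∀ x : Fin (n + 2), (v none : ℕ) < x → ¬ Nat.testBit (v (some a) : ℕ) (x : ℕ) = Bool.true) ∨
      (0 = (v (some a) : ℕ) ∧ 0 = (v none : ℕ)) := by
    refine FODefinable.or (FODefinable.and (FODefinable.bit _ _) ?_)
      (FODefinable.and (zero.eq_var (some a)) (zero.eq_var none))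
    apply FODefinable.all
    exact (FODefinable.lt (some none) none).imp (FODefinable.bit none (some (some a))).not
  refine this.congr fun n v => ?_
  beta_reduce
  set x : ℕ := (v (some a) : ℕ) with hx
  by_cases h0 : x = 0
  · simp only [h0, Nat.zero_testBit, Nat.log_zero_right]
    simp
  have hbit : Nat.testBit x (Nat.log 2 x) = Bool.true :=
    Nat.testBit_of_two_pow_le_and_two_pow_add_one_gt (Nat.pow_log_le_self 2 h0)
      (Nat.lt_pow_succ_log_self one_lt_two x)
  have hbig : ∀ i, Nat.log 2 x < i → Nat.testBit x i = Bool.false := fun i hi =>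
    Nat.testBit_lt_two_pow ((Nat.lt_pow_succ_log_self one_lt_two x).trans_le
      (Nat.pow_le_pow_right two_pos hi))
  constructor
  · rintro (⟨h₁, h₂⟩ | ⟨h₁, -⟩)
    · apply le_antisymm
      · by_contra hlt
        have := (v (some a)).isLt
        have hlog : Nat.log 2 x ≤ x := Nat.log_le_self 2 x
        exact h₂ ⟨Nat.log 2 x, by omega⟩ (by simp only; omega) hbit
      · by_contra hlt
        have := hbig _ (not_le.1 hlt)
        rw [h₁] at this
        exact Bool.noConfusion this
    · exact absurd h₁.symm h0
  · intro h
    left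
    rw [← h]
    exact ⟨hbit, fun y hy => by rw [hbig _ hy]; simp⟩

theorem log (hf : FOTerm f) (hb : ∀ n v, f n v < n + 2) : FOTerm fun n v => Nat.log 2 (f n v) := by
  have : FODefinable (α := Option α) fun n v => ∃ x : Fin (n + 2),
      f n (fun a => v (some a)) = x ∧ Nat.log 2 x = v none := by
    apply FODefinable.ex
    exact (FODefinable.reindex hf fun o => o.elim none fun a => some (some a)).and
      ((log_var none).eq_var (some none))
  refine this.congr fun n v => ?_
  beta_reduce
  refine ⟨fun ⟨x, h₁, h₂⟩ => by rw [h₁, h₂], fun h => ?_⟩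
  exact ⟨⟨f n _, hb n _⟩, rfl, h⟩

theorem loglog : FOTerm fun n (_ : α → Fin (n + 2)) => loglog n := by
  refine log (log length fun n _ => by omega) fun n _ => ?_
  have := Nat.log_le_self 2 n
  omega

/-- For `x ≥ 2` the rounded-up logarithm is `log (x - 1) + 1`. -/
theorem clog_var (a : α) : FOTerm fun _ v => Nat.clog 2 (v a) := by
  have hb : ∀ (n : ℕ) (_ : Option (Option α) → Fin (n + 2)), 1 < n + 2 := fun n _ => by omega
  have : FODefinable (α := Option α) fun n v =>
      ((v (some a) : ℕ) ≤ 1 ∧ 0 = (v none : ℕ)) ∨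
      ∃ m : Fin (n + 2), (m : ℕ) + 1 = v (some a) ∧ 0 < (m : ℕ) ∧ Nat.log 2 m + 1 = v none := by
    refine FODefinable.or (FODefinable.and (one.var_le _) (zero.eq_var _)) ?_
    apply FODefinable.ex
    exact (((var none).add one).eq_var (some (some a))).and
      ((zero.lt_var none).and (((log_var none).add one).eq_var (some none)))
  refine this.congr fun n v => ?_
  beta_reduce
  set x : ℕ := (v (some a) : ℕ) with hx
  have hlt : x < n + 2 := (v (some a)).isLt
  by_cases h1 : x ≤ 1
  · rw [Nat.clog_of_right_le_one h1]
    constructor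
    · rintro (⟨-, h⟩ | ⟨m, h₁, h₂, -⟩)
      · exact h
      · omega
    · exact fun h => Or.inl ⟨h1, h⟩
  · have hclog : Nat.clog 2 x = Nat.log 2 (x - 1) + 1 := by
      have h2 : x - 1 ≠ 0 := by omega
      apply le_antisymm
      · apply Nat.clog_le_of_le_pow
        have := Nat.lt_pow_succ_log_self one_lt_two (x - 1)
        rw [Nat.succ_eq_add_one] at this
        omega
      · rw [Nat.add_one_le_iff, Nat.lt_clog_iff_pow_lt one_lt_two]
        have := Nat.pow_log_le_self 2 h2
        omega
    rw [hclog]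
    constructor
    · rintro (⟨h, -⟩ | ⟨m, h₁, h₂, h₃⟩)
      · omega
      · rw [← h₃, ← h₁, Nat.add_sub_cancel]
    · exact fun h => Or.inr ⟨⟨x - 1, by omega⟩, by simp only; omega, by simp only; omega, h⟩

theorem clog (hf : FOTerm f) (hb : ∀ n v, f n v < n + 2) :
    FOTerm fun n v => Nat.clog 2 (f n v) := by
  have : FODefinable (α := Option α) fun n v => ∃ x : Fin (n + 2),
      f n (fun a => v (some a)) = x ∧ Nat.clog 2 x = v none := by
    apply FODefinable.ex
    exact (FODefinable.reindex hf fun o => o.elim none fun a => some (some a)).and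
      ((clog_var none).eq_var (some none))
  refine this.congr fun n v => ?_
  beta_reduce
  refine ⟨fun ⟨x, h₁, h₂⟩ => by rw [h₁, h₂], fun h => ?_⟩
  exact ⟨⟨f n _, hb n _⟩, rfl, h⟩

end FOTerm

end Definable

/-! ### Circuits that iterate a formula -/

theorem Circuit.eval_iff {n k : ℕ} (C : Circuit n k) (x : Fin n → Bool) (g : Gate n k) :
    C.eval x g ↔ match C.kind g with
      | .input i => x i = true
      | .and => ∀ h, C.wire h g → C.eval x h
      | .or => ∃ h, C.wire h g ∧ C.eval x h
      | .not => ∀ h, C.wire h g → ¬ C.eval x h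
      | .maj => Nat.card {h // C.wire h g} < 2 * Nat.card {h // C.wire h g ∧ C.eval x h} := by
  unfold Circuit.eval
  rw [WellFounded.fix_eq]
  cases C.kind g <;> simp only [exists_prop]

/-- First-order formulas in the variables `ι` over the definable relations, the input bits and a
relation symbol `prev`, which stands for the relation of the preceding stage of an iteration. The
definable relations may refer to the number of the stage. -/
inductive IterFormula (ι : Type) : Type
  | rel (R : ∀ n : ℕ, ℕ → (ι → Fin (n + 2)) → Prop)
      (h : FODefinable (α := Option ι) fun n v => R n (v none) fun a => v (some a)) : IterFormula ι
  | bit (a : ι) : IterFormula ι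
  | not (φ : IterFormula ι) : IterFormula ι
  | and (φ ψ : IterFormula ι) : IterFormula ι
  | ex (a : ι) (φ : IterFormula ι) : IterFormula ι
  | prev (σ : ι → ι) : IterFormula ι

namespace IterFormula

variable {ι : Type}

/-- Truth of a formula at the stage `t`, where `E` is the relation of the preceding stage. -/
def Holds (n : ℕ) (x : Fin n → Bool) (E : (ι → Fin (n + 2)) → Prop) (t : ℕ) :
    IterFormula ι → (ι → Fin (n + 2)) → Prop
  | rel R _, v => R n t v
  | bit a, v => ∃ h : (v a : ℕ) < n, x ⟨v a, h⟩ = true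
  | not φ, v => ¬ φ.Holds n x E t v
  | and φ ψ, v => φ.Holds n x E t v ∧ ψ.Holds n x E t v
  | ex a φ, v => ∃ u, (∀ b, b ≠ a → u b = v b) ∧ φ.Holds n x E t u
  | prev σ, v => E fun a => v (σ a)

/-- The relation defined by the stage `t` of the iteration of a formula. -/
def Stage (φ : IterFormula ι) (n : ℕ) (x : Fin n → Bool) : ℕ → (ι → Fin (n + 2)) → Prop
  | 0 => φ.Holds n x (fun _ => False) 0
  | t + 1 => φ.Holds n x (φ.Stage n x t) (t + 1)

/-- The size of a formula. -/
def size : IterFormula ι → ℕ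
  | rel _ _ => 0
  | bit _ => 0
  | not φ => φ.size + 1
  | and φ ψ => φ.size + ψ.size + 1
  | ex _ φ => φ.size + 1
  | prev _ => 0

/-- Immediate subformulas. -/
def IsChild (χ : IterFormula ι) : IterFormula ι → Prop
  | rel _ _ => False
  | bit _ => False
  | not φ => χ = φ
  | and φ ψ => χ = φ ∨ χ = ψ
  | ex _ φ => χ = φ
  | prev _ => False

theorem IsChild.size_lt {χ ψ : IterFormula ι} (h : IsChild χ ψ) : χ.size < ψ.size := by
  cases ψ with
  | rel R hR => exact h.elim
  | bit a => exact h.elim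
  | not φ => subst h; exact Nat.lt_succ_self _
  | and φ ψ =>
    change _ < φ.size + ψ.size + 1
    rcases h with rfl | rfl <;> omega
  | ex a φ => subst h; exact Nat.lt_succ_self _
  | prev σ => exact h.elim

/-- Gates will be tagged by formulas, so a finite set containing all subformulas is needed; the size
bound controls the depth. -/
theorem exists_closed (φ : IterFormula ι) : ∃ S : Set (IterFormula ι), S.Finite ∧ φ ∈ S ∧
    (∀ ψ ∈ S, ψ.size ≤ φ.size) ∧ ∀ ψ ∈ S, ∀ χ, IsChild χ ψ → χ ∈ S := by
  induction φ with
  | rel R hR =>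
    refine ⟨{rel R hR}, Set.finite_singleton _, rfl, ?_, ?_⟩
    · rintro ψ rfl; exact le_rfl
    · rintro ψ rfl χ h; exact h.elim
  | bit a =>
    refine ⟨{bit a}, Set.finite_singleton _, rfl, ?_, ?_⟩
    · rintro ψ rfl; exact le_rfl
    · rintro ψ rfl χ h; exact h.elim
  | prev σ =>
    refine ⟨{prev σ}, Set.finite_singleton _, rfl, ?_, ?_⟩
    · rintro ψ rfl; exact le_rfl
    · rintro ψ rfl χ h; exact h.elim
  | not φ ih =>
    obtain ⟨S, hS, hφ, hsize, hcl⟩ := ih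
    refine ⟨insert (not φ) S, hS.insert _, Set.mem_insert _ _, ?_, ?_⟩
    · rintro ψ (rfl | h)
      · exact le_rfl
      · exact (hsize ψ h).trans (Nat.le_succ _)
    · rintro ψ (rfl | h) χ hχ
      · obtain rfl : χ = φ := hχ
        exact Or.inr hφ
      · exact Or.inr (hcl ψ h χ hχ)
  | ex a φ ih =>
    obtain ⟨S, hS, hφ, hsize, hcl⟩ := ih
    refine ⟨insert (ex a φ) S, hS.insert _, Set.mem_insert _ _, ?_, ?_⟩
    · rintro ψ (rfl | h)
      · exact le_rfl
      · exact (hsize ψ h).trans (Nat.le_succ _)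
    · rintro ψ (rfl | h) χ hχ
      · obtain rfl : χ = φ := hχ
        exact Or.inr hφ
      · exact Or.inr (hcl ψ h χ hχ)
  | and φ₁ φ₂ ih₁ ih₂ =>
    obtain ⟨S₁, hS₁, hφ₁, hsize₁, hcl₁⟩ := ih₁
    obtain ⟨S₂, hS₂, hφ₂, hsize₂, hcl₂⟩ := ih₂
    refine ⟨insert (and φ₁ φ₂) (S₁ ∪ S₂), (hS₁.union hS₂).insert _, Set.mem_insert _ _, ?_, ?_⟩
    · rintro ψ (rfl | h | h)
      · exact le_rfl
      · have := hsize₁ ψ h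
        simp only [size]; omega
      · have := hsize₂ ψ h
        simp only [size]; omega
    · rintro ψ (rfl | h | h) χ hχ
      · rcases hχ with rfl | rfl
        · exact Or.inr (Or.inl hφ₁)
        · exact Or.inr (Or.inr hφ₂)
      · exact Or.inr (Or.inl (hcl₁ ψ h χ hχ))
      · exact Or.inr (Or.inr (hcl₂ ψ h χ hχ))

/-- The type of the gate that evaluates a formula. -/
noncomputable def gateKind (n t : ℕ) (v : ι → Fin (n + 2)) : IterFormula ι → GateKind n :=
  open Classical in fun
  -- Gates without inputs serve as constants: an empty conjunction is true and an empty disjunction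
  -- is false.
  | rel R _ => if R n t v then .and else .or
  | bit a => if h : (v a : ℕ) < n then .input ⟨v a, h⟩ else .or
  | not _ => .not
  | and _ _ => .and
  | ex _ _ => .or
  | prev _ => .or

/-- The gate for `χ` at the stage `s` and the assignment `u` is an input of the gate for `ψ`
at the stage `t` and the assignment `v`, when `φ` is iterated `T` times. -/
def WireRel (φ : IterFormula ι) (T : ℕ) {A : Type} (χ : IterFormula ι) (s : ℕ) (u : ι → A)
    (t : ℕ) (v : ι → A) : IterFormula ι → Prop
  | rel _ _ => False
  | bit _ => False
  | not ψ => χ = ψ ∧ s = t ∧ ∀ a, u a = v a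
  | and ψ₁ ψ₂ => (χ = ψ₁ ∨ χ = ψ₂) ∧ s = t ∧ ∀ a, u a = v a
  | ex a ψ => χ = ψ ∧ s = t ∧ ∀ b, b ≠ a → u b = v b
  -- The condition `t ≤ T` cuts off wires at unused stage numbers, which would otherwise create
  -- paths of linear length.
  | prev σ => χ = φ ∧ s + 1 = t ∧ t ≤ T ∧ ∀ a, u a = v (σ a)

/-! #### The circuit -/

section Circuit

variable (S : Set (IterFormula ι))

/-- Coordinates of the gates: a tag, which is a formula coded in unary, the number of the stage, and
an assignment of the variables. -/
abbrev Coord : Type := S ⊕ Option ι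

variable {S}

/-- The tag of a gate is the formula `ψ`. -/
def HasTag {n : ℕ} (ψ : S) (w : Coord S → Fin (n + 2)) : Prop :=
  ∀ χ : S, χ = ψ ∧ (w (.inl χ) : ℕ) = 1 ∨ χ ≠ ψ ∧ (w (.inl χ) : ℕ) = 0

theorem HasTag.unique {n : ℕ} {ψ χ : S} {w : Coord S → Fin (n + 2)} (h : HasTag ψ w)
    (h' : HasTag χ w) : ψ = χ := by
  by_contra hne
  rcases h ψ with h₁ | h₁ <;> rcases h' ψ with h₂ | h₂
  · exact hne h₂.1
  · omega
  · exact h₁.1 rfl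
  · exact h₁.1 rfl

theorem definable_hasTag [Finite S] (ψ : S) :
    FODefinable fun n (w : Coord S → Fin (n + 2)) => HasTag ψ w := by
  refine FODefinable.forall_finite fun χ => ?_
  exact ((FODefinable.const _).and ((FOTerm.one.eq_var _).congr fun _ _ => eq_comm)).or
    ((FODefinable.const _).and ((FOTerm.zero.eq_var _).congr fun _ _ => eq_comm))

/-- The gate with the tag `ψ`, the stage `t` and the assignment `v`. -/
noncomputable def encode {n : ℕ} (ψ : S) (t : Fin (n + 2)) (v : ι → Fin (n + 2)) :
    Coord S → Fin (n + 2) :=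
  open Classical in
  Sum.elim (fun χ => if χ = ψ then 1 else 0) fun o => o.elim t v

theorem hasTag_encode {n : ℕ} (ψ : S) (t : Fin (n + 2)) (v : ι → Fin (n + 2)) :
    HasTag ψ (encode ψ t v) := by
  intro χ
  by_cases h : χ = ψ
  · exact Or.inl ⟨h, by simp [encode, h]⟩
  · exact Or.inr ⟨h, by simp [encode, h]⟩

theorem HasTag.eq_encode {n : ℕ} {ψ : S} {w : Coord S → Fin (n + 2)} (h : HasTag ψ w) :
    w = encode ψ (w (.inr none)) fun a => w (.inr (some a)) := by
  funext c
  rcases c with χ | _ | a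
  · rcases h χ with ⟨h₁, h₂⟩ | ⟨h₁, h₂⟩
    · apply Fin.ext; rw [h₂]; simp [encode, h₁]
    · apply Fin.ext; simp [encode, h₁, h₂]
  · rfl
  · rfl

/-- Types of the gates. -/
noncomputable def kindOf {n : ℕ} (w : Coord S → Fin (n + 2)) : GateKind n :=
  open Classical in
  if h : ∃ ψ : S, HasTag ψ w then
    gateKind n (w (.inr none)) (fun a => w (.inr (some a))) (h.choose : IterFormula ι)
  else .or

theorem kindOf_of_hasTag {n : ℕ} {ψ : S} {w : Coord S → Fin (n + 2)} (h : HasTag ψ w) :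
    kindOf w = gateKind n (w (.inr none)) (fun a => w (.inr (some a))) (ψ : IterFormula ι) := by
  have h' : ∃ ψ : S, HasTag ψ w := ⟨ψ, h⟩
  rw [kindOf, dif_pos h', h'.choose_spec.unique h]

theorem kindOf_eq_iff {n : ℕ} (w : Coord S → Fin (n + 2)) (K : GateKind n) :
    kindOf w = K ↔ (∃ ψ : S, HasTag ψ w ∧
      gateKind n (w (.inr none)) (fun a => w (.inr (some a))) (ψ : IterFormula ι) = K) ∨
      (¬ ∃ ψ : S, HasTag ψ w) ∧ GateKind.or = K := by
  by_cases h : ∃ ψ : S, HasTag ψ w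
  · obtain ⟨ψ, hψ⟩ := h
    rw [kindOf_of_hasTag hψ]
    constructor
    · exact fun h => Or.inl ⟨ψ, hψ, h⟩
    · rintro (⟨χ, hχ, h⟩ | ⟨h, -⟩)
      · rwa [hψ.unique hχ]
      · exact (h ⟨ψ, hψ⟩).elim
  · rw [kindOf, dif_neg h]
    constructor
    · exact fun h' => Or.inr ⟨h, h'⟩
    · rintro (⟨χ, hχ, -⟩ | ⟨-, h⟩)
      · exact (h ⟨χ, hχ⟩).elim
      · exact h

/-- Wires of the circuit that iterates `φ`. -/
def IsWire (φ : IterFormula ι) (T : ℕ) {n : ℕ} (w' w : Coord S → Fin (n + 2)) : Prop :=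
  ∃ χ ψ : S, HasTag χ w' ∧ HasTag ψ w ∧
    WireRel φ T (χ : IterFormula ι) (w' (.inr none)) (fun a => w' (.inr (some a)))
      (w (.inr none)) (fun a => w (.inr (some a))) (ψ : IterFormula ι)

theorem isWire_encode {φ : IterFormula ι} {T n : ℕ} {w : Coord S → Fin (n + 2)} {ψ : S}
    {t : Fin (n + 2)} {v : ι → Fin (n + 2)} :
    IsWire φ T w (encode ψ t v) ↔ ∃ (χ : S) (s : Fin (n + 2)) (u : ι → Fin (n + 2)),
      w = encode χ s u ∧ WireRel φ T (χ : IterFormula ι) s u t v (ψ : IterFormula ι) := by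
  constructor
  · rintro ⟨χ, ψ', hχ, hψ', h⟩
    obtain rfl := (hasTag_encode ψ t v).unique hψ'
    exact ⟨χ, _, _, hχ.eq_encode, h⟩
  · rintro ⟨χ, s, u, rfl, h⟩
    exact ⟨χ, ψ, hasTag_encode _ _ _, hasTag_encode _ _ _, h⟩

/-- The level of a gate in the circuit that iterates a formula of size `m`. -/
noncomputable def level (m T : ℕ) {n : ℕ} (w : Coord S → Fin (n + 2)) : ℕ :=
  open Classical in
  if h : ∃ ψ : S, HasTag ψ w then
    -- Beyond stage `T` no wire changes the stage, so formula size alone orders those gates.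
    (if (w (.inr none) : ℕ) ≤ T then (w (.inr none) : ℕ) * (m + 1) else 0) +
      (h.choose : IterFormula ι).size
  else 0

theorem level_of_hasTag (m T : ℕ) {n : ℕ} {ψ : S} {w : Coord S → Fin (n + 2)} (h : HasTag ψ w) :
    level m T w = (if (w (.inr none) : ℕ) ≤ T then (w (.inr none) : ℕ) * (m + 1) else 0) +
      (ψ : IterFormula ι).size := by
  have h' : ∃ ψ : S, HasTag ψ w := ⟨ψ, h⟩
  rw [level, dif_pos h', h'.choose_spec.unique h]

theorem level_le {m T n : ℕ} (hS : ∀ ψ ∈ S, ψ.size ≤ m) (w : Coord S → Fin (n + 2)) :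
    level m T w ≤ T * (m + 1) + m := by
  by_cases h : ∃ ψ : S, HasTag ψ w
  · obtain ⟨ψ, hψ⟩ := h
    rw [level_of_hasTag m T hψ]
    refine add_le_add ?_ (hS ψ ψ.2)
    split_ifs with h
    · exact Nat.mul_le_mul_right _ h
    · exact Nat.zero_le _
  · rw [level, dif_neg h]
    exact Nat.zero_le _

/-- Within a stage the formula size drops. Between stages, `s * (m + 1) + m` is below `(s + 1) * (m
+ 1)`, where `m` is the size of `φ`. -/
theorem IsWire.level_lt {φ : IterFormula ι} {T n : ℕ} {w' w : Coord S → Fin (n + 2)}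
    (h : IsWire φ T w' w) : level φ.size T w' < level φ.size T w := by
  obtain ⟨χ, ⟨ψ, hψS⟩, hχ, hψ, h⟩ := h
  rw [level_of_hasTag _ _ hχ, level_of_hasTag _ _ hψ]
  have key (hc : IsChild (χ : IterFormula ι) ψ) (he : (w' (.inr none) : ℕ) = w (.inr none)) :
      (if (w' (.inr none) : ℕ) ≤ T then (w' (.inr none) : ℕ) * (φ.size + 1) else 0) +
        (χ : IterFormula ι).size <
      (if (w (.inr none) : ℕ) ≤ T then (w (.inr none) : ℕ) * (φ.size + 1) else 0) + ψ.size := by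
    rw [he]
    exact Nat.add_lt_add_left hc.size_lt _
  cases ψ with
  | rel R hR => exact h.elim
  | bit a => exact h.elim
  | not ψ => exact key h.1 h.2.1
  | and ψ₁ ψ₂ => exact key h.1 h.2.1
  | ex a ψ => exact key h.1 h.2.1
  | prev σ =>
    obtain ⟨h₁, h₂, h₃, -⟩ := h
    rw [if_pos h₃, if_pos (by omega), h₁, ← h₂, add_mul (w' (.inr none) : ℕ)]
    omega

variable (S) in
/-- The gates are indexed by numbers. -/
noncomputable def coordEquiv [Finite S] [Finite ι] : Coord S ≃ Fin (Nat.card (Coord S)) :=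
  Finite.equivFin _

variable (S) in
/-- The circuit that iterates `φ`. -/
noncomputable def circuit [Finite S] [Finite ι] (hcl : ∀ ψ ∈ S, ∀ χ, IsChild χ ψ → χ ∈ S)
    (φ : IterFormula ι) (T n : ℕ) : Circuit n (Nat.card (Coord S)) where
  kind g := kindOf (S := S) fun c => g (coordEquiv S c)
  wire h g := IsWire (S := S) φ T (fun c => h (coordEquiv S c)) fun c => g (coordEquiv S c)
  acyclic := Subrelation.wf
    (r := InvImage (· < ·) fun g : Gate n _ => level (S := S) φ.size T fun c => g (coordEquiv S c))
    (fun h => h.level_lt) (InvImage.wf _ wellFounded_lt)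
  not_fanin g hg := by
    obtain ⟨w, rfl⟩ := (Equiv.arrowCongr (coordEquiv S) (Equiv.refl _)).surjective g
    simp only [Equiv.arrowCongr_apply, Equiv.coe_refl, Function.comp_def, id,
      Equiv.symm_apply_apply] at hg ⊢
    rw [kindOf_eq_iff] at hg
    obtain ⟨⟨ψ, hψS⟩, hψ, h⟩ | ⟨-, h⟩ := hg
    swap
    · cases h
    cases ψ with
    | rel R hR => simp only [gateKind] at h; split_ifs at h
    | bit a => simp only [gateKind] at h; split_ifs at h
    | and ψ₁ ψ₂ => cases h
    | ex a ψ => cases h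
    | prev σ => cases h
    | not ψ =>
      have hS : ψ ∈ S := hcl _ hψS ψ rfl
      rw [hψ.eq_encode]
      simp only [isWire_encode]
      refine ⟨fun c => encode ⟨ψ, hS⟩ (w (.inr none)) (fun a => w (.inr (some a)))
        ((coordEquiv S).symm c), ⟨⟨ψ, hS⟩, _, _, by simp only [Equiv.symm_apply_apply], rfl, rfl,
          fun _ => rfl⟩, ?_⟩
      rintro g' ⟨χ, s, u, h₁, h₂, h₃, h₄⟩
      obtain rfl : χ = ⟨ψ, hS⟩ := Subtype.ext h₂
      obtain rfl := Fin.ext h₃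
      obtain rfl := funext h₄
      funext c
      have := congrFun h₁ ((coordEquiv S).symm c)
      simpa only [Equiv.apply_symm_apply] using this

/-- A gate of the circuit that iterates a formula. -/
noncomputable def gate [Finite S] [Finite ι] {n : ℕ} (ψ : S) (t : Fin (n + 2))
    (v : ι → Fin (n + 2)) : Gate n (Nat.card (Coord S)) :=
  fun c => encode ψ t v ((coordEquiv S).symm c)

variable [Finite S] [Finite ι] {hcl : ∀ ψ ∈ S, ∀ χ, IsChild χ ψ → χ ∈ S}
  {φ : IterFormula ι} {T n : ℕ}

theorem circuit_kind_gate (ψ : S) (t : Fin (n + 2)) (v : ι → Fin (n + 2)) :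
    (circuit S hcl φ T n).kind (gate ψ t v) = gateKind n t v (ψ : IterFormula ι) := by
  simp only [circuit, gate, Equiv.symm_apply_apply]
  exact kindOf_of_hasTag (hasTag_encode ψ t v)

theorem circuit_wire_gate {g : Gate n (Nat.card (Coord S))} {ψ : S} {t : Fin (n + 2)}
    {v : ι → Fin (n + 2)} :
    (circuit S hcl φ T n).wire g (gate ψ t v) ↔
      ∃ (χ : S) (s : Fin (n + 2)) (u : ι → Fin (n + 2)),
        g = gate χ s u ∧ WireRel φ T (χ : IterFormula ι) s u t v (ψ : IterFormula ι) := by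
  simp only [circuit, gate, Equiv.symm_apply_apply]
  change _ ↔ ∃ χ s u, g = (fun c => encode χ s u ((coordEquiv S).symm c)) ∧ _
  refine isWire_encode.trans (exists_congr fun χ => exists_congr fun s => exists_congr fun u =>
    and_congr_left fun _ => ⟨fun h => ?_, fun h => ?_⟩)
  · funext c
    have := congrFun h ((coordEquiv S).symm c)
    simpa only [Equiv.apply_symm_apply] using this
  · subst h
    simp only [Equiv.symm_apply_apply]

/-- This is the correctness of a single block, given that `E` is what the gates for `φ` at the
preceding stage compute. At stage `0` there is no such gate, so `E` is empty. -/
theorem circuit_eval_gate_of_prev (x : Fin n → Bool) {φ : S} {t : Fin (n + 2)}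
    {E : (ι → Fin (n + 2)) → Prop}
    (hE : ∀ v, E v ↔ ∃ s : Fin (n + 2), (s : ℕ) + 1 = t ∧ (t : ℕ) ≤ T ∧
      (circuit S hcl φ T n).eval x (gate φ s v))
    (ψ : IterFormula ι) (hψ : ψ ∈ S) (v : ι → Fin (n + 2)) :
    (circuit S hcl φ T n).eval x (gate ⟨ψ, hψ⟩ t v) ↔ ψ.Holds n x E t v := by
  induction ψ generalizing v with
  | rel R hR =>
    rw [Circuit.eval_iff, circuit_kind_gate]
    simp only [gateKind, circuit_wire_gate, WireRel, Holds]
    by_cases h : R n t v <;> simp [h]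
  | bit a =>
    rw [Circuit.eval_iff, circuit_kind_gate]
    simp only [gateKind, circuit_wire_gate, WireRel, Holds]
    by_cases h : (v a : ℕ) < n <;> simp [h]
  | not ψ ih =>
    rw [Circuit.eval_iff, circuit_kind_gate]
    simp only [gateKind, circuit_wire_gate, WireRel, Holds]
    rw [← ih (hcl _ hψ ψ rfl)]
    constructor
    · exact fun h => h _ ⟨⟨ψ, _⟩, t, v, rfl, rfl, rfl, fun _ => rfl⟩
    · rintro h g ⟨χ, s, u, rfl, h₁, h₂, h₃⟩
      obtain rfl : χ = ⟨ψ, hcl _ hψ ψ rfl⟩ := Subtype.ext h₁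
      obtain rfl := Fin.ext h₂
      obtain rfl := funext h₃
      exact h
  | and ψ₁ ψ₂ ih₁ ih₂ =>
    rw [Circuit.eval_iff, circuit_kind_gate]
    simp only [gateKind, circuit_wire_gate, WireRel, Holds]
    rw [← ih₁ (hcl _ hψ ψ₁ (Or.inl rfl)), ← ih₂ (hcl _ hψ ψ₂ (Or.inr rfl))]
    constructor
    · exact fun h => ⟨h _ ⟨⟨ψ₁, _⟩, t, v, rfl, Or.inl rfl, rfl, fun _ => rfl⟩,
        h _ ⟨⟨ψ₂, _⟩, t, v, rfl, Or.inr rfl, rfl, fun _ => rfl⟩⟩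
    · rintro ⟨h, h'⟩ g ⟨⟨χ, hχ⟩, s, u, rfl, h₁, h₂, h₃⟩
      obtain rfl := Fin.ext h₂
      obtain rfl := funext h₃
      rcases h₁ with h₁ | h₁ <;> change χ = _ at h₁ <;> subst h₁
      · exact h
      · exact h'
  | ex a ψ ih =>
    rw [Circuit.eval_iff, circuit_kind_gate]
    simp only [gateKind, circuit_wire_gate, WireRel, Holds]
    simp only [← ih (hcl _ hψ ψ rfl)]
    constructor
    · rintro ⟨g, ⟨χ, s, u, rfl, h₁, h₂, h₃⟩, h⟩
      obtain rfl : χ = ⟨ψ, hcl _ hψ ψ rfl⟩ := Subtype.ext h₁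
      obtain rfl := Fin.ext h₂
      exact ⟨u, h₃, h⟩
    · rintro ⟨u, hu, h⟩
      exact ⟨_, ⟨⟨ψ, _⟩, t, u, rfl, rfl, rfl, hu⟩, h⟩
  | prev σ =>
    rw [Circuit.eval_iff, circuit_kind_gate]
    simp only [gateKind, circuit_wire_gate, WireRel, Holds]
    rw [hE]
    constructor
    · rintro ⟨g, ⟨χ, s, u, rfl, h₁, h₂, h₃, h₄⟩, h⟩
      obtain rfl : χ = φ := Subtype.ext h₁
      obtain rfl := funext h₄
      exact ⟨s, h₂, h₃, h⟩
    · rintro ⟨s, h₁, h₂, h⟩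
      exact ⟨_, ⟨φ, s, _, rfl, rfl, h₁, h₂, fun _ => rfl⟩, h⟩

theorem circuit_eval_gate (x : Fin n → Bool) {φ : S} (t : ℕ) (ht : t < n + 2) (htT : t ≤ T)
    (v : ι → Fin (n + 2)) :
    (circuit S hcl φ T n).eval x (gate φ ⟨t, ht⟩ v) ↔ (φ : IterFormula ι).Stage n x t v := by
  induction t generalizing v with
  | zero =>
    refine circuit_eval_gate_of_prev x (fun v => ?_) φ.1 φ.2 v
    simp
  | succ t ih =>
    refine circuit_eval_gate_of_prev x (fun v => ?_) φ.1 φ.2 v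
    rw [← ih (by omega) (by omega)]
    constructor
    · exact fun h => ⟨⟨t, by omega⟩, rfl, htT, h⟩
    · rintro ⟨s, h₁, -, h₂⟩
      have hs : s = ⟨t, by omega⟩ := Fin.ext (Nat.succ_injective h₁)
      rwa [hs] at h₂

end Circuit

end IterFormula

namespace IterFormula

variable {ι : Type}

/-! ### Uniformity and depth of the circuits -/

section Uniform

variable {S : Set (IterFormula ι)}

theorem definable_kindOf_eq [Finite S] {K : ∀ n, GateKind n}
    (h : ∀ ψ : IterFormula ι, FODefinable (α := Option ι) fun n v =>
      gateKind n (v none) (fun a => v (some a)) ψ = K n)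
    (h' : FODefinable (α := Coord S) fun n _ => GateKind.or = K n) :
    FODefinable fun n (w : Coord S → Fin (n + 2)) => kindOf w = K n := by
  refine FODefinable.congr ?_ fun n w => (kindOf_eq_iff w (K n)).symm
  refine FODefinable.or (FODefinable.exists_finite fun ψ => ?_)
    (FODefinable.and (FODefinable.exists_finite fun ψ => definable_hasTag ψ).not h')
  exact (definable_hasTag ψ).and ((h ψ).reindex Sum.inr)

theorem definable_kind_and (ψ : IterFormula ι) : FODefinable (α := Option ι) fun n v =>
    gateKind n (v none) (fun a => v (some a)) ψ = GateKind.and := by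
  cases ψ with
  | rel R h => exact h.congr fun n v => by simp [gateKind]
  | bit a => exact FODefinable.false.congr fun n v => by simp only [gateKind]; split_ifs <;> simp
  | and φ ψ => exact FODefinable.true.congr fun n v => by simp [gateKind]
  | _ => exact FODefinable.false.congr fun n v => by simp [gateKind]

theorem definable_kind_not (ψ : IterFormula ι) : FODefinable (α := Option ι) fun n v =>
    gateKind n (v none) (fun a => v (some a)) ψ = GateKind.not := by
  cases ψ with
  | rel R h => exact FODefinable.false.congr fun n v => by simp only [gateKind]; split_ifs <;> simp
  | bit a => exact FODefinable.false.congr fun n v => by simp only [gateKind]; split_ifs <;> simp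
  | not ψ => exact FODefinable.true.congr fun n v => by simp [gateKind]
  | _ => exact FODefinable.false.congr fun n v => by simp [gateKind]

theorem definable_kind_or (ψ : IterFormula ι) : FODefinable (α := Option ι) fun n v =>
    gateKind n (v none) (fun a => v (some a)) ψ = GateKind.or := by
  cases ψ with
  | rel R h => exact h.not.congr fun n v => by simp [gateKind]
  | bit a =>
    refine ((FOTerm.length.lt_var (some a)).or (FOTerm.length.eq_var (some a))).congr fun n v => ?_
    rw [← le_iff_lt_or_eq, ← not_lt]
    simp only [gateKind]
    split_ifs with h <;> simp [h]
  | not φ => exact FODefinable.false.congr fun n v => by simp [gateKind]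
  | and φ ψ => exact FODefinable.false.congr fun n v => by simp [gateKind]
  | _ => exact FODefinable.true.congr fun n v => by simp [gateKind]

theorem gateKind_ne_maj (n t : ℕ) (v : ι → Fin (n + 2)) (ψ : IterFormula ι) :
    gateKind n t v ψ ≠ GateKind.maj := by
  cases ψ <;> simp only [gateKind] <;> try split_ifs
  all_goals simp

theorem kindOf_ne_maj {n : ℕ} (w : Coord S → Fin (n + 2)) : kindOf w ≠ GateKind.maj := by
  rw [Ne, kindOf_eq_iff]
  rintro (⟨ψ, -, h⟩ | ⟨-, h⟩)
  · exact gateKind_ne_maj _ _ _ _ h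
  · cases h

/-- Comparisons between formulas do not depend on `n` and enter as constants; only stages and
assignments have to be compared arithmetically. -/
theorem definable_wireRel [Finite ι] (φ χ : IterFormula ι) {T : ℕ → ℕ}
    (hT : FOTerm (α := Empty) fun n _ => T n) (ψ : IterFormula ι) :
    FODefinable (α := Option ι ⊕ Option ι) fun n v =>
      WireRel φ (T n) χ (v (.inl none)) (fun a => v (.inl (some a))) (v (.inr none))
        (fun a => v (.inr (some a))) ψ := by
  have htime : FODefinable (α := Option ι ⊕ Option ι) fun n v =>
      (v (.inl none) : ℕ) = v (.inr none) :=
    (FODefinable.eq (.inl none) (.inr none)).congr fun _ _ => Fin.ext_iff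
  have heq : FODefinable (α := Option ι ⊕ Option ι) fun n v =>
      ∀ a : ι, v (.inl (some a)) = v (.inr (some a)) :=
    FODefinable.forall_finite fun a => FODefinable.eq _ _
  cases ψ with
  | rel R h => exact FODefinable.false
  | bit a => exact FODefinable.false
  | not ψ => exact (FODefinable.const _).and (htime.and heq)
  | and ψ₁ ψ₂ => exact (FODefinable.const _).and (htime.and heq)
  | ex a ψ =>
    exact (FODefinable.const _).and (htime.and (FODefinable.forall_finite fun b =>
      (FODefinable.const _).imp (FODefinable.eq _ _)))
  | prev σ =>
    exact (FODefinable.const _).and ((((FOTerm.var (Sum.inl none)).add FOTerm.one).eq_var _).and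
      (((hT.reindex Empty.elim).var_le _).and
        (FODefinable.forall_finite fun b => FODefinable.eq _ _)))

variable [Finite S] [Finite ι] {hcl : ∀ ψ ∈ S, ∀ χ, IsChild χ ψ → χ ∈ S}

theorem uniform_circuit (φ : IterFormula ι) {T : ℕ → ℕ}
    (hT : FOTerm (α := Empty) fun n _ => T n) :
    Uniform fun n => circuit S hcl φ (T n) n where
  input := by
    have hdef (ψ : IterFormula ι) : FODefinable (α := Option ι ⊕ Unit) fun n v =>
        ∃ i : Fin n, gateKind n (v (.inl none)) (fun a => v (.inl (some a))) ψ =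
          GateKind.input i ∧ (i : ℕ) = v (.inr ()) := by
      cases ψ with
      | rel R h =>
        refine FODefinable.false.congr fun n v => ?_
        simp only [gateKind]
        split_ifs <;> simp
      | bit a =>
        refine ((FOTerm.length.var_le (Sum.inl (some a))).and
          ((FODefinable.eq (.inl (some a)) (.inr ())).and
            (FOTerm.length.eq_var (Sum.inl (some a))).not)).congr fun n v => ?_
        simp only [gateKind]
        split_ifs with h
        · simp only [GateKind.input.injEq, Fin.ext_iff]
          constructor
          · rintro ⟨-, h₂, -⟩
            exact ⟨⟨_, h⟩, rfl, h₂⟩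
          · rintro ⟨i, h₁, h₂⟩
            exact ⟨h.le, h₁.trans h₂, by omega⟩
        · simp only [false_and, exists_false, iff_false]
          omega
      | _ => exact FODefinable.false.congr fun n v => by simp [gateKind]
    have hex : FODefinable (α := Coord S ⊕ Unit) fun n v => ∃ ψ : S,
        HasTag ψ (fun c => v (.inl c)) ∧ ∃ i : Fin n,
          gateKind n (v (.inl (.inr none))) (fun a => v (.inl (.inr (some a))))
            (ψ : IterFormula ι) = GateKind.input i ∧ (i : ℕ) = v (.inr ()) :=
      FODefinable.exists_finite fun ψ => ((definable_hasTag ψ).reindex Sum.inl).and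
        ((hdef ψ).reindex (Sum.map Sum.inr id))
    refine (hex.reindex (Sum.map (coordEquiv S) id)).congr fun n v => ?_
    simp only [circuit, kindOf_eq_iff, reduceCtorEq, and_false, or_false]
    constructor
    · rintro ⟨ψ, h₁, i, h₂, h₃⟩
      exact ⟨i, ⟨ψ, h₁, h₂⟩, h₃⟩
    · rintro ⟨i, ⟨ψ, h₁, h₂⟩, h₃⟩
      exact ⟨ψ, h₁, i, h₂, h₃⟩
  and := (definable_kindOf_eq (K := fun _ => GateKind.and) definable_kind_and
    (FODefinable.false.congr fun n v => by simp)).reindex (coordEquiv S)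
  or := (definable_kindOf_eq (K := fun _ => GateKind.or) definable_kind_or
    (FODefinable.true.congr fun n v => by simp)).reindex (coordEquiv S)
  not := (definable_kindOf_eq (K := fun _ => GateKind.not) definable_kind_not
    (FODefinable.false.congr fun n v => by simp)).reindex (coordEquiv S)
  maj := FODefinable.false.congr fun n v => by
    simp only [circuit, false_iff]
    exact kindOf_ne_maj _
  wire := by
    have hex : FODefinable (α := Coord S ⊕ Coord S) fun n v =>
        IsWire φ (T n) (fun c => v (.inl c)) fun c => v (.inr c) :=
      FODefinable.exists_finite fun χ => FODefinable.exists_finite fun ψ =>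
        ((definable_hasTag χ).reindex Sum.inl).and (((definable_hasTag ψ).reindex Sum.inr).and
          ((definable_wireRel φ (χ : IterFormula ι) hT (ψ : IterFormula ι)).reindex
            (Sum.map Sum.inr Sum.inr)))
    exact hex.reindex (Sum.map (coordEquiv S) (coordEquiv S))

theorem depthLE_circuit {φ : IterFormula ι} (hS : ∀ ψ ∈ S, ψ.size ≤ φ.size) (T n : ℕ) :
    (circuit S hcl φ T n).DepthLE (T * (φ.size + 1) + φ.size) :=
  ⟨fun g => level (S := S) φ.size T fun c => g (coordEquiv S c), fun _ _ h => h.level_lt,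
    fun _ => level_le hS _⟩

/-- The number `t` if it is in the range of the variables, and `0` otherwise. -/
def clip (n t : ℕ) : Fin (n + 2) := if h : t < n + 2 then ⟨t, h⟩ else 0

theorem definable_gate_eq (φ : S) {T : ℕ → ℕ} (hT : FOTerm (α := Empty) fun n _ => T n) :
    FODefinable fun n (g : Gate n (Nat.card (Coord S))) =>
      gate φ (clip n (T n)) (fun _ => 0) = g := by
  have hclip : FODefinable (α := Coord S) fun n v => clip n (T n) = v (.inr none) := by
    have : FODefinable (α := Coord S) fun n v => T n = v (.inr none) ∨
        (¬ ∃ x : Fin (n + 2), T n = x) ∧ 0 = (v (.inr none) : ℕ) :=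
      ((hT.reindex Empty.elim).eq_var _).or (FODefinable.and
        (FODefinable.not (FODefinable.ex ((hT.reindex Empty.elim).eq_var none)))
        (FOTerm.zero.eq_var _))
    refine this.congr fun n v => ?_
    simp only [clip]
    split_ifs with h
    · have : ∃ x : Fin (n + 2), T n = x := ⟨⟨T n, h⟩, rfl⟩
      simp [this, Fin.ext_iff]
    · have h' : ¬ ∃ x : Fin (n + 2), T n = x := fun ⟨x, hx⟩ => h (hx ▸ x.isLt)
      have h'' : T n ≠ v (.inr none) := fun hv => h' ⟨_, hv⟩
      simp [h', h'', Fin.ext_iff]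
  have : FODefinable fun n (w : Coord S → Fin (n + 2)) => HasTag φ w ∧
      clip n (T n) = w (.inr none) ∧ ∀ a : ι, 0 = (w (.inr (some a)) : ℕ) :=
    (definable_hasTag φ).and (hclip.and (FODefinable.forall_finite fun a => FOTerm.zero.eq_var _))
  refine (this.reindex (coordEquiv S)).congr fun n g => ?_
  constructor
  · rintro ⟨h₁, h₂, h₃⟩
    have h₄ := h₁.eq_encode
    funext c
    have h₅ := congrFun h₄ ((coordEquiv S).symm c)
    simp only [Equiv.apply_symm_apply] at h₅
    rw [h₅, gate, h₂]
    congr 1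
    funext a
    exact Fin.ext (h₃ a)
  · rintro rfl
    simp only [gate, Equiv.symm_apply_apply]
    exact ⟨hasTag_encode _ _ _, rfl, fun _ => rfl⟩

end Uniform

variable [Finite ι]

/-- Iterating a formula `O(log log n)` times is possible in `FOLL`. -/
theorem exists_follComputable (φ : IterFormula ι) {T : ℕ → ℕ}
    (hT : FOTerm (α := Empty) fun n _ => T n) {c : ℕ} (hc : ∀ n, T n ≤ c * loglog n + c) :
    ∃ f, FOLLComputable f ∧ ∀ x : List Bool, ∃ b, f x = [b] ∧ (T x.length < x.length + 2 →
      (b = true ↔ φ.Stage x.length x.get (T x.length) fun _ => 0)) := by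
  classical
  obtain ⟨S, hfin, hφ, hsize, hcl⟩ := φ.exists_closed
  have : Finite S := hfin
  let out (n : ℕ) : Gate n (Nat.card (Coord S)) := gate ⟨φ, hφ⟩ (clip n (T n)) fun _ => 0
  refine ⟨fun x => [decide ((circuit S hcl φ (T x.length) x.length).eval x.get (out x.length))],
    ⟨Nat.card (Coord S), 0, c * (φ.size + 1) + φ.size, fun n => circuit S hcl φ (T n) n,
      fun _ => 1, fun n _ => out n, uniform_circuit φ hT, fun n => ?_, fun n g => kindOf_ne_maj _,
      fun n => by simp, ?_, fun x => ⟨rfl, fun j hj => ?_⟩⟩, fun x => ⟨_, rfl, fun h => ?_⟩⟩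
  · obtain ⟨l, hl, hle⟩ := depthLE_circuit (hcl := hcl) hsize (T n) n
    refine ⟨l, hl, fun g => (hle g).trans ?_⟩
    have := Nat.mul_le_mul_right (φ.size + 1) (hc n)
    nlinarith
  · refine ((definable_gate_eq ⟨φ, hφ⟩ hT).reindex Sum.inr).congr fun n v => ?_
    -- There is one output bit, so positions have no digits and the only index is `0`.
    simp only [tupleIndex, Finset.univ_eq_empty, Finset.sum_empty, zero_lt_one, true_and]
    rfl
  · obtain rfl : j = 0 := by simpa using hj
    simp
  · rw [decide_eq_true_iff]
    simp only [out, clip, dif_pos h]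
    exact circuit_eval_gate x.get (φ := ⟨φ, hφ⟩) _ h le_rfl _

/-- Languages defined by formulas are in `MAC⁰`. -/
theorem mem_mac0 (φ : IterFormula ι) :
    {x : List Bool | φ.Stage x.length x.get 0 fun _ => 0} ∈ MAC0 := by
  obtain ⟨S, hfin, hφ, hsize, hcl⟩ := φ.exists_closed
  have : Finite S := hfin
  have h0 : FOTerm (α := Empty) fun n _ => 0 := FOTerm.zero
  refine ⟨Nat.card (Coord S), 0 * (φ.size + 1) + φ.size, fun n => circuit S hcl φ 0 n,
    fun n => gate ⟨φ, hφ⟩ (clip n 0) fun _ => 0, uniform_circuit φ h0,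
    definable_gate_eq ⟨φ, hφ⟩ h0, depthLE_circuit hsize 0,
    fun n g h => (kindOf_ne_maj _ h).elim, fun x => ?_⟩
  exact (circuit_eval_gate x.get (φ := ⟨φ, hφ⟩) 0 (by omega) le_rfl _).symm

end IterFormula

/-! ### Reading a single output bit in `β₁MAC⁰` -/

section BetaMAC0

/-- Doubling keeps the first bit of `x` in front; for empty `x` the separator starts with `false`.
-/
theorem head_pairCode (x y : List Bool) :
    (pairCode x y).head? = some (x.head?.getD false) := by
  cases x <;> simp [pairCode]

theorem firstBit_mem_mac0 : {x : List Bool | x.head? = some true} ∈ MAC0 ∧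
    {x : List Bool | ¬ x.head? = some true} ∈ MAC0 := by
  have key (x : List Bool) : (∃ h : (0 : ℕ) < x.length, x.get ⟨0, h⟩ = true) ↔
      x.head? = some true := by
    cases x <;> simp
  constructor
  · convert IterFormula.mem_mac0 (IterFormula.bit ()) using 2
    ext x
    exact (key x).symm
  · convert IterFormula.mem_mac0 (IterFormula.not (IterFormula.bit ())) using 2
    ext x
    exact not_congr (key x).symm

theorem firstBit_mem_beta : {x : List Bool | x.head? = some true} ∈ beta 1 MAC0 ∧
    {x : List Bool | ¬ x.head? = some true} ∈ beta 1 MAC0 := by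
  have key (x y : List Bool) : (pairCode x y).head? = some true ↔ x.head? = some true := by
    rw [head_pairCode]
    cases x <;> simp
  refine ⟨⟨_, firstBit_mem_mac0.1, 0, fun x => ?_⟩, ⟨_, firstBit_mem_mac0.2, 0, fun x => ?_⟩⟩
  · exact ⟨fun h => ⟨[], by simp, (key x []).2 h⟩, fun ⟨y, _, hy⟩ => (key x y).1 hy⟩
  · exact ⟨fun h => ⟨[], by simp, (not_congr (key x [])).2 h⟩,
      fun ⟨y, _, hy⟩ => (not_congr (key x y)).1 hy⟩

/-- The iteration is done in `FOLL`; the outer language ignores its guess and reads the output bit,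
or its negation for the complement. -/
theorem exists_mem_beta1MAC0FOLL {ι : Type} [Finite ι] (φ : IterFormula ι) {T : ℕ → ℕ}
    (hT : FOTerm (α := Empty) fun n _ => T n) {c : ℕ} (hc : ∀ n, T n ≤ c * loglog n + c) :
    ∃ L ∈ beta1MAC0FOLL, ∃ L' ∈ beta1MAC0FOLL, ∀ x : List Bool, T x.length < x.length + 2 →
      (x ∈ L ↔ φ.Stage x.length x.get (T x.length) fun _ => 0) ∧
      (x ∈ L' ↔ ¬ φ.Stage x.length x.get (T x.length) fun _ => 0) := by
  obtain ⟨f, hf, h⟩ := φ.exists_follComputable hT hc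
  refine ⟨{x | (f x).head? = some true}, ⟨f, hf, _, firstBit_mem_beta.1, fun x => Iff.rfl⟩,
    {x | ¬ (f x).head? = some true}, ⟨f, hf, _, firstBit_mem_beta.2, fun x => Iff.rfl⟩,
    fun x hx => ?_⟩
  obtain ⟨b, hb, hb'⟩ := h x
  simp only [Set.mem_ofPred_eq, hb, ← hb' hx, List.head?_cons, Option.some.injEq, and_self]

end BetaMAC0

/-! ### Codes of Cayley tables -/

/-- The length of the code of a Cayley table of order `n`. -/
def codeLength (n : ℕ) : ℕ := n + 1 + n * n * Nat.clog 2 n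

theorem codeLength_strictMono : StrictMono codeLength := by
  intro m n h
  have : m * m * Nat.clog 2 m ≤ n * n * Nat.clog 2 n :=
    Nat.mul_le_mul (Nat.mul_le_mul h.le h.le) (Nat.clog_mono_right 2 h.le)
  simp only [codeLength]
  omega

theorem getElem?_flatMap_of_length_eq {α β : Type} {f : α → List β} {w : ℕ}
    (hf : ∀ a, (f a).length = w) {l : List α} {i : ℕ} {a : α} (hi : l[i]? = some a) {s : ℕ}
    (hs : s < w) : (l.flatMap f)[i * w + s]? = (f a)[s]? := by
  induction l generalizing i with
  | nil => simp at hi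
  | cons b l ih =>
    rw [List.flatMap_cons]
    cases i with
    | zero =>
      obtain rfl : b = a := by simpa using hi
      rw [zero_mul, zero_add, List.getElem?_append_left (by rw [hf]; exact hs)]
    | succ i =>
      rw [List.getElem?_append_right (by rw [hf, add_mul]; omega), hf,
        ← ih (by simpa using hi)]
      congr 1
      rw [add_mul]
      omega

theorem length_flatMap_finRange {β : Type} {n w : ℕ} {f : Fin n → List β}
    (hf : ∀ a, (f a).length = w) : ((List.finRange n).flatMap f).length = n * w := by
  simp [List.length_flatMap, hf]

section CayleyCode

variable {G : Type} [Group G] {n : ℕ} (e : Fin n ≃ G)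

theorem length_cayleyCode : (cayleyCode e).length = codeLength n := by
  rw [cayleyCode, List.length_append, length_flatMap_finRange (w := n * Nat.clog 2 n)
    fun i => length_flatMap_finRange fun j => List.length_ofFn]
  simp [codeLength, mul_assoc]

theorem getElem?_cayleyCode_of_lt {a : ℕ} (h : a < n) : (cayleyCode e)[a]? = some true := by
  rw [cayleyCode, List.append_assoc, List.getElem?_append_left (by simpa using h)]
  simp [h]

theorem getElem?_cayleyCode_self : (cayleyCode e)[n]? = some false := by
  rw [cayleyCode, List.append_assoc, List.getElem?_append_right (by simp)]
  simp

/-- The position of a bit of the product of the elements `i` and `j`. -/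
def bitPosition (n i j s : ℕ) : ℕ := n + 1 + (i * n + j) * Nat.clog 2 n + s

theorem getElem?_cayleyCode_bitPosition (i j : Fin n) {s : ℕ} (hs : s < Nat.clog 2 n) :
    (cayleyCode e)[bitPosition n i j s]? =
      some (Nat.testBit (e.symm (e i * e j) : ℕ) s) := by
  rw [cayleyCode, List.getElem?_append_right (by simp [bitPosition]; omega)]
  have h₁ : bitPosition n i j s - (List.replicate n true ++ [false]).length =
      (i : ℕ) * (n * Nat.clog 2 n) + ((j : ℕ) * Nat.clog 2 n + s) := by
    simp only [bitPosition, List.length_append, List.length_replicate, List.length_singleton]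
    rw [add_assoc (n + 1), Nat.add_sub_cancel_left]
    ring
  have h₂ : (j : ℕ) * Nat.clog 2 n + s < n * Nat.clog 2 n := calc
    (j : ℕ) * Nat.clog 2 n + s < (j : ℕ) * Nat.clog 2 n + Nat.clog 2 n := by omega
    _ = (j + 1) * Nat.clog 2 n := by ring
    _ ≤ n * Nat.clog 2 n := Nat.mul_le_mul_right _ j.isLt
  rw [h₁, getElem?_flatMap_of_length_eq (a := i)
    (fun i => length_flatMap_finRange fun j => List.length_ofFn) (by simp) h₂,
    getElem?_flatMap_of_length_eq (a := j) (fun j => List.length_ofFn) (by simp) hs]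
  simp [hs]

end CayleyCode

open Classical in
/-- The order of two groups of the same order, recovered from the length of their codes. -/
noncomputable def orderOfLength (L : ℕ) : ℕ :=
  if h : ∃ m, codeLength m + codeLength m = L then h.choose else 0

theorem orderOfLength_add_self (m : ℕ) : orderOfLength (codeLength m + codeLength m) = m := by
  have h : ∃ m', codeLength m' + codeLength m' = codeLength m + codeLength m := ⟨m, rfl⟩
  rw [orderOfLength, dif_pos h]
  have := h.choose_spec
  exact codeLength_strictMono.injective (by omega)

theorem codeLength_orderOfLength {L : ℕ} (h : orderOfLength L ≠ 0) :
    codeLength (orderOfLength L) + codeLength (orderOfLength L) = L := by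
  by_cases hL : ∃ m, codeLength m + codeLength m = L
  · rw [orderOfLength, dif_pos hL]
    exact hL.choose_spec
  · rw [orderOfLength, dif_neg hL] at h
    exact (h rfl).elim

theorem orderOfLength_lt (L : ℕ) : orderOfLength L < L + 2 := by
  by_cases h : orderOfLength L = 0
  · omega
  · have := codeLength_orderOfLength h
    simp only [codeLength] at this
    omega

namespace FOTerm

variable {α : Type}

/-- The order is less than the length of the input plus two, so it can be found by quantification;
`0` is the default when no order fits. -/
theorem orderOfLength : FOTerm fun n (_ : α → Fin (n + 2)) => orderOfLength n := by
  have hlen {β : Type} (b : β) : FODefinable fun n (v : β → Fin (n + 2)) =>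
      codeLength (v b) + codeLength (v b) = n := by
    have h : FOTerm fun n (v : β → Fin (n + 2)) => codeLength (v b) :=
      ((var b).add one).add (((var b).mul (var b)).mul (clog_var b))
    exact (h.add h).eq_of_lt length fun n _ => by omega
  have : FODefinable (α := Option α) fun n v =>
      (codeLength (v none) + codeLength (v none) = n ∨
        (¬ ∃ x : Fin (n + 2), codeLength x + codeLength x = n) ∧ 0 = (v none : ℕ)) :=
    (hlen none).or (FODefinable.and (FODefinable.not (FODefinable.ex (hlen none)))
      (zero.eq_var none))
  refine this.congr fun n v => ⟨?_, fun h => ?_⟩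
  · rintro (h | ⟨h, h'⟩)
    · rw [← orderOfLength_add_self (v none : ℕ), h]
    · rw [← h']
      by_contra hne
      exact h ⟨⟨_, orderOfLength_lt n⟩, codeLength_orderOfLength hne⟩
  · by_cases h0 : CFIGroups.orderOfLength n = 0
    · by_cases hex : ∃ x : Fin (n + 2), codeLength x + codeLength x = n
      · obtain ⟨x, hx⟩ := hex
        left
        have h₁ := orderOfLength_add_self x
        rw [hx] at h₁
        rwa [← show (x : ℕ) = v none from h₁.symm.trans h]
      · exact Or.inr ⟨hex, h0.symm.trans h⟩
    · left
      rw [← h]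
      exact codeLength_orderOfLength h0

theorem half : FOTerm fun n (_ : α → Fin (n + 2)) => n / 2 := by
  have hb : ∀ (n : ℕ) (_ : Option α → Fin (n + 2)), n < n + 2 := fun n _ => by omega
  have h2 := (var (none : Option α)).add (var none)
  refine ((h2.eq_of_lt length hb).or ((h2.add one).eq_of_lt length hb)).congr fun n v => ?_
  beta_reduce
  omega

end FOTerm

/-! ### Definability by iterated formulas -/

/-- A family of predicates is defined by one iterated formula. -/
def IterDefinable {ι : Type} (P : ∀ n, (Fin n → Bool) → ((ι → Fin (n + 2)) → Prop) → ℕ →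
    (ι → Fin (n + 2)) → Prop) : Prop :=
  ∃ φ : IterFormula ι, ∀ n x E t v, φ.Holds n x E t v ↔ P n x E t v

/-- The bit at the position `i` of the input `x` is `1`. -/
def Reads {n : ℕ} (x : Fin n → Bool) (i : ℕ) : Prop := ∃ h : i < n, x ⟨i, h⟩ = true

theorem reads_get_iff (x : List Bool) (i : ℕ) : Reads x.get i ↔ x[i]? = some true := by
  rw [List.getElem?_eq_some_iff]
  rfl

namespace IterDefinable

variable {ι : Type} {P Q : ∀ n, (Fin n → Bool) → ((ι → Fin (n + 2)) → Prop) → ℕ →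
    (ι → Fin (n + 2)) → Prop}

theorem congr (h : IterDefinable P) (hPQ : ∀ n x E t v, P n x E t v ↔ Q n x E t v) :
    IterDefinable Q := by
  obtain ⟨φ, hφ⟩ := h
  exact ⟨φ, fun n x E t v => (hφ n x E t v).trans (hPQ n x E t v)⟩

theorem rel {R : ∀ n, (ι → Fin (n + 2)) → Prop} (h : FODefinable R) :
    IterDefinable fun n _ _ _ v => R n v :=
  ⟨.rel (fun n _ v => R n v) (h.reindex some), fun _ _ _ _ _ => Iff.rfl⟩

theorem time_eq {T : ℕ → ℕ} (h : FOTerm (α := Empty) fun n _ => T n) :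
    IterDefinable (ι := ι) fun n _ _ t _ => T n = t :=
  ⟨.rel (fun n t _ => T n = t) ((h.reindex Empty.elim).eq_var none), fun _ _ _ _ _ => Iff.rfl⟩

theorem not (h : IterDefinable P) : IterDefinable fun n x E t v => ¬ P n x E t v := by
  obtain ⟨φ, hφ⟩ := h
  exact ⟨φ.not, fun n x E t v => not_congr (hφ n x E t v)⟩

theorem and (hP : IterDefinable P) (hQ : IterDefinable Q) :
    IterDefinable fun n x E t v => P n x E t v ∧ Q n x E t v := by
  obtain ⟨φ, hφ⟩ := hP
  obtain ⟨ψ, hψ⟩ := hQ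
  exact ⟨φ.and ψ, fun n x E t v => and_congr (hφ n x E t v) (hψ n x E t v)⟩

theorem imp (hP : IterDefinable P) (hQ : IterDefinable Q) :
    IterDefinable fun n x E t v => P n x E t v → Q n x E t v :=
  (hP.and hQ.not).not.congr fun n x E t v => by tauto

theorem iff (hP : IterDefinable P) (hQ : IterDefinable Q) :
    IterDefinable fun n x E t v => (P n x E t v ↔ Q n x E t v) :=
  ((hP.imp hQ).and (hQ.imp hP)).congr fun n x E t v => by tauto

theorem forall_finite {κ : Type} [Finite κ] {P : κ → ∀ n, (Fin n → Bool) →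
    ((ι → Fin (n + 2)) → Prop) → ℕ → (ι → Fin (n + 2)) → Prop} (h : ∀ i, IterDefinable (P i)) :
    IterDefinable fun n x E t v => ∀ i, P i n x E t v := by
  have := Fintype.ofFinite κ
  suffices ∀ l : List κ, IterDefinable fun n x E t v => ∀ i ∈ l, P i n x E t v from
    (this Finset.univ.toList).congr fun n x E t v => by simp
  intro l
  induction l with
  | nil => exact (rel FODefinable.true).congr fun n x E t v => by simp
  | cons i l ih => exact ((h i).and ih).congr fun n x E t v => by simp

theorem ex [DecidableEq ι] (a : ι) (h : IterDefinable P) :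
    IterDefinable fun n x E t v => ∃ c, P n x E t (Function.update v a c) := by
  obtain ⟨φ, hφ⟩ := h
  refine ⟨φ.ex a, fun n x E t v => ⟨?_, ?_⟩⟩
  · rintro ⟨u, hu, h⟩
    refine ⟨u a, ?_⟩
    rw [← hφ, Function.update_eq_iff.2 ⟨rfl, fun b hb => (hu b hb).symm⟩]
    exact h
  · rintro ⟨c, h⟩
    exact ⟨_, fun b hb => Function.update_of_ne hb _ _, (hφ _ _ _ _ _).2 h⟩

theorem all [DecidableEq ι] (a : ι) (h : IterDefinable P) :
    IterDefinable fun n x E t v => ∀ c, P n x E t (Function.update v a c) :=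
  (ex a h.not).not.congr fun n x E t v => by simp

theorem prev (σ : ι → ι) : IterDefinable fun _ _ E _ v => E fun a => v (σ a) :=
  ⟨.prev σ, fun _ _ _ _ _ => Iff.rfl⟩

/-- The computed position is guessed in the scratch variable `b`, on which `f` must not depend. -/
theorem reads [DecidableEq ι] (b : ι) {f : ∀ n, (ι → Fin (n + 2)) → ℕ} (hf : FOTerm f)
    (hb : ∀ n v c, f n (Function.update v b c) = f n v) :
    IterDefinable fun n x _ _ v => Reads x (f n v) := by
  have hbit : IterDefinable fun n x _ _ v => Reads x (v b) := ⟨.bit b, fun _ _ _ _ _ => Iff.rfl⟩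
  refine (ex b ((rel (hf.eq_var b)).and hbit)).congr fun n x E t v => ?_
  simp only [hb, Function.update_self]
  constructor
  · rintro ⟨c, h₁, h₂⟩
    rwa [h₁]
  · rintro ⟨h₁, h₂⟩
    exact ⟨⟨f n v, by omega⟩, rfl, h₁, h₂⟩

end IterDefinable

/-! ### The refinement as an iterated formula -/

section Formula

variable {k : ℕ}

/-- Variables of the formula for count-free refinement: two `k`-tuples and two further elements. -/
abbrev WLVar (k : ℕ) : Type := (Fin k ⊕ Fin k) ⊕ Bool

/-- The entries of the first tuple. -/
abbrev fstVar (i : Fin k) : WLVar k := .inl (.inl i)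

/-- The entries of the second tuple. -/
abbrev sndVar (i : Fin k) : WLVar k := .inl (.inr i)

/-- A further element of the first group. -/
abbrev fstNew : WLVar k := .inr false

/-- A further element of the second group. -/
abbrev sndNew : WLVar k := .inr true

/-- The product of `i` and `j` is `l` in the Cayley table that starts at the position `o` of the
input. -/
def ReadsProduct {n : ℕ} (x : Fin n → Bool) (o i j l : ℕ) : Prop :=
  ∀ s : Fin (n + 2), (s : ℕ) < Nat.clog 2 (orderOfLength n) →
    (Reads x (o + bitPosition (orderOfLength n) i j s) ↔ Nat.testBit l s = true)

/-- The variable `fstNew` runs through the bit positions, and `sndNew` holds the computed address.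
-/
theorem definable_readsProduct {o : ℕ → ℕ} (ho : FOTerm (α := WLVar k) fun n _ => o n)
    (a b c : Fin k ⊕ Fin k) :
    IterDefinable (ι := WLVar k) fun n x _ _ v =>
      ReadsProduct x (o n) (v (.inl a)) (v (.inl b)) (v (.inl c)) := by
  have hord : FOTerm (α := WLVar k) fun n _ => orderOfLength n := FOTerm.orderOfLength
  have hlog : FOTerm (α := WLVar k) fun n _ => Nat.clog 2 (orderOfLength n) :=
    hord.clog fun n _ => orderOfLength_lt n
  have hpos : FOTerm (α := WLVar k) fun n v => o n +
      bitPosition (orderOfLength n) (v (.inl a)) (v (.inl b)) (v fstNew) :=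
    ho.add (((hord.add FOTerm.one).add (((((FOTerm.var _).mul hord).add (FOTerm.var _)).mul
      hlog))).add (FOTerm.var _))
  have hlt : FODefinable (α := WLVar k) fun n v =>
      (v fstNew : ℕ) < Nat.clog 2 (orderOfLength n) :=
    hlog.var_lt (fun n _ => ((Nat.clog_le_of_le_pow
      (Nat.lt_two_pow_self).le).trans_lt (orderOfLength_lt n))) _
  refine (IterDefinable.all fstNew ((IterDefinable.rel hlt).imp
    ((IterDefinable.reads sndNew hpos fun n v c => by simp).iff
      (IterDefinable.rel (FODefinable.bit fstNew (.inl c)))))).congr fun n x E t v => ?_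
  simp [ReadsProduct]

/-- Initial colours agree. -/
def InitFormula {n : ℕ} (x : Fin n → Bool) (v : WLVar k → Fin (n + 2)) : Prop :=
  (∀ i j : Fin k, v (fstVar i) = v (fstVar j) ↔ v (sndVar i) = v (sndVar j)) ∧
  ∀ i j l : Fin k, ReadsProduct x 0 (v (fstVar i)) (v (fstVar j)) (v (fstVar l)) ↔
    ReadsProduct x (n / 2) (v (sndVar i)) (v (sndVar j)) (v (sndVar l))

/-- The variables after the replacement of the `i`-th entries of both tuples. -/
def replaceVar (i : Fin k) : WLVar k → WLVar k :=
  Function.update (Function.update id (fstVar i) fstNew) (sndVar i) sndNew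

/-- The assignment `v` with the values `c` and `d` for the two further elements. -/
def setNew {n : ℕ} (v : WLVar k → Fin (n + 2)) (c d : Fin (n + 2)) : WLVar k → Fin (n + 2) :=
  Function.update (Function.update v fstNew c) sndNew d

/-- Colours of the next round agree, where `E` says that the colours of the round agree. -/
def StepFormula {n : ℕ} (E : (WLVar k → Fin (n + 2)) → Prop) (v : WLVar k → Fin (n + 2)) : Prop :=
  E v ∧
  (∀ c : Fin (n + 2), (c : ℕ) < orderOfLength n → ∃ d : Fin (n + 2), (d : ℕ) < orderOfLength n ∧
    ∀ i, E fun a => setNew v c d (replaceVar i a)) ∧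
  (∀ d : Fin (n + 2), (d : ℕ) < orderOfLength n → ∃ c : Fin (n + 2), (c : ℕ) < orderOfLength n ∧
    ∀ i, E fun a => setNew v c d (replaceVar i a))

/-- All entries of the first tuple are replaced by the same element, and likewise for the second. -/
def constVar : WLVar k → WLVar k := Sum.elim (Sum.elim (fun _ => fstNew) fun _ => sndNew) .inr

/-- The first table has the order that is expected from the length of the input, and the colours of
some constant tuples agree. -/
def FinalFormula {n : ℕ} (x : Fin n → Bool) (E : (WLVar k → Fin (n + 2)) → Prop)
    (v : WLVar k → Fin (n + 2)) : Prop :=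
  (∀ c : Fin (n + 2), (c : ℕ) < orderOfLength n → Reads x c) ∧ ¬ Reads x (orderOfLength n) ∧
  ∃ c : Fin (n + 2), (c : ℕ) < orderOfLength n ∧ ∃ d : Fin (n + 2), (d : ℕ) < orderOfLength n ∧
    E fun a => setNew v c d (constVar a)

/-- The formula whose iteration compares the colours of two groups after `T n - 1` rounds. -/
def WLFormula (T : ℕ → ℕ) (n : ℕ) (x : Fin n → Bool) (E : (WLVar k → Fin (n + 2)) → Prop)
    (t : ℕ) (v : WLVar k → Fin (n + 2)) : Prop :=
  (0 = t → InitFormula x v) ∧ (¬ 0 = t ∧ ¬ T n = t → StepFormula E v) ∧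
    (T n = t → FinalFormula x E v)

theorem definable_wlFormula {T : ℕ → ℕ} (hT : FOTerm (α := Empty) fun n _ => T n) :
    IterDefinable (WLFormula (k := k) T) := by
  have hord {α : Type} : FOTerm fun n (_ : α → Fin (n + 2)) => orderOfLength n :=
    FOTerm.orderOfLength
  have hlt (a : WLVar k) : IterDefinable (ι := WLVar k) fun n _ _ _ v =>
      (v a : ℕ) < orderOfLength n :=
    IterDefinable.rel (hord.var_lt (fun n _ => orderOfLength_lt n) a)
  have h0 := IterDefinable.time_eq (ι := WLVar k) (T := fun _ => 0) FOTerm.zero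
  have h1 := IterDefinable.time_eq (ι := WLVar k) hT
  refine (h0.imp (IterDefinable.and ?_ ?_)).and (((h0.not.and h1.not).imp
    (IterDefinable.and (IterDefinable.prev id) (IterDefinable.and ?_ ?_))).and
    (h1.imp (IterDefinable.and ?_ (IterDefinable.and ?_ ?_))))
  · exact IterDefinable.rel (FODefinable.forall_finite fun i => FODefinable.forall_finite fun j =>
      (FODefinable.eq _ _).iff (FODefinable.eq _ _))
  · exact IterDefinable.forall_finite fun i => IterDefinable.forall_finite fun j =>
      IterDefinable.forall_finite fun l => (definable_readsProduct FOTerm.zero _ _ _).iff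
        (definable_readsProduct FOTerm.half _ _ _)
  · refine (IterDefinable.all fstNew ((hlt fstNew).imp (IterDefinable.ex sndNew ((hlt sndNew).and
      (IterDefinable.forall_finite fun i => IterDefinable.prev (replaceVar i)))))).congr
      fun n x E t v => ?_
    simp [setNew]
  · refine (IterDefinable.all sndNew ((hlt sndNew).imp (IterDefinable.ex fstNew ((hlt fstNew).and
      (IterDefinable.forall_finite fun i => IterDefinable.prev (replaceVar i)))))).congr
      fun n x E t v => ?_
    simp [setNew, Function.update_comm (show fstNew (k := k) ≠ sndNew by simp)]
  · refine (IterDefinable.all fstNew ((hlt fstNew).imp (IterDefinable.reads sndNew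
      (FOTerm.var fstNew) fun n v c => by simp))).congr fun n x E t v => ?_
    simp
  · exact (IterDefinable.reads sndNew hord fun n v c => rfl).not
  · refine (IterDefinable.ex fstNew ((hlt fstNew).and (IterDefinable.ex sndNew ((hlt sndNew).and
      (IterDefinable.prev constVar))))).congr fun n x E t v => ?_
    simp [setNew]

end Formula

/-! ### Correctness on codes of groups of the same order -/

section Correctness

variable {k : ℕ} {G H : Type} [Group G] [Group H] {n m : ℕ}

/-- The unary header has its first `0` at position `n`; this checks a conjectured order against the
first table. -/
theorem header_iff (e : Fin n ≃ G) (l : List Bool) (o : ℕ) :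
    ((∀ c < o, (cayleyCode e ++ l)[c]? = some true) ∧
      ¬ (cayleyCode e ++ l)[o]? = some true) ↔ o = n := by
  have hn : n < (cayleyCode e).length := by
    rw [length_cayleyCode, codeLength]
    omega
  have h₁ (c : ℕ) (hc : c < n) : (cayleyCode e ++ l)[c]? = some true := by
    rw [List.getElem?_append_left (by omega), getElem?_cayleyCode_of_lt e hc]
  have h₂ : (cayleyCode e ++ l)[n]? = some false := by
    rw [List.getElem?_append_left hn, getElem?_cayleyCode_self]
  constructor
  · rintro ⟨h, h'⟩
    rcases lt_trichotomy o n with ho | ho | ho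
    · exact (h' (h₁ o ho)).elim
    · exact ho
    · have := h n ho
      rw [h₂] at this
      cases this
  · rintro rfl
    exact ⟨h₁, by simp [h₂]⟩

theorem eq_iff_testBit_clog (i j : Fin n) :
    (∀ s < Nat.clog 2 n, Nat.testBit i s = Nat.testBit j s) ↔ i = j := by
  refine ⟨fun h => Fin.ext (Nat.eq_of_testBit_eq fun s => ?_), by rintro rfl _ _; rfl⟩
  by_cases hs : s < Nat.clog 2 n
  · exact h s hs
  · have hlt (i : Fin n) : (i : ℕ) < 2 ^ s := i.isLt.trans_le
      ((Nat.le_pow_clog one_lt_two n).trans (Nat.pow_le_pow_right two_pos (not_lt.1 hs)))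
    rw [Nat.testBit_lt_two_pow (hlt i), Nat.testBit_lt_two_pow (hlt j)]

theorem readsProduct_iff {L : List Bool} {o : ℕ} (hL : orderOfLength L.length = n)
    (e : Fin n ≃ G)
    (h : ∀ i j : Fin n, ∀ s < Nat.clog 2 n, L[o + bitPosition n i j s]? =
      (cayleyCode e)[bitPosition n i j s]?) (i j l : Fin n) :
    ReadsProduct L.get o i j l ↔ e i * e j = e l := by
  rw [← Equiv.symm_apply_eq, ← eq_iff_testBit_clog, ReadsProduct, hL]
  have key (s : ℕ) (hs : s < Nat.clog 2 n) :
      (Reads L.get (o + bitPosition n i j s) ↔ Nat.testBit l s = true) ↔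
        Nat.testBit (e.symm (e i * e j) : ℕ) s = Nat.testBit l s := by
    rw [reads_get_iff, h i j s hs, getElem?_cayleyCode_bitPosition e i j hs, Option.some.injEq]
    exact Bool.eq_iff_iff.symm
  constructor
  · intro h' s hs
    have hs' : s < L.length + 2 := by
      have h₁ := orderOfLength_lt L.length
      have h₂ : Nat.clog 2 n ≤ n := Nat.clog_le_of_le_pow Nat.lt_two_pow_self.le
      omega
    exact (key s hs).1 (h' ⟨s, hs'⟩ hs)
  · exact fun h' s hs => (key s hs).2 (h' s hs)

variable (e : Fin n ≃ G) (e' : Fin n ≃ H)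

theorem length_append_cayleyCode :
    (cayleyCode e ++ cayleyCode e').length = codeLength n + codeLength n := by
  rw [List.length_append, length_cayleyCode, length_cayleyCode]

theorem initFormula_iff (L : List Bool) (hL : L = cayleyCode e ++ cayleyCode e')
    {v : WLVar k → Fin (L.length + 2)} {g h : Fin k → Fin n}
    (hg : ∀ i, (v (fstVar i) : ℕ) = g i) (hh : ∀ i, (v (sndVar i) : ℕ) = h i) :
    InitFormula L.get v ↔ WLEquiv 0 (e ∘ g) (e' ∘ h) := by
  have hlen : L.length = codeLength n + codeLength n := hL ▸ length_append_cayleyCode e e'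
  have hord : orderOfLength L.length = n := by rw [hlen, orderOfLength_add_self]
  have hbound (i j : Fin n) (s : ℕ) (hs : s < Nat.clog 2 n) :
      bitPosition n i j s < (cayleyCode e).length :=
    (List.getElem?_eq_some_iff.1 (getElem?_cayleyCode_bitPosition e i j hs)).1
  have h₁ := readsProduct_iff (o := 0) hord e fun i j s hs => by
    rw [hL, zero_add, List.getElem?_append_left (hbound i j s hs)]
  -- Both codes have the same length, so the second table starts in the middle of the input.
  have h₂ := readsProduct_iff (o := L.length / 2) hord e' fun i j s hs => by
    have : L.length / 2 = (cayleyCode e).length := by rw [length_cayleyCode]; omega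
    rw [this, hL, List.getElem?_append_right (Nat.le_add_right _ _), Nat.add_sub_cancel_left]
  rw [wlEquiv_zero, InitFormula]
  simp only [Fin.ext_iff, hg, hh, h₁, h₂]
  simp [Fin.ext_iff]

theorem stepFormula_iff {L r : ℕ} (hL : orderOfLength L = n)
    {E : (WLVar k → Fin (L + 2)) → Prop}
    (hE : ∀ v (g h : Fin k → Fin n), (∀ i, (v (fstVar i) : ℕ) = g i) →
      (∀ i, (v (sndVar i) : ℕ) = h i) → (E v ↔ WLEquiv r (e ∘ g) (e' ∘ h)))
    {v : WLVar k → Fin (L + 2)} {g h : Fin k → Fin n}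
    (hg : ∀ i, (v (fstVar i) : ℕ) = g i) (hh : ∀ i, (v (sndVar i) : ℕ) = h i) :
    StepFormula E v ↔ WLEquiv (r + 1) (e ∘ g) (e' ∘ h) := by
  have hlt := orderOfLength_lt L
  have key (c d : Fin n) (c' d' : Fin (L + 2)) (hc : (c' : ℕ) = c) (hd : (d' : ℕ) = d)
      (i : Fin k) : (E fun a => setNew v c' d' (replaceVar i a)) ↔
        WLEquiv r (Function.update (e ∘ g) i (e c)) (Function.update (e' ∘ h) i (e' d)) := by
    rw [← Function.comp_update, ← Function.comp_update]
    apply hE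
    · intro j
      by_cases hj : j = i
      · subst hj; simp [setNew, replaceVar, hc]
      · simp [setNew, replaceVar, hg, hj]
    · intro j
      by_cases hj : j = i
      · subst hj; simp [setNew, replaceVar, hd]
      · simp [setNew, replaceVar, hh, hj]
  let cast (c : Fin n) : Fin (L + 2) := ⟨c, by omega⟩
  rw [wlEquiv_succ, StepFormula, hL, hE v g h hg hh]
  refine and_congr_right fun _ => and_congr ⟨fun H x => ?_, fun H c hc => ?_⟩
    ⟨fun H y => ?_, fun H d hd => ?_⟩
  · obtain ⟨c, rfl⟩ := e.surjective x
    obtain ⟨d, hd, h'⟩ := H (cast c) c.isLt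
    exact ⟨e' ⟨d, hd⟩, fun i => (key c ⟨d, hd⟩ _ d rfl rfl i).1 (h' i)⟩
  · obtain ⟨y, hy⟩ := H (e ⟨c, hc⟩)
    obtain ⟨d, rfl⟩ := e'.surjective y
    exact ⟨cast d, d.isLt, fun i => (key ⟨c, hc⟩ d c _ rfl rfl i).2 (hy i)⟩
  · obtain ⟨d, rfl⟩ := e'.surjective y
    obtain ⟨c, hc, h'⟩ := H (cast d) d.isLt
    exact ⟨e ⟨c, hc⟩, fun i => (key ⟨c, hc⟩ d c _ rfl rfl i).1 (h' i)⟩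
  · obtain ⟨x, hx⟩ := H (e' ⟨d, hd⟩)
    obtain ⟨c, rfl⟩ := e.surjective x
    exact ⟨cast c, c.isLt, fun i => (key c ⟨d, hd⟩ _ d rfl rfl i).2 (hx i)⟩

/-- Before stage `T` the final clause is inactive, so the stages are precisely the rounds of
refinement. -/
theorem stage_iff {T : ℕ → ℕ} {φ : IterFormula (WLVar k)}
    (hφ : ∀ n x E t v, φ.Holds n x E t v ↔ WLFormula T n x E t v) {L : List Bool}
    (hL : L = cayleyCode e ++ cayleyCode e') {t : ℕ} (ht : t < T L.length)
    {v : WLVar k → Fin (L.length + 2)} {g h : Fin k → Fin n}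
    (hg : ∀ i, (v (fstVar i) : ℕ) = g i) (hh : ∀ i, (v (sndVar i) : ℕ) = h i) :
    φ.Stage L.length L.get t v ↔ WLEquiv t (e ∘ g) (e' ∘ h) := by
  induction t generalizing v g h with
  | zero =>
    simp only [IterFormula.Stage, hφ, WLFormula, ← initFormula_iff e e' L hL hg hh, ht.ne',
      forall_const, not_true_eq_false, false_and, false_imp_iff, and_true]
  | succ t ih =>
    have hord : orderOfLength L.length = n := by
      rw [hL, length_append_cayleyCode, orderOfLength_add_self]
    rw [← stepFormula_iff e e' hord (fun v g h hg hh => ih (by omega) hg hh) hg hh]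
    simp [IterFormula.Stage, hφ, WLFormula, ht.ne']

end Correctness

theorem stage_iff_exists_wlEquiv {k : ℕ} {G H : Type} [Group G] [Group H] {n m : ℕ}
    (e : Fin n ≃ G) (e' : Fin m ≃ H) {T : ℕ → ℕ} {φ : IterFormula (WLVar k)}
    (hφ : ∀ n x E t v, φ.Holds n x E t v ↔ WLFormula T n x E t v) {L : List Bool}
    (hL : L = cayleyCode e ++ cayleyCode e') {r : ℕ} (hT : T L.length = r + 1)
    (v : WLVar k → Fin (L.length + 2)) :
    φ.Stage L.length L.get (r + 1) v ↔
      n = m ∧ ∃ (g : G) (h : H), WLEquiv r (fun _ : Fin k => g) fun _ : Fin k => h := by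
  have hlt := orderOfLength_lt L.length
  have hhead : ((∀ c : Fin (L.length + 2), (c : ℕ) < orderOfLength L.length → Reads L.get c) ∧
      ¬ Reads L.get (orderOfLength L.length)) ↔ orderOfLength L.length = n := by
    rw [← header_iff e (cayleyCode e'), ← hL]
    simp only [reads_get_iff]
    exact and_congr_left fun _ => ⟨fun h c hc => h ⟨c, by omega⟩ hc, fun h c hc => h c hc⟩
  have hlen : L.length = codeLength n + codeLength m := by
    rw [hL, List.length_append, length_cayleyCode, length_cayleyCode]
  have hnm : orderOfLength L.length = n ↔ n = m := by
    constructor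
    · intro h
      -- The value `0` is also the default of `orderOfLength`, but a group is nonempty.
      have hn : n ≠ 0 := by
        rintro rfl
        exact (e.symm 1).elim0
      have := codeLength_orderOfLength (h.trans_ne hn)
      rw [h] at this
      exact codeLength_strictMono.injective (by omega)
    · rintro rfl
      rw [hlen, orderOfLength_add_self]
  simp only [IterFormula.Stage, hφ, WLFormula, hT, FinalFormula]
  rw [← and_assoc (c := ∃ c : Fin (L.length + 2), _), hhead, hnm]
  simp only [(Nat.succ_ne_zero r).symm, and_false, false_imp_iff, not_true_eq_false, true_and,
    forall_const]
  refine and_congr_right fun h => ?_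
  subst h
  rw [hnm.2 rfl]
  rw [hnm.2 rfl] at hlt
  have key (c d : Fin n) (c' d' : Fin (L.length + 2)) (hc : (c' : ℕ) = c) (hd : (d' : ℕ) = d) :
      (φ.Stage L.length L.get r fun a => setNew v c' d' (constVar a)) ↔
        WLEquiv r (fun _ : Fin k => e c) fun _ : Fin k => e' d :=
    stage_iff e e' hφ hL (by omega) (g := fun _ => c) (h := fun _ => d)
      (fun i => by simp [setNew, constVar, hc]) (fun i => by simp [setNew, constVar, hd])
  constructor
  · rintro ⟨c, hc, d, hd, h⟩
    exact ⟨_, _, (key ⟨c, hc⟩ ⟨d, hd⟩ c d rfl rfl).1 h⟩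
  · rintro ⟨g, h, hgh⟩
    obtain ⟨c, rfl⟩ := e.surjective g
    obtain ⟨d, rfl⟩ := e'.surjective h
    exact ⟨⟨c, by omega⟩, c.isLt, ⟨d, by omega⟩, d.isLt, (key c d _ _ rfl rfl).2 hgh⟩

/-- Equality of order and equivalence of some constant `k`-tuples after `O(log log n)` rounds of
count-free refinement is decided in `β₁MAC⁰(FOLL)`, and so is the complement. -/
theorem exists_language_wlEquiv (k c : ℕ) :
    ∃ L ∈ beta1MAC0FOLL, ∃ L' ∈ beta1MAC0FOLL,
      ∀ (G H : Type) [Group G] [Group H] (n m : ℕ) (e : Fin n ≃ G) (e' : Fin m ≃ H) (N : ℕ),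
        N = (cayleyCode e ++ cayleyCode e').length → c * loglog N ≤ N →
        (cayleyCode e ++ cayleyCode e' ∈ L ↔ n = m ∧ ∃ (g : G) (h : H),
          WLEquiv (c * loglog N) (fun _ : Fin k => g) fun _ : Fin k => h) ∧
        (cayleyCode e ++ cayleyCode e' ∈ L' ↔ ¬ (n = m ∧ ∃ (g : G) (h : H),
          WLEquiv (c * loglog N) (fun _ : Fin k => g) fun _ : Fin k => h)) := by
  -- The extra stage is for the final formula.
  have hT : FOTerm (α := Empty) fun n _ => c * loglog n + 1 :=
    ((FOTerm.const c).mul FOTerm.loglog).add FOTerm.one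
  obtain ⟨φ, hφ⟩ := definable_wlFormula (k := k) hT
  obtain ⟨L, hL, L', hL', h⟩ := exists_mem_beta1MAC0FOLL φ hT (c := c + 1) fun n => by
    rw [add_mul]
    omega
  refine ⟨L, hL, L', hL', ?_⟩
  rintro G H _ _ n m e e' _ rfl hN
  have h₁ := h (cayleyCode e ++ cayleyCode e') (by omega)
  rwa [stage_iff_exists_wlEquiv e e' hφ rfl rfl] at h₁

/-! ### Groups of CFI graphs -/

/-- Equal multisets of colours give groups of the same order with tuples of the same colour. -/
theorem card_eq_and_exists_wlEquiv_of_not_differ {k r : ℕ} (hk : k ≠ 0) {G H : Type} [Group G]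
    [Group H] [Finite G] [Finite H] (h : ¬ ColorMultisetsDiffer k r G H) :
    Nat.card G = Nat.card H ∧ ∃ (g : Fin k → G) (h : Fin k → H), WLEquiv r g h := by
  simp only [ColorMultisetsDiffer, not_exists, not_not] at h
  -- Colour classes of equal size are matched by bijections, which glue to a bijection of all
  -- `k`-tuples; as `k ≠ 0`, the orders agree.
  have hequiv : (Fin k → G) ≃ (Fin k → H) :=
    (Equiv.sigmaFiberEquiv (wlColor groupInit r)).symm.trans
      ((Equiv.sigmaCongrRight fun c => (Finite.card_eq.1 (h c)).some).trans
        (Equiv.sigmaFiberEquiv (wlColor groupInit r)))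
  refine ⟨?_, fun _ => 1, ?_⟩
  · have := Nat.card_congr hequiv
    rw [Nat.card_fun, Nat.card_fun, Nat.card_fin] at this
    exact Nat.pow_left_injective hk this
  · have hpos : 0 < colorMultiplicity G k r (wlColor groupInit r fun _ => (1 : G)) := by
      have : Nonempty {g : Fin k → G //
          wlColor groupInit r g = wlColor groupInit r fun _ => (1 : G)} :=
        ⟨⟨_, rfl⟩⟩
      exact Nat.card_pos
    rw [h] at hpos
    obtain ⟨⟨h, hh⟩⟩ := (Nat.card_pos_iff.1 hpos).1
    exact ⟨h, hh.symm⟩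

section CFIGroup

variable {p : ℕ} {V : Type} {Γ : SimpleGraph V} {G : Type} [Group G]

theorem IsCFIGroup.exists_twist (h : IsCFIGroup p Γ G) :
    ∃ T : Set (Sym2 V), Nonempty (G ≃* MeklerGroup p (twistedCFI Γ T)) := by
  rcases h with h | ⟨e, -, h⟩
  · exact ⟨∅, h⟩
  · exact ⟨{e}, h⟩

theorem finite_mekler_twistedCFI (hp : p.Prime) (hΓ : IsBaseGraph Γ) (T : Set (Sym2 V)) :
    Finite (MeklerGroup p (twistedCFI Γ T)) := by
  have := hΓ.1
  have : Fact (1 < p) := ⟨hp.one_lt⟩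
  have := Fintype.ofFinite (CFIVertex Γ)
  infer_instance

theorem IsBaseGraph.nontrivial_cfiVertex (hΓ : IsBaseGraph Γ) : Nontrivial (CFIVertex Γ) := by
  obtain ⟨-, hconn, hloc, hreg⟩ := hΓ
  obtain ⟨v⟩ := hconn.nonempty
  obtain ⟨w, hw⟩ := (Γ.degree_pos_iff_exists_adj v).1 (by rw [hreg v]; omega)
  exact ⟨.ext ⟨(v, w), hw⟩ true, .ext ⟨(v, w), hw⟩ false, by simp⟩

/-- Order at least nine makes the code long enough for the number of rounds to be bounded by the
input length. -/
theorem nine_le_card_mekler_twistedCFI (hp : p.Prime) (hp2 : 2 < p) (hΓ : IsBaseGraph Γ)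
    (T : Set (Sym2 V)) : 9 ≤ Nat.card (MeklerGroup p (twistedCFI Γ T)) := by
  have := hΓ.1
  have : Fact (1 < p) := ⟨hp.one_lt⟩
  have := Fintype.ofFinite (CFIVertex Γ)
  have := hΓ.nontrivial_cfiVertex
  calc 9 = 3 ^ 2 := by norm_num
    _ ≤ p ^ 2 := Nat.pow_le_pow_left hp2 2
    _ ≤ p ^ Fintype.card (CFIVertex Γ) := Nat.pow_le_pow_right hp.pos Fintype.one_lt_card
    _ ≤ _ := pow_card_le_card_mekler

theorem iso_of_wlEquiv_mekler_twistedCFI (hp : p.Prime) (hp2 : 2 < p) (hΓ : IsBaseGraph Γ)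
    {T : Set (Sym2 V)} (ψ : G ≃* MeklerGroup p (twistedCFI Γ T))
    {H : Type} [Group H] [Finite H] (hcard : Nat.card G = Nat.card H) {g : Fin 20 → G}
    {h : Fin 20 → H} {r : ℕ} (hr : 48 * loglog (Nat.card G) ≤ r) (e : WLEquiv r g h) :
    Nonempty (G ≃* H) := by
  have := hΓ.1
  have : Fact p.Prime := ⟨hp⟩
  have := Fintype.ofFinite (CFIVertex Γ)
  obtain ⟨col, hcol⟩ := exists_isSparse_twistedCFI hΓ T
  have hG := Nat.card_congr ψ.toEquiv
  rw [hG] at hcard hr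
  obtain ⟨θ⟩ := mekler_iso_of_wlEquiv hcol (hp.odd_of_ne_two hp2.ne') hcard hr
    (((WLEquiv.of_mulEquiv ψ r g).symm).trans e)
  exact ⟨ψ.trans θ⟩

theorem colorMultisetsDiffer_of_not_iso (hp : p.Prime) (hp2 : 2 < p) (hΓ : IsBaseGraph Γ)
    {T : Set (Sym2 V)} (ψ : G ≃* MeklerGroup p (twistedCFI Γ T))
    {H : Type} [Group H] [Finite H] (hiso : ¬ Nonempty (G ≃* H)) {r : ℕ}
    (hr : 48 * loglog (Nat.card G) ≤ r) : ColorMultisetsDiffer 20 r G H := by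
  have := finite_mekler_twistedCFI hp hΓ T
  have := Finite.of_equiv _ ψ.symm.toEquiv
  by_contra hdiff
  obtain ⟨hcard, g, h, e⟩ := card_eq_and_exists_wlEquiv_of_not_differ (by norm_num) hdiff
  exact hiso (iso_of_wlEquiv_mekler_twistedCFI hp hp2 hΓ ψ hcard hr e)

theorem mekler_cfi_not_iso (hp : p.Prime) (hp2 : 2 < p) (hΓ : IsBaseGraph Γ) {e : Sym2 V}
    (he : e ∈ Γ.edgeSet) :
    ¬ Nonempty (MeklerGroup p (CFI Γ) ≃* MeklerGroup p (twistedCFI Γ {e})) := by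
  rintro ⟨ψ⟩
  have := hΓ.1
  have : Fact p.Prime := ⟨hp⟩
  have := Fintype.ofFinite (CFIVertex Γ)
  obtain ⟨col, hcol⟩ := exists_isSparse_twistedCFI hΓ ∅
  obtain ⟨col', hcol'⟩ := exists_isSparse_twistedCFI hΓ {e}
  obtain ⟨θ⟩ := graph_iso_of_mekler_iso hcol hcol' (hp.odd_of_ne_two hp2.ne') ψ
  exact (cfi_not_iso hΓ.isCubic hΓ.2.1 he).elim θ

theorem loglog_mono : Monotone loglog := fun _ _ h => Nat.log_mono_right (Nat.log_mono_right h)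

theorem mul_loglog_le {N : ℕ} (hN : 96 ≤ N) : 48 * loglog N ≤ N := by
  have h₁ : 2 ^ Nat.log 2 N ≤ N := Nat.pow_log_le_self 2 (by omega)
  have h₂ : 2 ^ loglog N ≤ Nat.log 2 N :=
    Nat.pow_log_le_self 2 (Nat.log_pos one_lt_two (by omega)).ne'
  generalize loglog N = b at h₂ ⊢
  by_cases hb : b ≤ 2
  · omega
  -- With `b = loglog N`, the number `N` is at least `2 ^ 2 ^ b`. For `b ≥ 3` this is at least `2 ^
  -- (b + 5) = 32 * 2 ^ b`, hence at least `48 * b`; for `b ≤ 2` the hypothesis `96 ≤ N` suffices.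
  have h₃ : ∀ b, 3 ≤ b → b + 5 ≤ 2 ^ b ∧ 48 * b ≤ 32 * 2 ^ b := by
    intro b hb
    induction b, hb using Nat.le_induction with
    | base => norm_num
    | succ b hb ih => rw [pow_succ]; omega
  obtain ⟨h₄, h₅⟩ := h₃ b (by omega)
  calc 48 * b ≤ 32 * 2 ^ b := h₅
    _ = 2 ^ (b + 5) := by rw [pow_add]; ring
    _ ≤ 2 ^ Nat.log 2 N := Nat.pow_le_pow_right two_pos (h₄.trans h₂)
    _ ≤ N := h₁

/-- Isomorphism of Mekler groups of CFI graphs with arbitrary groups. -/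
theorem isoDecidableIn_of_isCFIGroup {P : (G H : Type) → [Group G] → [Group H] → Prop}
    (hP : ∀ (G H : Type) [Group G] [Group H], P G H → ∃ (p : ℕ) (V : Type) (Γ : SimpleGraph V),
      p.Prime ∧ 2 < p ∧ IsBaseGraph Γ ∧ IsCFIGroup p Γ G) :
    IsoDecidableIn beta1MAC0FOLL P := by
  obtain ⟨L, hL, L', hL', h⟩ := exists_language_wlEquiv 20 48
  have key (G H : Type) [Group G] [Group H] (n m : ℕ) (e : Fin n ≃ G) (e' : Fin m ≃ H)
      (hGH : P G H) : (cayleyCode e ++ cayleyCode e' ∈ L ↔ Nonempty (G ≃* H)) ∧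
        (cayleyCode e ++ cayleyCode e' ∈ L' ↔ ¬ Nonempty (G ≃* H)) := by
    obtain ⟨p, V, Γ, hp, hp2, hΓ, hG⟩ := hP G H hGH
    obtain ⟨T, ⟨ψ⟩⟩ := hG.exists_twist
    have hn : Nat.card G = n := by rw [← Nat.card_congr e, Nat.card_fin]
    have hm : Nat.card H = m := by rw [← Nat.card_congr e', Nat.card_fin]
    have hn9 : 9 ≤ n := by
      rw [← hn, Nat.card_congr ψ.toEquiv]
      exact nine_le_card_mekler_twistedCFI hp hp2 hΓ T
    have hlen : codeLength n ≤ (cayleyCode e ++ cayleyCode e').length := by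
      rw [List.length_append, length_cayleyCode]
      exact Nat.le_add_right _ _
    have hcode : 96 ≤ codeLength n :=
      le_trans (by norm_num [codeLength, Nat.clog]) (codeLength_strictMono.monotone hn9)
    obtain ⟨h₁, h₂⟩ := h G H n m e e' _ rfl (mul_loglog_le (hcode.trans hlen))
    -- Any equivalent pair of tuples forces isomorphism, and an isomorphism matches the constant
    -- tuples of identities, so constant tuples decide.
    have hiff : (n = m ∧ ∃ (g : G) (h : H), WLEquiv
        (48 * loglog (cayleyCode e ++ cayleyCode e').length) (fun _ : Fin 20 => g)
          fun _ : Fin 20 => h) ↔ Nonempty (G ≃* H) := by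
      constructor
      · rintro ⟨rfl, g, h, hgh⟩
        have := Finite.of_equiv _ e'
        refine iso_of_wlEquiv_mekler_twistedCFI hp hp2 hΓ ψ (hn.trans hm.symm) ?_ hgh
        -- The rounds are counted by the input length, which exceeds the group order.
        refine Nat.mul_le_mul_left 48 (loglog_mono (le_trans ?_ hlen))
        rw [hn, codeLength]
        omega
      · rintro ⟨θ⟩
        exact ⟨by rw [← hn, ← hm, Nat.card_congr θ.toEquiv], 1, θ 1,
          WLEquiv.of_mulEquiv θ _ fun _ => 1⟩
    rw [hiff] at h₁ h₂
    exact ⟨h₁, h₂⟩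
  exact ⟨⟨L, hL, fun G H _ _ n m e e' hGH => (key G H n m e e' hGH).1⟩,
    ⟨L', hL', fun G H _ _ n m e e' hGH => (key G H n m e e' hGH).2⟩⟩

end CFIGroup

end CFIGroups

theorem mainTheorem1 :
    -- (a) colour multisets
    (∃ k C : ℕ, 2 ≤ k ∧
      ∀ (p : ℕ), p.Prime → 2 < p →
      ∀ (V : Type) (Γ₀ : SimpleGraph V), IsBaseGraph Γ₀ → ∀ e ∈ Γ₀.edgeSet,
        ColorMultisetsDiffer k (C * loglog (Nat.card (MeklerGroup p (CFI Γ₀))))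
          (MeklerGroup p (CFI Γ₀)) (MeklerGroup p (twistedCFI Γ₀ {e}))) ∧
    -- (a) isomorphism test
    IsoDecidableIn beta1MAC0FOLL (fun G H _ _ =>
      ∃ (p : ℕ) (V : Type) (Γ₀ : SimpleGraph V),
        p.Prime ∧ 2 < p ∧ IsBaseGraph Γ₀ ∧ IsCFIGroup p Γ₀ G ∧ IsCFIGroup p Γ₀ H) ∧
    -- (b) colour multisets
    (∃ k C : ℕ, 2 ≤ k ∧
      ∀ (p : ℕ), p.Prime → 2 < p →
      ∀ (V : Type) (Γ₀ : SimpleGraph V), IsBaseGraph Γ₀ →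
      ∀ r : ℕ, GraphIdentified 3 r Γ₀ →
      ∀ (G : Type) [Group G], IsCFIGroup p Γ₀ G →
      ∀ (H : Type) [Group H] [Finite H], ¬ Nonempty (G ≃* H) →
        ColorMultisetsDiffer k (max r (C * loglog (Nat.card G))) G H) ∧
    -- (b) isomorphism test
    IsoDecidableIn beta1MAC0FOLL (fun G _ _ _ =>
      ∃ (p : ℕ) (V : Type) (Γ₀ : SimpleGraph V) (r : ℕ),
        p.Prime ∧ 2 < p ∧ IsBaseGraph Γ₀ ∧ GraphIdentified 3 r Γ₀ ∧ IsCFIGroup p Γ₀ G) := by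
  -- Dimension `20` and factor `48` are those of `mekler_iso_of_wlEquiv`.
  refine ⟨⟨20, 48, by norm_num, fun p hp hp2 V Γ₀ hΓ e he => ?_⟩,
    isoDecidableIn_of_isCFIGroup ?_,
    ⟨20, 48, by norm_num, fun p hp hp2 V Γ₀ hΓ r _ G _ hG H _ _ hiso => ?_⟩,
    isoDecidableIn_of_isCFIGroup ?_⟩
  · have := finite_mekler_twistedCFI hp hΓ {e}
    exact colorMultisetsDiffer_of_not_iso (T := ∅) hp hp2 hΓ (MulEquiv.refl _)
      (mekler_cfi_not_iso hp hp2 hΓ he) le_rfl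
  · rintro G H _ _ ⟨p, V, Γ₀, hp, hp2, hΓ, hG, -⟩
    exact ⟨p, V, Γ₀, hp, hp2, hΓ, hG⟩
  · obtain ⟨T, ⟨ψ⟩⟩ := hG.exists_twist
    exact colorMultisetsDiffer_of_not_iso hp hp2 hΓ ψ hiso (le_max_right _ _)
  · rintro G H _ _ ⟨p, V, Γ₀, r, hp, hp2, hΓ, -, hG⟩
    exact ⟨p, V, Γ₀, hp, hp2, hΓ, hG⟩
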